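/- **Setting.** Let $F$ be a non-archimedean local field of characteristic $2$ with residue field of cardinality $q$, and let $E/F$ be a totally ramified quadratic Galois extension of discriminant $\mathfrak p_F^{d+1}$ with $d>0$ odd. Fix uniformizers $\varpi$ of $F$ and $\pi$ of $E$ with $\pi^2+\Delta\pi+\varpi=0$, where $\Delta\in F$ has $\mathrm{ord}_F(\Delta)=\frac{d+1}2$. Let $\tau$ be the non-trivial element of $\mathrm{Gal}(E/F)$ and $\varepsilon=\tau(\pi)/\pi$. Let $\iota\colon E\to \mathrm{Mat}_{2}(F)$ be the $F$-algebra embedding with $\pi\mapsto\begin{pmatrix}\Delta&1\\ \varpi&0\end{pmatrix}$. For $L=F,E$ let $I_L=\begin{pmatrix}\mathcal O_L^\times&\mathcal O_L\\ \mathfrak p_L&\mathcal O_L^\times\end{pmatrix}$. Let $n\ge1$ with $2n>d$, put $m=2n+d-1$, $N=n+d+m+1$ and $$J=\begin{pmatrix}1+\mathfrak p_E^{m+1}&\mathfrak p_E^m\\ \mathfrak p_E^{m+1}&1+\mathfrak p_E^{m+1}\end{pmatrix}\subseteq GL_2(E).$$ Write $e_+(a)=\begin{pmatrix}1&a\\0&1\end{pmatrix}$,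 $e_-(a)=\begin{pmatrix}1&0\\a&1\end{pmatrix}$, $e_0(b,c)=\begin{pmatrix}b&0\\0&c\end{pmatrix}$. Let $$\dot w=\begin{pmatrix}0&\pi^{-n}\\ \pi^n&0\end{pmatrix}e_0\big(\varepsilon^{\lfloor n/2\rfloor},\varepsilon^{-\lfloor (n+1)/2\rfloor}\big),\qquad \dot v=\begin{pmatrix}0&\pi^{-(\frac{d+1}2+\lfloor\frac{n+1}2\rfloor)}\\ \pi^{\frac{d+1}2+\lfloor\frac n2\rfloor}&0\end{pmatrix}.$$ Let $X=\{xJ\in GL_2(E)/J: x^{-1}\tau(x)\in J\dot wJ\}$ and let $X_P\subseteq X$ be the set of points lying over some $e_-(a)\dot vI_E$ with $a\in\mathfrak p_E\smallsetminus\mathfrak p_E^2$. Let $Z$ be the center of $GL_2$ and let $\widetilde\Gamma\subseteq Z(E)I_E/J$ be the stabilizer of $J\dot wJ$ under $(i,J\dot wJ)\mapsto i^{-1}J\dot wJ\,\tau(i)$; it acts on $X$ by right multiplication. Let $\widetilde X=X_P\cdot\widetilde\Gamma$. For $t\in E^\times$ and $r\in\mathcal O_E$ let $P_r=1+\varepsilon^n\pi^{2n}r\tau(r)$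 and let $i(t,r)$ be the class of $$e_+(r)\,e_-\big(\varepsilon^n\pi^{2n}\tau(r)P_r^{-1}\big)\,e_0\big(t,\tau(t)P_r^{-1}\big).$$ Let $\ell$ be a prime and let $\tilde\theta$ be a $\overline{\mathbb Q}_\ell^\times$-valued character of $\widetilde\Gamma$. Let $V_{\tilde\theta}$ be the $\tilde\theta$-isotypic part of $H^0_c(\widetilde X,\overline{\mathbb Q}_\ell)$: the largest quotient of the space of finitely supported functions on $\widetilde X$ in which $\delta_{x\gamma}=\tilde\theta(\gamma)\delta_x$ for all $x\in\widetilde X$, $\gamma\in\widetilde\Gamma$. Let $\Xi_{\tilde\theta}$ be the representation of $\iota(E^\times)I_F$ on $V_{\tilde\theta}$ given by $g\,\delta_x=\delta_{gx}$. For $a\in\mathfrak p_E\smallsetminus\mathfrak p_E^2$ put $R=R(a)=\pi^{-(d+1)}(\tau(a)+a)$. For $a\in(\mathfrak p_E/\mathfrak p_E^{N})^*:=(\mathfrak p_E/\mathfrak p_E^{N})\smallsetminus(\mathfrak p_E^2/\mathfrak p_E^{N})$ and $C\in U_E/U_E^{m+1}$ let $$x(a,C)=e_-(a)\,\dot v\,e_-(\pi^nR^{-1})\,e_0\big(C,\varepsilon^{\frac{d+1}2}\tau(C)R^{-1}\big)J.$$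 **Proposition.** The elements $i(t,r)$ ($t\in E^\times$, $r\in\mathcal O_E$) lie in $\widetilde\Gamma$, the set $\widetilde X$ is stable under $\iota(E^\times)I_F$, and $V_{\tilde\theta}$ is finite-dimensional. Let $g\in\iota(E^\times)I_F$, $s=\mathrm{ord}_F(\det g)$, and $\beta_g(y)=g\,y\,i(\pi,0)^{-s}$. There are $\beta_g(a)\in(\mathfrak p_E/\mathfrak p_E^{N})^*$ and $\beta'_{g,a}\in U_E/U_E^{m+1}$, depending only on $g$ and on $a\in(\mathfrak p_E/\mathfrak p_E^{N})^*$, such that $$\beta_g(x(a,C))=x(\beta_g(a),\beta'_{g,a}C)\quad\text{for all } a, C.$$ With the finite set $A_g=\{a\in(\mathfrak p_E/\mathfrak p_E^{N})^*:\beta_g(a)\equiv a \bmod \mathfrak p_E^{n+d+1}\}$ and, for $a\in A_g$, $h(g,a)=\pi^{-(n+d+1)}(\beta_g(a)-a)\in\mathcal O_E/\mathfrak p_E^m$, one has $$\mathrm{tr}(g;\Xi_{\tilde\theta})=\frac1{q^m}\,\tilde\theta(i(\pi,0))^{\mathrm{ord}_F(\det g)}\sum_{a\in A_g}\tilde\theta(i(t_a,\bar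 r_a)),$$ where $$\bar r_a=R^{-1}h(g,a)\big(1+\pi^nh(g,a)R^{-1}\big)^{-1}\in\mathcal O_E/\mathfrak p_E^d,\qquad t_a=\beta'_{g,a}\big(1+\pi^nh(g,a)R^{-1}\big)^{-1}\in U_E/U_E^{m+1},$$ and $\tilde\theta(i(t_a,\bar r_a))$ is the value of $\tilde\theta$ at $i(t,r)$ for any lifts $t\in U_E$ of $t_a$ and $r\in\mathcal O_E$ of $\bar r_a$ (it does not depend on the lifts). -/

import Mathlib

open ValuativeRel
open scoped Matrix MatrixGroups

noncomputable section

namespace WildGL2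

/-! ### Powers of the maximal ideal, the Iwahori subgroup and its level subgroups -/

section LevelSubgroups

variable (L : Type*) [Field L] [ValuativeRel L]

/-- The power `𝔭_L ^ k` of the maximal ideal, as a subset of the field `L`. -/
def pp (k : ℕ) : Submodule 𝒪[L] L :=
  Submodule.map (Algebra.linearMap 𝒪[L] L) (𝓂[L] ^ k)

variable {L}

theorem mem_pp {k : ℕ} {x : L} : x ∈ pp L k ↔ ∃ y ∈ 𝓂[L] ^ k, (y : L) = x := by
  unfold pp
  rw [Submodule.mem_map]
  rfl

theorem mul_mem_pp {j k : ℕ} {x y : L} (hx : x ∈ pp L j) (hy : y ∈ pp L k) :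
    x * y ∈ pp L (j + k) := by
  obtain ⟨a, ha, rfl⟩ := mem_pp.1 hx
  obtain ⟨b, hb, rfl⟩ := mem_pp.1 hy
  exact mem_pp.2 ⟨a * b, by rw [pow_add]; exact Ideal.mul_mem_mul ha hb, rfl⟩

theorem pp_anti {j k : ℕ} (h : j ≤ k) {x : L} (hx : x ∈ pp L k) : x ∈ pp L j := by
  obtain ⟨a, ha, rfl⟩ := mem_pp.1 hx
  exact mem_pp.2 ⟨a, Ideal.pow_le_pow_right h ha, rfl⟩

theorem valuation_le_one_of_mem_pp {k : ℕ} {x : L} (hx : x ∈ pp L k) : valuation L x ≤ 1 := by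
  obtain ⟨a, _, rfl⟩ := mem_pp.1 hx
  exact a.2

theorem valuation_lt_one_of_mem_pp {k : ℕ} {x : L} (hx : x ∈ pp L (k + 1)) :
    valuation L x < 1 := by
  have h1 := pp_anti (Nat.succ_le_succ (Nat.zero_le k)) hx
  obtain ⟨a, ha, rfl⟩ := mem_pp.1 h1
  rw [pow_one, IsLocalRing.mem_maximalIdeal] at ha
  refine lt_of_le_of_ne a.2 fun h => ha ?_
  exact (Valuation.integer.integers (valuation L)).isUnit_iff_valuation_eq_one.2 h

theorem mem_pp_zero {x : L} (hx : valuation L x ≤ 1) : x ∈ pp L 0 :=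
  mem_pp.2 ⟨⟨x, hx⟩, by simp, rfl⟩

variable (L)

/-- The standard Iwahori subgroup of `GL₂(L)`, with entries
`(𝒪ˣ, 𝒪; 𝔭, 𝒪ˣ)`. -/
def iwahori : Subgroup (GL (Fin 2) L) where
  carrier := {g | valuation L (g 0 0) = 1 ∧ valuation L (g 0 1) ≤ 1 ∧
    valuation L (g 1 0) < 1 ∧ valuation L (g 1 1) = 1}
  one_mem' := by simp
  mul_mem' := by
    rintro g h ⟨a, b, c, e⟩ ⟨a', b', c', e'⟩
    have key1 : valuation L (g 0 1 * h 1 0) < 1 := by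
      rw [map_mul]; exact mul_lt_one_of_nonneg_of_lt_one_right b zero_le c'
    have key2 : valuation L (g 1 0 * h 0 1) < 1 := by
      rw [map_mul]; exact mul_lt_one_of_nonneg_of_lt_one_left zero_le c b'
    simp only [Set.mem_ofPred_eq, Units.val_mul, Matrix.mul_apply, Fin.sum_univ_two]
    refine ⟨?_, ?_, ?_, ?_⟩
    · rw [Valuation.map_add_eq_of_lt_left] <;> simp_all
    · refine (Valuation.map_add _ _ _).trans (max_le ?_ ?_) <;> simp_all
    · refine (Valuation.map_add_lt _ ?_ ?_) <;> simp_all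
    · rw [Valuation.map_add_eq_of_lt_right] <;> simp_all
  inv_mem' := by
    rintro g ⟨a, b, c, e⟩
    have key2 : valuation L (g 0 1 * g 1 0) < 1 := by
      rw [map_mul]; exact mul_lt_one_of_nonneg_of_lt_one_right b zero_le c
    have hd : valuation L (g.1.det) = 1 := by
      rw [Matrix.det_fin_two, sub_eq_add_neg, Valuation.map_add_eq_of_lt_left] <;>
        simp_all [Valuation.map_neg]
    simp only [Set.mem_ofPred_eq, Matrix.coe_units_inv, Matrix.inv_def, Matrix.adjugate_fin_two,
      Ring.inverse_eq_inv', Matrix.smul_apply, smul_eq_mul, map_mul, map_inv₀, hd]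
    simp_all [Valuation.map_neg]

/-- The level subgroup `I_L^{2m+1}` of `GL₂(L)`, with entries
`(1 + 𝔭 ^ (m+1), 𝔭 ^ m; 𝔭 ^ (m+1), 1 + 𝔭 ^ (m+1))`. -/
def level (m : ℕ) : Subgroup (GL (Fin 2) L) where
  carrier := {g | g 0 0 - 1 ∈ pp L (m + 1) ∧ g 0 1 ∈ pp L m ∧
    g 1 0 ∈ pp L (m + 1) ∧ g 1 1 - 1 ∈ pp L (m + 1)}
  one_mem' := by simp
  mul_mem' := by
    rintro g h ⟨a, b, c, e⟩ ⟨a', b', c', e'⟩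
    simp only [Set.mem_ofPred_eq, Units.val_mul, Matrix.mul_apply, Fin.sum_univ_two]
    refine ⟨?_, ?_, ?_, ?_⟩
    · have := add_mem (add_mem (pp_anti (by omega) (mul_mem_pp a a')) (add_mem a a'))
        (pp_anti (j := m + 1) (by omega) (mul_mem_pp b c'))
      convert this using 1; ring
    · have := add_mem (add_mem (pp_anti (by omega) (mul_mem_pp a b')) (add_mem b b'))
        (pp_anti (j := m) (by omega) (mul_mem_pp b e'))
      convert this using 1; ring
    · have := add_mem (add_mem (pp_anti (by omega) (mul_mem_pp c a')) (add_mem c c'))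
        (pp_anti (j := m + 1) (by omega) (mul_mem_pp e c'))
      convert this using 1; ring
    · have := add_mem (add_mem (pp_anti (by omega) (mul_mem_pp e e')) (add_mem e e'))
        (pp_anti (j := m + 1) (by omega) (mul_mem_pp c b'))
      convert this using 1; ring
  inv_mem' := by
    rintro g ⟨a, b, c, e⟩
    have hdet : g.1.det - 1 ∈ pp L (m + 1) := by
      have := sub_mem (add_mem (pp_anti (by omega) (mul_mem_pp a e)) (add_mem a e))
        (pp_anti (j := m + 1) (by omega) (mul_mem_pp b c))
      rw [Matrix.det_fin_two]
      convert this using 1; ring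
    have hv : valuation L g.1.det = 1 := by
      have h1 : g.1.det = (g.1.det - 1) + 1 := by ring
      rw [h1, Valuation.map_add_eq_of_lt_right, map_one]
      rw [map_one]; exact valuation_lt_one_of_mem_pp hdet
    have hne : g.1.det ≠ 0 := by
      intro h0; rw [h0, map_zero] at hv; exact zero_ne_one hv
    have hi : (g.1.det)⁻¹ ∈ pp L 0 := mem_pp_zero (by rw [map_inv₀, hv, inv_one])
    simp only [Set.mem_ofPred_eq, Matrix.coe_units_inv, Matrix.inv_def, Matrix.adjugate_fin_two,
      Ring.inverse_eq_inv', Matrix.smul_apply, smul_eq_mul]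
    refine ⟨?_, ?_, ?_, ?_⟩
    · have := mul_mem_pp hi (sub_mem e hdet)
      rw [zero_add] at this
      convert this using 1; simp; field_simp
    · have := mul_mem_pp hi (neg_mem b)
      rw [zero_add] at this
      simpa using this
    · have := mul_mem_pp hi (neg_mem c)
      rw [zero_add] at this
      simpa using this
    · have := mul_mem_pp hi (sub_mem a hdet)
      rw [zero_add] at this
      convert this using 1; simp; field_simp

end LevelSubgroups

/-! ### Some elements of `GL₂` -/

section Elements

variable {L : Type*} [Field L]

/-- `e₊(a) = (1, a; 0, 1)`. -/
def ePlus (a : L) : GL (Fin 2) L where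
  val := !![1, a; 0, 1]
  inv := !![1, -a; 0, 1]
  val_inv := by simp [Matrix.one_fin_two]
  inv_val := by simp [Matrix.one_fin_two]

/-- `e₋(a) = (1, 0; a, 1)`. -/
def eMinus (a : L) : GL (Fin 2) L where
  val := !![1, 0; a, 1]
  inv := !![1, 0; -a, 1]
  val_inv := by simp [Matrix.one_fin_two]
  inv_val := by simp [Matrix.one_fin_two]

/-- `e₀(b, c) = (b, 0; 0, c)`. -/
def eZero (b c : Lˣ) : GL (Fin 2) L where
  val := !![(b : L), 0; 0, c]
  inv := !![((b⁻¹ : Lˣ) : L), 0; 0, ((c⁻¹ : Lˣ) : L)]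
  val_inv := by simp [Matrix.one_fin_two]
  inv_val := by simp [Matrix.one_fin_two]

/-- The antidiagonal matrix `(0, b; c, 0)`. -/
def antiDiag (b c : Lˣ) : GL (Fin 2) L where
  val := !![0, (b : L); c, 0]
  inv := !![0, ((c⁻¹ : Lˣ) : L); ((b⁻¹ : Lˣ) : L), 0]
  val_inv := by simp [Matrix.one_fin_two]
  inv_val := by simp [Matrix.one_fin_two]

open Classical in
/-- A nonzero element `x`, regarded as a unit (the value at `x = 0` is never used). -/
def unitOf (x : L) : Lˣ := if h : x = 0 then 1 else Units.mk0 x h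

end Elements

/-! ### The varieties and the group acting on the right

`E / F` is the quadratic extension, `τ` the nontrivial element of its Galois group, `π` the
uniformizer of `E`. -/

section Varieties

variable {F E : Type*} [Field F] [Field E] [Algebra F E] [ValuativeRel E]
variable (τ : E ≃ₐ[F] E) (π : Eˣ) (d n m : ℕ)

/-- `ε = τ(π) / π`. -/
def eps : Eˣ := Units.map (τ : E →* E) π * π⁻¹

/-- The action of `τ` on `GL₂(E)`. -/
def tauGL : GL (Fin 2) E →* GL (Fin 2) E :=
  Matrix.GeneralLinearGroup.map (τ : E →+* E)

/-- `ẇ = (0, π ^ (-n); π ^ n, 0) · (ε ^ ⌊n/2⌋, 0; 0, ε ^ (-⌊(n+1)/2⌋))`. -/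
def wDot : GL (Fin 2) E :=
  antiDiag (π ^ n)⁻¹ (π ^ n) *
    eZero (eps τ π ^ (n / 2)) (eps τ π ^ ((n + 1) / 2))⁻¹

/-- `v̇ = (0, π ^ (-(⌊(d+1)/2⌋ + ⌊(n+1)/2⌋)); π ^ (⌊(d+1)/2⌋ + ⌊n/2⌋), 0)`. -/
def vDot : GL (Fin 2) E :=
  antiDiag (π ^ ((d + 1) / 2 + (n + 1) / 2))⁻¹ (π ^ ((d + 1) / 2 + n / 2))

/-- The double coset `J ẇ J` for `J = I_E^{2m+1}`. -/
def dblCoset : Set (GL (Fin 2) E) :=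
  DoubleCoset.doubleCoset (wDot τ π n) (level E m : Set (GL (Fin 2) E)) (level E m)

/-- The extended affine Deligne-Lusztig variety `X_ẇ^m(1)`: the set of all `x J` in `GL₂(E) / J`
with `x⁻¹ τ(x) ∈ J ẇ J`. -/
def X : Set (GL (Fin 2) E ⧸ level E m) :=
  {y | ∃ x : GL (Fin 2) E, (x : GL (Fin 2) E ⧸ level E m) = y ∧
    x⁻¹ * tauGL τ x ∈ dblCoset τ π n m}

/-- The subset `X_ẇ^m(1)_{P_{1/2}}` of `X_ẇ^m(1)`: the points lying over the locus `a₁ ≠ 0` in the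
Schubert cell of `v`, that is, over `e₋(a) v̇ I_E` with `a ∈ 𝔭_E` and `a ∉ 𝔭_E²`. -/
def XP : Set (GL (Fin 2) E ⧸ level E m) :=
  {y | y ∈ X τ π n m ∧ ∃ a ∈ pp E 1, a ∉ pp E 2 ∧ ∃ i ∈ iwahori E,
    ((eMinus a * vDot π d n * i : GL (Fin 2) E) : GL (Fin 2) E ⧸ level E m) = y}

/-- The preimage in `Z(E) I_E` of the group `Γ̃ ⊆ Z(E) I_E / J`: the stabilizer of the double coset
`J ẇ J` under `(i, S) ↦ i⁻¹ S τ(i)`. -/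
def gammaTilde : Subgroup (GL (Fin 2) E) where
  carrier := {i | i ∈ Subgroup.center (GL (Fin 2) E) ⊔ iwahori E ∧
    ∀ x, i⁻¹ * x * tauGL τ i ∈ dblCoset τ π n m ↔ x ∈ dblCoset τ π n m}
  one_mem' := ⟨one_mem _, by simp⟩
  mul_mem' := by
    rintro i j ⟨hi, hi'⟩ ⟨hj, hj'⟩
    refine ⟨mul_mem hi hj, fun x => ?_⟩
    rw [← hi' x, ← hj' (i⁻¹ * x * tauGL τ i)]
    simp only [map_mul, _root_.mul_inv_rev, mul_assoc]
  inv_mem' := by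
    rintro i ⟨hi, hi'⟩
    refine ⟨inv_mem hi, fun x => ?_⟩
    rw [← hi' (i⁻¹⁻¹ * x * tauGL τ i⁻¹)]
    simp [mul_assoc]

/-- `X̃_ẇ^m(1)_{P_{1/2}}`: the union of all `Γ̃`-translates of `X_ẇ^m(1)_{P_{1/2}}`. -/
def XTilde : Set (GL (Fin 2) E ⧸ level E m) :=
  {y | ∃ x i : GL (Fin 2) E, (x : GL (Fin 2) E ⧸ level E m) ∈ XP τ π d n m ∧
    i ∈ gammaTilde τ π n m ∧ ((x * i : GL (Fin 2) E) : GL (Fin 2) E ⧸ level E m) = y}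

/-- `P_r = 1 + ε ^ n π ^ (2n) r τ(r)`. -/
def P (r : E) : E := 1 + (eps τ π : E) ^ n * (π : E) ^ (2 * n) * r * τ r

/-- `i(t, r) = (1, r; 0, 1) (1, 0; ε ^ n π ^ (2n) τ(r) P_r⁻¹, 1) (t, 0; 0, τ(t) P_r⁻¹)`. -/
def iElt (t : Eˣ) (r : E) : GL (Fin 2) E :=
  ePlus r * eMinus ((eps τ π : E) ^ n * (π : E) ^ (2 * n) * τ r * (P τ π n r)⁻¹) *
    eZero t (Units.map (τ : E →* E) t * (unitOf (P τ π n r))⁻¹)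

/-! ### The representation -/

variable {τ π d n m} in
/-- `θ̃` factors through `Γ̃`, that is, it is trivial on `J = I_E^{2m+1}`. -/
def TrivialOnLevel {K : Type*} [Field K] (θ : gammaTilde τ π n m →* Kˣ) : Prop :=
  ∀ j : gammaTilde τ π n m, (j : GL (Fin 2) E) ∈ level E m → θ j = 1

variable {τ π n m} in
/-- The relations `δ_{x γ} = θ̃(γ) δ_x` (`x ∈ X̃`, `γ ∈ Γ̃`) among finitely supported functions. -/
def relations {K : Type*} [Field K] (θ : gammaTilde τ π n m →* Kˣ) :
    Submodule K (XTilde τ π d n m →₀ K) :=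
  Submodule.span K {f | ∃ (x : GL (Fin 2) E) (i : gammaTilde τ π n m)
    (h : (x : GL (Fin 2) E ⧸ level E m) ∈ XTilde τ π d n m)
    (h' : ((x * i : GL (Fin 2) E) : GL (Fin 2) E ⧸ level E m) ∈ XTilde τ π d n m),
    f = Finsupp.single ⟨_, h'⟩ 1 - (θ i : K) • Finsupp.single ⟨_, h⟩ 1}

variable {τ π n m} in
/-- `V_θ̃ = H⁰_c(X̃)[θ̃]`: for the discrete set `X̃`, the space `H⁰_c` is that of all finitely
supported functions, spanned by the `δ_x`; the group `Γ̃` acts by `δ_x ↦ δ_{x γ}`, and `V_θ̃` is the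
largest quotient on which it acts through `θ̃`. -/
abbrev V {K : Type*} [Field K] (θ : gammaTilde τ π n m →* Kˣ) : Type _ :=
  (XTilde τ π d n m →₀ K) ⧸ relations d θ

/-- The inclusion `GL₂(F) → GL₂(E)`. -/
def toGLE : GL (Fin 2) F →* GL (Fin 2) E :=
  Matrix.GeneralLinearGroup.map (algebraMap F E)

variable [ValuativeRel F]

/-- The subgroup `ι(Eˣ) I_F` of `GL₂(F)`. -/
def torusIwahori (ι : E →ₐ[F] Matrix (Fin 2) (Fin 2) F) : Subgroup (GL (Fin 2) F) :=
  (Units.map (ι : E →* Matrix (Fin 2) (Fin 2) F)).range ⊔ iwahori F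

variable {τ π n m} in
/-- The representation `Ξ_θ̃` of `ι(Eˣ) I_F` on `V_θ̃`, induced by left multiplication
`δ_x ↦ δ_{g x}` on the `ι(Eˣ) I_F`-stable set `X̃`. -/
def Xi (ι : E →ₐ[F] Matrix (Fin 2) (Fin 2) F)
    (hX : ∀ g ∈ torusIwahori ι, ∀ y ∈ XTilde τ π d n m,
      toGLE (E := E) g • y ∈ XTilde τ π d n m)
    {K : Type*} [Field K] (θ : gammaTilde τ π n m →* Kˣ) :
    Representation K (torusIwahori ι) (V d θ) where
  toFun g := (relations d θ).mapQ (relations d θ)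
    (Finsupp.lmapDomain K K fun y : XTilde τ π d n m =>
      (⟨toGLE (E := E) g.1 • y.1, hX g.1 g.2 y.1 y.2⟩ : XTilde τ π d n m))
    (by
      rw [relations, Submodule.span_le]
      rintro f ⟨x, i, h, h', rfl⟩
      have e := hX g.1 g.2 _ h
      have e' := hX g.1 g.2 _ h'
      refine Submodule.subset_span ⟨toGLE g.1 * x, i, e, ?_, ?_⟩
      · rw [mul_assoc]; exact e'
      · rw [map_sub, map_smul, Finsupp.lmapDomain_apply, Finsupp.lmapDomain_apply,
          Finsupp.mapDomain_single, Finsupp.mapDomain_single]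
        congr 3
        simp only [MulAction.Quotient.smul_coe, smul_eq_mul, mul_assoc])
  map_one' := by
    apply Submodule.linearMap_qext
    ext y
    simp
  map_mul' g h := by
    apply Submodule.linearMap_qext
    ext y
    simp [mul_smul]

/-! ### Coordinates on `X_ẇ^m(1)_{P_{1/2}}` and the action of `β_g` on them -/

/-- `R = π ^ (-(d+1)) (τ(a) + a)`. -/
def R (a : E) : E := ((π : E) ^ (d + 1))⁻¹ * (τ a + a)

/-- A representative in `GL₂(E)` of the point `x(a, C)` with coordinates `a`, `C`:
`e₋(a) v̇ e₋(B) e₀(C, D)` with `B = π ^ n R⁻¹` and `D = ε ^ ⌊(d+1)/2⌋ τ(C) R⁻¹`. -/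
def pt (a : E) (C : Eˣ) : GL (Fin 2) E :=
  eMinus a * vDot π d n * eMinus ((π : E) ^ n * (R τ π d a)⁻¹) *
    eZero C (eps τ π ^ ((d + 1) / 2) * Units.map (τ : E →* E) C * (unitOf (R τ π d a))⁻¹)

variable (E)

/-- `𝒪_E / 𝔭_E ^ k`. -/
abbrev Quo (k : ℕ) : Type _ := 𝒪[E] ⧸ 𝓂[E] ^ k

variable {E}

/-- The class in `𝒪_E / 𝔭_E ^ k` of an integer of `E`. -/
abbrev cls (k : ℕ) (a : 𝒪[E]) : Quo E k := Ideal.Quotient.mk (𝓂[E] ^ k) a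

/-- The class in `U_E / U_E ^ k = (𝒪_E / 𝔭_E ^ k)ˣ` of a unit. -/
abbrev ucls (k : ℕ) (c : 𝒪[E]ˣ) : (Quo E k)ˣ :=
  Units.map (Ideal.Quotient.mk (𝓂[E] ^ k) : 𝒪[E] →* Quo E k) c

/-- A unit of `𝒪_E`, as an element of `Eˣ`. -/
abbrev toE (c : 𝒪[E]ˣ) : Eˣ := Units.map (algebraMap 𝒪[E] E : 𝒪[E] →* E) c

variable (E) in
/-- `(𝔭_E / 𝔭_E ^ k)^* = (𝔭_E / 𝔭_E ^ k) ∖ (𝔭_E² / 𝔭_E ^ k)`. -/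
def star (k : ℕ) : Set (Quo E k) := {x | ∃ a ∈ 𝓂[E], a ∉ 𝓂[E] ^ 2 ∧ cls k a = x}

/-- `bA` and `bC` describe `β_g` in coordinates, where `β_g(y) = g y i(π,0) ^ (-s)` and
`s = ord_F (det g)`: for all `a ∈ (𝔭_E / 𝔭_E ^ (n+d+m+1))^*` and `C ∈ U_E / U_E ^ (m+1)` one has
`bA a ∈ (𝔭_E / 𝔭_E ^ (n+d+m+1))^*` and `β_g(x(a, C)) = x(bA a, bC a * C)`. In other words,
`β_g(a) = bA a` and `β'_{g,a} = bC a`. -/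
def IsBeta (g : GL (Fin 2) F) (s : ℤ)
    (bA : Quo E (n + d + m + 1) → Quo E (n + d + m + 1))
    (bC : Quo E (n + d + m + 1) → (Quo E (m + 1))ˣ) : Prop :=
  ∀ a ∈ 𝓂[E], a ∉ 𝓂[E] ^ 2 → bA (cls _ a) ∈ star E (n + d + m + 1) ∧
    ∀ (b : 𝒪[E]) (C C' : 𝒪[E]ˣ), cls _ b = bA (cls _ a) →
      ucls (m + 1) C' = bC (cls _ a) * ucls (m + 1) C →
      ((toGLE g * pt τ π d n a (toE C) * iElt τ π n π 0 ^ (-s) : GL (Fin 2) E) :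
          GL (Fin 2) E ⧸ level E m) =
        (pt τ π d n b (toE C') : GL (Fin 2) E)

variable {d n m} in
/-- `A_g = {a ∈ (𝔭_E / 𝔭_E ^ (n+d+m+1))^* : β_g(a) ≡ a mod 𝔭_E ^ (n+d+1)}`. -/
def fixSet (bA : Quo E (n + d + m + 1) → Quo E (n + d + m + 1)) :
    Set (Quo E (n + d + m + 1)) :=
  {x | x ∈ star E (n + d + m + 1) ∧ ∃ a b : 𝒪[E], cls _ a = x ∧ cls _ b = bA x ∧
    b - a ∈ 𝓂[E] ^ (n + d + 1)}

variable {d n m} in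
/-- For `x ∈ A_g`: the unit `t` represents `t_x ∈ U_E / U_E ^ (m+1)` and the integer `r` represents
`r̄_x ∈ 𝒪_E / 𝔭_E ^ d`, where, with `h = π ^ (-(n+d+1)) (β_g(x) - x)`,
`r̄_x = R⁻¹ h (1 + π ^ n h R⁻¹)⁻¹` and `t_x = β'_{g,x} (1 + π ^ n h R⁻¹)⁻¹`. -/
def Represents (bA : Quo E (n + d + m + 1) → Quo E (n + d + m + 1))
    (bC : Quo E (n + d + m + 1) → (Quo E (m + 1))ˣ)
    (x : Quo E (n + d + m + 1)) (t : 𝒪[E]ˣ) (r : 𝒪[E]) : Prop :=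
  ∃ (a b : 𝒪[E]) (c : 𝒪[E]ˣ) (h u : E),
    cls _ a = x ∧ cls _ b = bA x ∧ ucls (m + 1) c = bC x ∧
    h = ((π : E) ^ (n + d + 1))⁻¹ * ((b : E) - a) ∧
    u = (1 + (π : E) ^ n * h * (R τ π d a)⁻¹)⁻¹ ∧
    (r : E) - (R τ π d a)⁻¹ * h * u ∈ pp E d ∧
    (toE t : E) - (toE c : E) * u ∈ pp E (m + 1)

end Varieties

end WildGL2

end

set_option linter.unusedSectionVars false

noncomputable section

namespace WildGL2

/-! ### Powers of the maximal ideal described by the valuation -/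

section Integers

variable {L : Type*} [Field L] [ValuativeRel L]

/-! The representatives `pt` satisfy τ(x) = x ẇ exactly, not only modulo J (`pt_twisted`). Hence the
transition element g = x⁻¹x' between two of them satisfies ẇ τ(g) = g ẇ, and such a g with unit
upper left and integral upper right entry is an i(t, r), with t and r read off from its first row
(`eq_iElt_of_twisted`).

Orbits. In a point of X over e₋(a) v̇ I with a a uniformizer, the upper unipotent part of the
Iwahori factor passes through v̇ into the coordinate a, and the defining condition of X forces what
remains into J. So every point of X_P is some x(b, C) (`exists_pt_eq`). The class of a modulo
𝔭^(n+d+1) is invariant under right translation by Z(E) I_E (`sub_mem_of_pt_coset_eq`). Conversely,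
points with the same class differ by an explicit i(t, r) (`exists_pt_eq_pt_mul_iElt`). Thus the
Γ̃-orbits on X̃ correspond to the classes of uniformizers modulo 𝔭^(n+d+1). Since θ̃ is trivial on
J, each orbit carries a function `orbitFun` transforming by θ̃. These functions give a family of
functionals dual to the vectors δ_{x(a,1)}, which therefore form a basis of V.

Left action. An element g of ι(Eˣ) I_F moves the coordinate a by a fractional linear transformation,
up to a right factor in π^s I_E (`movesCell_of_mem`). Right multiplication by i(π, 0)^(-s) removes
π^s. As g is fixed by τ, the twisted equation survives, and the classification of points yields β_g.
Right multiplication by i(C, 0) commutes with i(π, 0), which gives the shape of the dependence on C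
(`exists_isBeta`).

Trace. The diagonal coefficient at the orbit of a vanishes unless β_g(a) ≡ a modulo 𝔭^(n+d+1), and
otherwise g x(a, 1) = x(a, 1) i(t, r) i(π, 0)^s. The closed formulas for t and r hold modulo 𝔭^(m+1)
and 𝔭^d only. This is enough by `character_iElt_congr`: modulo J, the elements e₊(𝔭^d) are
commutators in Γ̃, so θ̃ does not see them. Summing over a modulo 𝔭^(n+d+m+1) instead of 𝔭^(n+d+1)
counts every orbit q^m times, whence the factor q^(-m). -/

theorem mul_mem_pp_of_le_one {k : ℕ} {x y : L} (hx : valuation L x ≤ 1) (hy : y ∈ pp L k) :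
    x * y ∈ pp L k := by
  simpa using mul_mem_pp (mem_pp_zero hx) hy

theorem mul_mem_pp_of_le_one' {k : ℕ} {x y : L} (hx : valuation L x ≤ 1) (hy : y ∈ pp L k) :
    y * x ∈ pp L k := by
  rw [mul_comm]; exact mul_mem_pp_of_le_one hx hy

theorem mem_pp_one_iff {x : L} : x ∈ pp L 1 ↔ valuation L x < 1 := by
  refine ⟨fun h => valuation_lt_one_of_mem_pp (k := 0) h, fun h => ?_⟩
  refine mem_pp.2 ⟨⟨x, h.le⟩, ?_, rfl⟩
  rw [pow_one, IsLocalRing.mem_maximalIdeal]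
  exact fun hu => h.ne ((Valuation.integer.integers (valuation L)).isUnit_iff_valuation_eq_one.1 hu)

theorem mem_maximalIdeal_iff {x : 𝒪[L]} : x ∈ 𝓂[L] ↔ valuation L (x : L) < 1 := by
  rw [← mem_pp_one_iff, mem_pp]
  refine ⟨fun h => ⟨x, by simpa using h, rfl⟩, ?_⟩
  rintro ⟨y, hy, h⟩
  rw [Subtype.ext h] at hy
  simpa using hy

theorem coe_mem_pp {k : ℕ} {x : 𝒪[L]} : (x : L) ∈ pp L k ↔ x ∈ 𝓂[L] ^ k := by
  rw [mem_pp]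
  refine ⟨?_, fun h => ⟨x, h, rfl⟩⟩
  rintro ⟨y, hy, h⟩
  rwa [Subtype.ext h] at hy

/-- An element of `L` with valuation less than `1` such that no value lies strictly between. -/
theorem mem_pp_iff_le {p : L} (hp0 : p ≠ 0) (hp : valuation L p < 1)
    (hmax : ∀ x : L, valuation L x < 1 → valuation L x ≤ valuation L p) {k : ℕ} {x : L} :
    x ∈ pp L k ↔ valuation L x ≤ valuation L p ^ k := by
  constructor
  · rw [mem_pp]
    rintro ⟨y, hy, rfl⟩
    have hspan : 𝓂[L] = Ideal.span {(⟨p, hp.le⟩ : 𝒪[L])} := by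
      refine le_antisymm (fun z hz => ?_) ?_
      · rw [mem_maximalIdeal_iff] at hz
        rw [Ideal.mem_span_singleton]
        refine ⟨⟨(z : L) / p, ?_⟩, Subtype.ext ?_⟩
        · change valuation L _ ≤ 1
          rw [map_div₀]
          exact div_le_one_of_le₀ (hmax _ hz) zero_le
        · change (z : L) = p * (z / p)
          field_simp
      · rw [Ideal.span_singleton_le_iff_mem, mem_maximalIdeal_iff]
        exact hp
    rw [hspan, Ideal.span_singleton_pow, Ideal.mem_span_singleton] at hy
    obtain ⟨z, rfl⟩ := hy
    change valuation L (p ^ k * z) ≤ _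
    rw [map_mul, map_pow]
    exact mul_le_of_le_one_right' z.2
  · intro h
    have hpm : p ∈ pp L 1 := mem_pp_one_iff.2 hp
    have hpk : p ^ k ∈ pp L k := by
      refine mem_pp.2 ⟨⟨p, hp.le⟩ ^ k, Ideal.pow_mem_pow (mem_maximalIdeal_iff.2 hp) k, rfl⟩
    have : x = (x / p ^ k) * p ^ k := by field_simp
    rw [this]
    refine mul_mem_pp_of_le_one ?_ hpk
    rw [map_div₀, map_pow]
    exact div_le_one_of_le₀ h zero_le

theorem valuation_eq_one_of_sub_mem {k : ℕ} {x y : L} (h : x - y ∈ pp L (k + 1))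
    (hy : valuation L y = 1) : valuation L x = 1 := by
  have : x = (x - y) + y := by ring
  rw [this, Valuation.map_add_eq_of_lt_right, hy]
  rw [hy]; exact valuation_lt_one_of_mem_pp h

theorem mul_sub_mul_mem_pp {k : ℕ} {x y x' y' : L} (hx : x - x' ∈ pp L k) (hy : y - y' ∈ pp L k)
    (hvx : valuation L x' ≤ 1) (hvy : valuation L y ≤ 1) : x * y - x' * y' ∈ pp L k := by
  have h1 := add_mem (mul_mem_pp_of_le_one' hvy hx) (mul_mem_pp_of_le_one hvx hy)
  convert h1 using 1; ring

theorem inv_sub_inv_mem_pp {k : ℕ} {x y : L} (h : x - y ∈ pp L k) (hx : valuation L x = 1)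
    (hy : valuation L y = 1) : x⁻¹ - y⁻¹ ∈ pp L k := by
  have hx0 : x ≠ 0 := fun h => by simp [h] at hx
  have hy0 : y ≠ 0 := fun h => by simp [h] at hy
  have h1 : valuation L (-(x⁻¹ * y⁻¹)) ≤ 1 := by rw [Valuation.map_neg]; simp [hx, hy]
  convert mul_mem_pp_of_le_one h1 h using 1
  field_simp
  ring

end Integers

/-! ### The group J as one plus a lattice stable under the Iwahori subgroup -/

section Lattice

variable (L : Type*) [Field L] [ValuativeRel L]

/-- The matrices with entries in `(𝔭 ^ (m+1), 𝔭 ^ m; 𝔭 ^ (m+1), 𝔭 ^ (m+1))`. -/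
def levelLattice (m : ℕ) : AddSubgroup (Matrix (Fin 2) (Fin 2) L) where
  carrier := {g | g 0 0 ∈ pp L (m + 1) ∧ g 0 1 ∈ pp L m ∧ g 1 0 ∈ pp L (m + 1) ∧
    g 1 1 ∈ pp L (m + 1)}
  zero_mem' := by simp
  add_mem' := by
    rintro g h ⟨a, b, c, e⟩ ⟨a', b', c', e'⟩
    exact ⟨add_mem a a', add_mem b b', add_mem c c', add_mem e e'⟩
  neg_mem' := by
    rintro g ⟨a, b, c, e⟩
    exact ⟨neg_mem a, neg_mem b, neg_mem c, neg_mem e⟩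

variable {L} {m : ℕ}

theorem mem_levelLattice {g : Matrix (Fin 2) (Fin 2) L} :
    g ∈ levelLattice L m ↔ g 0 0 ∈ pp L (m + 1) ∧ g 0 1 ∈ pp L m ∧ g 1 0 ∈ pp L (m + 1) ∧
    g 1 1 ∈ pp L (m + 1) := Iff.rfl

theorem mem_level {g : GL (Fin 2) L} : g ∈ level L m ↔ g 0 0 - 1 ∈ pp L (m + 1) ∧
    g 0 1 ∈ pp L m ∧ g 1 0 ∈ pp L (m + 1) ∧ g 1 1 - 1 ∈ pp L (m + 1) := Iff.rfl

theorem mem_iwahori {g : GL (Fin 2) L} : g ∈ iwahori L ↔ valuation L (g 0 0) = 1 ∧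
    valuation L (g 0 1) ≤ 1 ∧ valuation L (g 1 0) < 1 ∧ valuation L (g 1 1) = 1 := Iff.rfl

theorem mem_level_iff_sub_mem {g : GL (Fin 2) L} :
    g ∈ level L m ↔ (g : Matrix (Fin 2) (Fin 2) L) - 1 ∈ levelLattice L m := by
  simp [mem_level, mem_levelLattice]

/-- The only product that needs more than integrality is the lower left entry in 𝔭 times the upper
right entry in 𝔭^m, which lands in 𝔭^(m+1). -/
theorem iwahori_mul_mem {g : GL (Fin 2) L} (hg : g ∈ iwahori L) {x : Matrix (Fin 2) (Fin 2) L}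
    (hx : x ∈ levelLattice L m) : (g : Matrix (Fin 2) (Fin 2) L) * x ∈ levelLattice L m := by
  obtain ⟨a, b, c, e⟩ := mem_iwahori.1 hg
  obtain ⟨a', b', c', e'⟩ := mem_levelLattice.1 hx
  have hc := mem_pp_one_iff.2 c
  simp only [mem_levelLattice, Matrix.mul_apply, Fin.sum_univ_two]
  refine ⟨add_mem (mul_mem_pp_of_le_one a.le a') (mul_mem_pp_of_le_one b c'),
    add_mem (mul_mem_pp_of_le_one a.le b') (mul_mem_pp_of_le_one b (pp_anti (by omega) e')),
    add_mem (mul_mem_pp_of_le_one c.le a') (mul_mem_pp_of_le_one e.le c'), add_mem ?_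
    (mul_mem_pp_of_le_one e.le e')⟩
  rw [add_comm m 1]; exact mul_mem_pp hc b'

theorem mul_iwahori_mem {g : GL (Fin 2) L} (hg : g ∈ iwahori L) {x : Matrix (Fin 2) (Fin 2) L}
    (hx : x ∈ levelLattice L m) : x * (g : Matrix (Fin 2) (Fin 2) L) ∈ levelLattice L m := by
  obtain ⟨a, b, c, e⟩ := mem_iwahori.1 hg
  obtain ⟨a', b', c', e'⟩ := mem_levelLattice.1 hx
  have hc := mem_pp_one_iff.2 c
  simp only [mem_levelLattice, Matrix.mul_apply, Fin.sum_univ_two]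
  refine ⟨add_mem (mul_mem_pp_of_le_one' a.le a') (mul_mem_pp b' hc),
    add_mem (mul_mem_pp_of_le_one' b (pp_anti (by omega) a')) (mul_mem_pp_of_le_one' e.le b'),
    add_mem (mul_mem_pp_of_le_one' a.le c') (mul_mem_pp_of_le_one' c.le e'),
    add_mem (mul_mem_pp_of_le_one' b c') (mul_mem_pp_of_le_one' e.le e')⟩

/-- Since x⁻¹y − 1 = x⁻¹(y − x), equality of cosets modulo J reduces to entrywise congruences as
soon as one representative lies in the Iwahori subgroup. -/
theorem inv_mul_mem_level {x y : GL (Fin 2) L} (hx : x ∈ iwahori L)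
    (h : (y : Matrix (Fin 2) (Fin 2) L) - x ∈ levelLattice L m) : x⁻¹ * y ∈ level L m := by
  rw [mem_level_iff_sub_mem]
  convert iwahori_mul_mem (inv_mem hx) h using 1
  rw [mul_sub, Units.val_mul, ← Units.val_mul x⁻¹ x, inv_mul_cancel, Units.val_one]

theorem level_le_iwahori : level L m ≤ iwahori L := by
  rintro g ⟨a, b, c, e⟩
  exact ⟨valuation_eq_one_of_sub_mem a (map_one _), valuation_le_one_of_mem_pp b,
    valuation_lt_one_of_mem_pp c, valuation_eq_one_of_sub_mem e (map_one _)⟩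

theorem conj_mem_level {i j : GL (Fin 2) L} (hi : i ∈ iwahori L) (hj : j ∈ level L m) :
    i * j * i⁻¹ ∈ level L m := by
  rw [mem_level_iff_sub_mem] at hj ⊢
  convert mul_iwahori_mem (inv_mem hi) (iwahori_mul_mem hi hj) using 1
  rw [mul_sub, sub_mul, mul_one, Units.val_mul, Units.val_mul, ← Units.val_mul i i⁻¹,
    mul_inv_cancel, Units.val_one]

theorem center_sup_iwahori_le_normalizer :
    Subgroup.center (GL (Fin 2) L) ⊔ iwahori L ≤ Subgroup.normalizer (level L m) := by
  refine sup_le (Subgroup.center_le_normalizer _) fun i hi => Subgroup.mem_normalizer_iff.2 fun j =>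
    ⟨conj_mem_level hi, fun h => ?_⟩
  have := conj_mem_level (inv_mem hi) h
  simpa [mul_assoc] using this

theorem conj_mem_level_iff {i j : GL (Fin 2) L}
    (hi : i ∈ Subgroup.center (GL (Fin 2) L) ⊔ iwahori L) :
    i⁻¹ * j * i ∈ level L m ↔ j ∈ level L m :=
  (Subgroup.mem_normalizer_iff''.1 (center_sup_iwahori_le_normalizer hi) j).symm

theorem exists_of_mem_center_sup_iwahori {i : GL (Fin 2) L}
    (hi : i ∈ Subgroup.center (GL (Fin 2) L) ⊔ iwahori L) :
    ∃ (z : Lˣ), ∃ j ∈ iwahori L, ∀ a b, i a b = z * j a b := by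
  obtain ⟨c, hc, j, hj, rfl⟩ := Subgroup.mem_sup_of_normal_left.1 hi
  rw [Matrix.GeneralLinearGroup.center_eq_range_scalar] at hc
  obtain ⟨z, rfl⟩ := hc
  exact ⟨z, j, hj, fun a b => by simp [Matrix.GeneralLinearGroup.scalar]⟩

/-- The entry 1 forces the central factor to be a unit, so the matrix has the integrality of an
Iwahori element. -/
theorem valuation_le_one_of_unipotent {i : GL (Fin 2) L}
    (hi : i ∈ Subgroup.center (GL (Fin 2) L) ⊔ iwahori L) (h : i 0 0 = 1) :
    valuation L (i 0 1) ≤ 1 := by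
  obtain ⟨z, j, hj, hz⟩ := exists_of_mem_center_sup_iwahori hi
  obtain ⟨a, b, -, -⟩ := mem_iwahori.1 hj
  have h1 : valuation L ((z : L) * j 0 0) = 1 := by rw [← hz, h, map_one]
  rw [map_mul, a, mul_one] at h1
  rw [hz, map_mul, h1, one_mul]
  exact b

end Lattice


/-! ### Entries of the elementary matrices -/

section Entries

variable {L : Type*} [Field L]

theorem coe_ePlus (a : L) : (ePlus a : Matrix (Fin 2) (Fin 2) L) = !![1, a; 0, 1] := rfl

theorem coe_eMinus (a : L) : (eMinus a : Matrix (Fin 2) (Fin 2) L) = !![1, 0; a, 1] := rfl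

theorem coe_eZero (b c : Lˣ) :
    (eZero b c : Matrix (Fin 2) (Fin 2) L) = !![(b : L), 0; 0, c] := rfl

theorem coe_antiDiag (b c : Lˣ) :
    (antiDiag b c : Matrix (Fin 2) (Fin 2) L) = !![0, (b : L); c, 0] := rfl

theorem coe_unitOf {x : L} (hx : x ≠ 0) : (unitOf x : L) = x := by simp [unitOf, hx]

theorem GL_ext {g h : GL (Fin 2) L} (h1 : g 0 0 = h 0 0) (h2 : g 0 1 = h 0 1)
    (h3 : g 1 0 = h 1 0) (h4 : g 1 1 = h 1 1) : g = h := by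
  ext i j
  fin_cases i <;> fin_cases j <;> assumption

theorem coe_mul_apply (g h : GL (Fin 2) L) (i j : Fin 2) :
    (g * h) i j = g i 0 * h 0 j + g i 1 * h 1 j := by
  simp [Matrix.mul_apply, Fin.sum_univ_two]

end Entries

/-! ### The wildly ramified quadratic extension, axiomatized by valuations -/

variable {F E : Type*} [Field F] [Field E] [Algebra F E] [ValuativeRel E]

/-- The properties of the ramified quadratic extension in characteristic `2` that are used:
`π` is a uniformizer of `E`, `τ` is an isometric involution, and `d` is its ramification number. -/
structure IsWild (τ : E ≃ₐ[F] E) (π : Eˣ) (d : ℕ) : Prop where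
  two_eq_zero : (2 : E) = 0
  lt_one : valuation E (π : E) < 1
  exists_zpow : ∀ x : E, x ≠ 0 → ∃ k : ℤ, valuation E x = valuation E (π : E) ^ k
  val_tau : ∀ x, valuation E (τ x) = valuation E x
  tau_tau : ∀ x, τ (τ x) = x
  val_tau_add_le : ∀ x, valuation E (τ x + x) ≤ valuation E (π : E) ^ d * valuation E x
  val_tau_add_eq : ∀ x, valuation E x = valuation E (π : E) →
    valuation E (τ x + x) = valuation E (π : E) ^ (d + 1)

theorem tauGL_apply (τ : E ≃ₐ[F] E) (g : GL (Fin 2) E) (i j : Fin 2) :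
    tauGL τ g i j = τ (g i j) := rfl

namespace IsWild

variable {τ : E ≃ₐ[F] E} {π : Eˣ} {d : ℕ}

section

variable (h : IsWild τ π d)
include h

theorem sub_eq (x y : E) : x - y = x + y := by linear_combination (-y) * h.two_eq_zero

theorem val_pos : 0 < valuation E (π : E) := by simp [zero_lt_iff]

theorem val_ne_zero : valuation E (π : E) ≠ 0 := h.val_pos.ne'

theorem zpow_lt_zpow_iff {i j : ℤ} :
    valuation E (π : E) ^ i < valuation E (π : E) ^ j ↔ j < i :=
  zpow_lt_zpow_iff_right_of_lt_one₀ h.val_pos h.lt_one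

theorem zpow_le_zpow_iff {i j : ℤ} :
    valuation E (π : E) ^ i ≤ valuation E (π : E) ^ j ↔ j ≤ i :=
  zpow_le_zpow_iff_right_of_lt_one₀ h.val_pos h.lt_one

theorem zpow_inj {i j : ℤ} :
    valuation E (π : E) ^ i = valuation E (π : E) ^ j ↔ i = j := by
  rw [le_antisymm_iff, h.zpow_le_zpow_iff, h.zpow_le_zpow_iff]; omega

theorem le_of_lt_one {x : E} (hx : valuation E x < 1) : valuation E x ≤ valuation E (π : E) := by
  rcases eq_or_ne x 0 with rfl | h0
  · simp
  obtain ⟨k, hk⟩ := h.exists_zpow x h0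
  rw [hk, ← zpow_one (valuation E (π : E)), ← zpow_mul, h.zpow_le_zpow_iff]
  rw [hk, ← zpow_zero (valuation E (π : E)), h.zpow_lt_zpow_iff] at hx
  omega

theorem mem_pp {k : ℕ} {x : E} : x ∈ pp E k ↔ valuation E x ≤ valuation E (π : E) ^ k :=
  mem_pp_iff_le π.ne_zero h.lt_one fun _ => h.le_of_lt_one

theorem pow_mem_pp (k : ℕ) : (π : E) ^ k ∈ pp E k := h.mem_pp.2 (by rw [map_pow])

theorem inv_pow_mul_mem_pp {j k : ℕ} {x : E} (hx : x ∈ pp E (j + k)) :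
    ((π : E) ^ j)⁻¹ * x ∈ pp E k := by
  rw [h.mem_pp] at hx ⊢
  rw [map_mul, map_inv₀, map_pow, inv_mul_le_iff₀ (pow_pos h.val_pos _), ← pow_add]
  exact hx

theorem uniformizer_iff {x : E} :
    (x ∈ pp E 1 ∧ x ∉ pp E 2) ↔ valuation E x = valuation E (π : E) := by
  rw [h.mem_pp, h.mem_pp, pow_one]
  refine ⟨fun ⟨h1, h2⟩ => ?_, fun h1 => ⟨h1.le, ?_⟩⟩
  · have h0 : x ≠ 0 := by rintro rfl; simp at h2
    obtain ⟨k, hk⟩ := h.exists_zpow x h0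
    rw [hk] at h1 h2 ⊢
    rw [← zpow_natCast, h.zpow_le_zpow_iff] at h2
    have h1' : valuation E (π : E) ^ k ≤ valuation E (π : E) ^ (1 : ℤ) := by simpa using h1
    rw [h.zpow_le_zpow_iff] at h1'
    have : k = 1 := by push_cast at h2; omega
    simp [this]
  · rw [h1, not_le]
    calc valuation E (π : E) ^ 2 = valuation E (π : E) * valuation E (π : E) := sq _
      _ < valuation E (π : E) * 1 := mul_lt_mul_of_pos_left h.lt_one h.val_pos
      _ = _ := mul_one _

theorem tau_mem_pp {k : ℕ} {x : E} (hx : x ∈ pp E k) : τ x ∈ pp E k := by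
  rw [h.mem_pp] at hx ⊢; rwa [h.val_tau]

theorem tau_add_mem_pp {k : ℕ} {x : E} (hx : x ∈ pp E k) : τ x + x ∈ pp E (k + d) := by
  rw [h.mem_pp] at hx ⊢
  refine (h.val_tau_add_le x).trans ?_
  rw [add_comm, pow_add]
  gcongr

omit h in
theorem coe_eps (τ : E ≃ₐ[F] E) (π : Eˣ) : (eps τ π : E) = τ π * (π : E)⁻¹ := by simp [eps]

theorem val_eps : valuation E (eps τ π : E) = 1 := by
  rw [coe_eps, map_mul, h.val_tau, map_inv₀, mul_inv_cancel₀ h.val_ne_zero]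

omit h in
theorem tau_pi (τ : E ≃ₐ[F] E) (π : Eˣ) : τ π = eps τ π * π := by simp [coe_eps]

/-- In characteristic 2, ε − 1 = (τ(π) + π)/π. -/
theorem eps_sub_one_mem : (eps τ π : E) - 1 ∈ pp E d := by
  have := h.inv_pow_mul_mem_pp (j := 1) (k := d) (h.tau_add_mem_pp (x := π) (k := 1)
    (by simpa using h.pow_mem_pp 1))
  rw [tau_pi] at this
  convert this using 1
  rw [h.sub_eq]
  field_simp

theorem tau_eps : τ (eps τ π : E) = (eps τ π : E)⁻¹ := by
  have : τ π ≠ 0 := by simp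
  rw [coe_eps, map_mul, h.tau_tau, map_inv₀]
  field_simp

end

end IsWild

/-! ### The twisted Galois action g ↦ ẇ τ(g) ẇ⁻¹ -/

section Twist

/-- `ε ^ n π ^ (2n)`, the `n`-th power of the norm of `π`. -/
def epsPi (τ : E ≃ₐ[F] E) (π : Eˣ) (n : ℕ) : E := (eps τ π : E) ^ n * (π : E) ^ (2 * n)

variable {τ : E ≃ₐ[F] E} {π : Eˣ} {d : ℕ} (n : ℕ)

theorem coe_wDot : (wDot τ π n : Matrix (Fin 2) (Fin 2) E) =
    !![0, ((π : E) ^ n)⁻¹ * ((eps τ π : E) ^ ((n + 1) / 2))⁻¹;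
      (π : E) ^ n * (eps τ π : E) ^ (n / 2), 0] := by
  simp [wDot, coe_antiDiag, coe_eZero]

theorem eps_pow_half : (eps τ π : E) ^ (n / 2) * (eps τ π : E) ^ ((n + 1) / 2) =
    (eps τ π : E) ^ n := by
  rw [← pow_add]; congr 1; omega

variable {n} (h : IsWild τ π d)
include h

theorem tau_epsPi : τ (epsPi τ π n) = epsPi τ π n := by
  have : (eps τ π : E) ≠ 0 := Units.ne_zero _
  rw [epsPi, pow_mul, ← mul_pow, map_pow, map_mul, map_pow, h.tau_eps, IsWild.tau_pi]
  congr 1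
  field_simp

theorem epsPi_mem : epsPi τ π n ∈ pp E (2 * n) := by
  refine mul_mem_pp_of_le_one ?_ (h.pow_mem_pp _)
  rw [map_pow, h.val_eps, one_pow]

/-- Conjugation by the antidiagonal ẇ exchanges the diagonal entries and the off-diagonal entries.
The two powers of ε in ẇ combine to ε^n, so only `epsPi` remains and the matrix equation becomes
four scalar ones. -/
theorem wDot_mul_tauGL_eq_iff {g k : GL (Fin 2) E} :
    wDot τ π n * tauGL τ g = k * wDot τ π n ↔ k 1 1 = τ (g 0 0) ∧ k 0 0 = τ (g 1 1) ∧
      k 1 0 = epsPi τ π n * τ (g 0 1) ∧ τ (g 1 0) = epsPi τ π n * k 0 1 := by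
  have hpi : (π : E) ≠ 0 := Units.ne_zero _
  have hp : (eps τ π : E) ^ (n / 2) ≠ 0 := by simp
  have hq : (eps τ π : E) ^ ((n + 1) / 2) ≠ 0 := by simp
  have hpq := eps_pow_half (τ := τ) (π := π) n
  have key : wDot τ π n * tauGL τ g = k * wDot τ π n ↔ ∀ i j,
      (wDot τ π n * tauGL τ g) i j = (k * wDot τ π n) i j := by
    rw [Units.ext_iff, ← Matrix.ext_iff]
  rw [key]
  simp only [Fin.forall_fin_two, coe_mul_apply, coe_wDot, tauGL_apply, Matrix.of_apply,
    Matrix.cons_val', Matrix.cons_val_zero, Matrix.cons_val_one, Matrix.cons_val_fin_one,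
    zero_mul, mul_zero, zero_add, add_zero, epsPi, ← hpq]
  generalize (eps τ π : E) ^ (n / 2) = p at *
  generalize (eps τ π : E) ^ ((n + 1) / 2) = q at *
  constructor
  · rintro ⟨⟨h1, h2⟩, h3, h4⟩
    field_simp at h1 h2 h3 h4
    refine ⟨h3.symm, h2.symm, ?_, ?_⟩
    · linear_combination -h4
    · linear_combination h1
  · rintro ⟨h1, h2, h3, h4⟩
    rw [h1, h2, h3, h4]
    refine ⟨⟨?_, ?_⟩, ?_, ?_⟩ <;> field_simp <;> ring

end Twist


/-! ### The stabilizer Γ̃ and the elements i(t, r) -/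

variable {F E : Type*} [Field F] [Field E] [Algebra F E] [ValuativeRel E]
variable {τ : E ≃ₐ[F] E} {π : Eˣ} {d n m : ℕ}

section Scalar

variable {L : Type*} [Field L] [ValuativeRel L]

theorem scalar_mem_center (z : Lˣ) :
    Matrix.GeneralLinearGroup.scalar (Fin 2) z ∈ Subgroup.center (GL (Fin 2) L) := by
  rw [Matrix.GeneralLinearGroup.center_eq_range_scalar]; exact ⟨z, rfl⟩

theorem scalar_inv_mul_mem_iwahori {g : GL (Fin 2) L} (z : Lˣ)
    (h1 : valuation L (g 0 0) = valuation L (z : L))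
    (h2 : valuation L (g 0 1) ≤ valuation L (z : L))
    (h3 : valuation L (g 1 0) < valuation L (z : L))
    (h4 : valuation L (g 1 1) = valuation L (z : L)) :
    (Matrix.GeneralLinearGroup.scalar (Fin 2) z)⁻¹ * g ∈ iwahori L := by
  have hz : valuation L (z : L) ≠ 0 := by simp
  have hz' : 0 < valuation L (z : L) := zero_lt_iff.2 hz
  rw [← map_inv, mem_iwahori]
  have e : ∀ i j, (Matrix.GeneralLinearGroup.scalar (Fin 2) z⁻¹ * g) i j = (z : L)⁻¹ * g i j := by
    intro i j
    simp [Matrix.GeneralLinearGroup.scalar]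
  simp only [e, map_mul, map_inv₀, h1, h4, inv_mul_cancel₀ hz, true_and, and_true]
  rw [inv_mul_le_iff₀ hz', mul_one, inv_mul_lt_iff₀ hz', mul_one]
  exact ⟨h2, h3⟩

theorem mem_center_sup_iwahori {g : GL (Fin 2) L} (z : Lˣ)
    (h1 : valuation L (g 0 0) = valuation L (z : L))
    (h2 : valuation L (g 0 1) ≤ valuation L (z : L))
    (h3 : valuation L (g 1 0) < valuation L (z : L))
    (h4 : valuation L (g 1 1) = valuation L (z : L)) :
    g ∈ Subgroup.center (GL (Fin 2) L) ⊔ iwahori L := by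
  have := Subgroup.mul_mem_sup (scalar_mem_center z) (scalar_inv_mul_mem_iwahori z h1 h2 h3 h4)
  rwa [mul_inv_cancel_left] at this

end Scalar

theorem tauGL_tauGL (h : IsWild τ π d) (g : GL (Fin 2) E) : tauGL τ (tauGL τ g) = g := by
  ext i j
  simp only [tauGL_apply, h.tau_tau]

theorem tauGL_mem_level (h : IsWild τ π d) {g : GL (Fin 2) E} (hg : g ∈ level E m) :
    tauGL τ g ∈ level E m := by
  obtain ⟨a, b, c, e⟩ := mem_level.1 hg
  refine mem_level.2 ⟨?_, h.tau_mem_pp b, h.tau_mem_pp c, ?_⟩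
  · simpa [tauGL_apply] using h.tau_mem_pp a
  · simpa [tauGL_apply] using h.tau_mem_pp e

theorem mem_dblCoset {x : GL (Fin 2) E} : x ∈ dblCoset τ π n m ↔
    ∃ j ∈ level E m, ∃ j' ∈ level E m, x = j * wDot τ π n * j' := by
  simp [dblCoset, DoubleCoset.mem_doubleCoset]

/-- Under the twisted equation, i⁻¹ (j ẇ j') τ(i) = (i⁻¹ j i) ẇ (τ(i)⁻¹ j' τ(i)), and both
conjugates stay in J because Z(E) I_E normalizes J and J is stable under τ. The converse implication
is the same statement for i⁻¹. -/
theorem mem_gammaTilde_of_twisted (h : IsWild τ π d) {i : GL (Fin 2) E}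
    (hi : i ∈ Subgroup.center (GL (Fin 2) E) ⊔ iwahori E)
    (hw : wDot τ π n * tauGL τ i = i * wDot τ π n) : i ∈ gammaTilde τ π n m := by
  have key : ∀ i : GL (Fin 2) E, i ∈ Subgroup.center (GL (Fin 2) E) ⊔ iwahori E →
      wDot τ π n * tauGL τ i = i * wDot τ π n → ∀ x ∈ dblCoset τ π n m,
      i⁻¹ * x * tauGL τ i ∈ dblCoset τ π n m := by
    intro i hi hw x hx
    obtain ⟨j, hj, j', hj', rfl⟩ := mem_dblCoset.1 hx
    refine mem_dblCoset.2 ⟨i⁻¹ * j * i, (conj_mem_level_iff hi).2 hj,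
      tauGL τ (i⁻¹ * tauGL τ j' * i), tauGL_mem_level h
        ((conj_mem_level_iff hi).2 (tauGL_mem_level h hj')), ?_⟩
    rw [map_mul, map_mul, tauGL_tauGL h, map_inv]
    have hw' : tauGL τ i = (wDot τ π n)⁻¹ * i * wDot τ π n := by
      rw [mul_assoc, ← hw, inv_mul_cancel_left]
    simp only [hw', mul_assoc, mul_inv_rev, inv_inv, mul_inv_cancel_left]
  refine ⟨hi, fun x => ⟨fun hx => ?_, key i hi hw x⟩⟩
  have := key i⁻¹ (inv_mem hi) (by
    rw [map_inv, mul_inv_eq_iff_eq_mul, mul_assoc, hw, inv_mul_cancel_left]) _ hx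
  simpa [mul_assoc] using this

section IElt

variable (τ π n) in
theorem P_eq (r : E) : P τ π n r = 1 + epsPi τ π n * r * τ r := rfl

theorem P_sub_one_mem (h : IsWild τ π d) {k : ℕ} {r : E} (hr : r ∈ pp E k) :
    P τ π n r - 1 ∈ pp E (2 * n + k + k) := by
  rw [P_eq, add_sub_cancel_left]
  exact mul_mem_pp (mul_mem_pp (epsPi_mem h) hr) (h.tau_mem_pp hr)

theorem val_P (h : IsWild τ π d) (hn : 1 ≤ n) {r : E} (hr : valuation E r ≤ 1) :
    valuation E (P τ π n r) = 1 :=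
  valuation_eq_one_of_sub_mem (k := 0)
    (pp_anti (by omega) (P_sub_one_mem h (mem_pp_zero hr))) (map_one _)

theorem P_ne_zero (h : IsWild τ π d) (hn : 1 ≤ n) {r : E} (hr : valuation E r ≤ 1) :
    P τ π n r ≠ 0 := fun h0 => by simpa [h0] using val_P h hn hr

theorem tau_P (h : IsWild τ π d) (r : E) : τ (P τ π n r) = P τ π n r := by
  simp only [P_eq, map_add, map_one, map_mul, tau_epsPi h, h.tau_tau]
  ring

theorem coe_iElt (h : IsWild τ π d) (t : Eˣ) {r : E} (hP : P τ π n r ≠ 0) :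
    (iElt τ π n t r : Matrix (Fin 2) (Fin 2) E) =
      !![(P τ π n r)⁻¹ * t, (P τ π n r)⁻¹ * (r * τ t);
        (P τ π n r)⁻¹ * (epsPi τ π n * τ r * t), (P τ π n r)⁻¹ * τ t] := by
  -- In characteristic 2, P_r + ε^n π^(2n) r τ(r) = 1; this gives the symmetric closed form in which
  -- the common factor is P_r⁻¹.
  have e : 1 + r * (epsPi τ π n * τ r * (P τ π n r)⁻¹) = (P τ π n r)⁻¹ := by
    field_simp
    rw [P_eq]
    linear_combination (epsPi τ π n * r * τ r) * h.two_eq_zero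
  rw [iElt, Units.val_mul, Units.val_mul, coe_ePlus, coe_eMinus, coe_eZero, Units.val_mul,
    Units.val_inv_eq_inv_val, coe_unitOf hP]
  change _ * !![1, 0; epsPi τ π n * τ r * (P τ π n r)⁻¹, 1] * !![_, 0; 0, τ t * _] = _
  ext i j
  fin_cases i <;> fin_cases j <;>
    simp only [Matrix.mul_apply, Fin.sum_univ_two, Matrix.of_apply, Matrix.cons_val', Fin.zero_eta,
      Matrix.cons_val_zero, Matrix.cons_val_one, Matrix.cons_val_fin_one, Fin.mk_one, Fin.isValue]
  · linear_combination (t : E) * e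
  · ring
  · ring
  · ring

theorem iElt_twisted (h : IsWild τ π d) (hn : 1 ≤ n) (t : Eˣ) {r : E} (hr : valuation E r ≤ 1) :
    wDot τ π n * tauGL τ (iElt τ π n t r) = iElt τ π n t r * wDot τ π n := by
  have hP := P_ne_zero h hn hr
  rw [wDot_mul_tauGL_eq_iff h, coe_iElt h t hP]
  simp only [Matrix.of_apply, Matrix.cons_val', Matrix.cons_val_zero, Matrix.cons_val_one,
    Matrix.cons_val_fin_one, map_mul, map_inv₀, tau_P h, h.tau_tau, tau_epsPi h]
  refine ⟨trivial, trivial, ?_, ?_⟩ <;> ring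

theorem iElt_mem_center_sup (h : IsWild τ π d) (hn : 1 ≤ n) (t : Eˣ) {r : E}
    (hr : valuation E r ≤ 1) :
    iElt τ π n t r ∈ Subgroup.center (GL (Fin 2) E) ⊔ iwahori E := by
  have hP := P_ne_zero h hn hr
  have hA : valuation E (epsPi τ π n) < 1 :=
    valuation_lt_one_of_mem_pp (k := 0) (pp_anti (by omega) (epsPi_mem h))
  have ht : 0 < valuation E (t : E) := by simp [zero_lt_iff]
  refine mem_center_sup_iwahori t ?_ ?_ ?_ ?_ <;> rw [coe_iElt h t hP] <;>
  simp only [Matrix.of_apply, Matrix.cons_val', Matrix.cons_val_zero, Matrix.cons_val_one,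
    Matrix.cons_val_fin_one, map_mul, map_inv₀, val_P h hn hr, h.val_tau, inv_one, one_mul]
  · exact mul_le_of_le_one_left' hr
  · exact mul_lt_of_lt_one_left ht ((mul_le_of_le_one_right' hr).trans_lt hA)

theorem iElt_mem_iwahori (h : IsWild τ π d) (hn : 1 ≤ n) {t : Eˣ} (ht : valuation E (t : E) = 1)
    {r : E} (hr : valuation E r ≤ 1) : iElt τ π n t r ∈ iwahori E := by
  have hP := P_ne_zero h hn hr
  have hA : valuation E (epsPi τ π n) < 1 :=
    valuation_lt_one_of_mem_pp (k := 0) (pp_anti (by omega) (epsPi_mem h))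
  rw [mem_iwahori, coe_iElt h t hP]
  simp only [Matrix.of_apply, Matrix.cons_val', Matrix.cons_val_zero, Matrix.cons_val_one,
    Matrix.cons_val_fin_one, map_mul, map_inv₀, val_P h hn hr, h.val_tau, inv_one, one_mul, ht,
    mul_one, true_and, and_true]
  exact ⟨hr, (mul_le_of_le_one_right' hr).trans_lt hA⟩

theorem iElt_mem_gammaTilde (h : IsWild τ π d) (hn : 1 ≤ n) (t : Eˣ) {r : E}
    (hr : valuation E r ≤ 1) : iElt τ π n t r ∈ gammaTilde τ π n m :=
  mem_gammaTilde_of_twisted h (iElt_mem_center_sup h hn t hr) (iElt_twisted h hn t hr)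

/-- An element fixed by the twisted Galois action `g ↦ ẇ τ(g) ẇ⁻¹` is some `i(t, r)`. -/
theorem eq_iElt_of_twisted (h : IsWild τ π d) (hn : 1 ≤ n) {g : GL (Fin 2) E}
    (hg : wDot τ π n * tauGL τ g = g * wDot τ π n) (h0 : valuation E (g 0 0) = 1)
    (h1 : valuation E (g 0 1) ≤ 1) (t : Eˣ) {r : E} (hr : r = g 0 1 / τ (g 0 0))
    (ht : (t : E) = g 0 0 * P τ π n r) :
    g = iElt τ π n t r := by
  have hne : g 0 0 ≠ 0 := fun h => by simp [h] at h0
  have hne' : τ (g 0 0) ≠ 0 := by simpa using hne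
  have hr1 : valuation E r ≤ 1 := by
    rw [hr, map_div₀, h.val_tau, h0, div_one]; exact h1
  have hP := P_ne_zero h hn hr1
  obtain ⟨a, b, c, e⟩ := (wDot_mul_tauGL_eq_iff h).1 hg
  have hr2 : g 0 1 = r * τ (g 0 0) := by rw [hr]; field_simp
  apply GL_ext <;> rw [coe_iElt h t hP] <;>
  simp only [Matrix.of_apply, Matrix.cons_val', Matrix.cons_val_zero, Matrix.cons_val_one,
    Matrix.cons_val_fin_one, ht, map_mul, tau_P h]
  · field_simp
  · rw [hr2]; field_simp
  · rw [c, hr2, map_mul, h.tau_tau]; field_simp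
  · rw [a]; field_simp

end IElt


/-! ### Dependence of θ̃(i(t, r)) on t and r -/

variable {F E : Type*} [Field F] [Field E] [Algebra F E] [ValuativeRel E]
variable {τ : E ≃ₐ[F] E} {π : Eˣ} {d n m : ℕ}

theorem sub_mem_pp_symm {L : Type*} [Field L] [ValuativeRel L] {k : ℕ} {x y : L}
    (h : x - y ∈ pp L k) : y - x ∈ pp L k := by
  rw [← neg_sub]; exact neg_mem h

theorem P_sub_P_mem (h : IsWild τ π d) {r r' : E} (hr : valuation E r ≤ 1)
    (hr' : valuation E r' ≤ 1) (hrr : r - r' ∈ pp E d) :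
    P τ π n r - P τ π n r' ∈ pp E (2 * n + d) := by
  have h1 : τ r - τ r' ∈ pp E d := by rw [← map_sub]; exact h.tau_mem_pp hrr
  have h2 := mul_sub_mul_mem_pp hrr h1 hr' (by rwa [h.val_tau])
  convert mul_mem_pp (epsPi_mem (n := n) h) h2 using 1
  rw [P_eq, P_eq]; ring

theorem iElt_zero (h : IsWild τ π d) (t : Eˣ) :
    iElt τ π n t 0 = eZero t (Units.map (τ : E →* E) t) := by
  have hP : P τ π n 0 = 1 := by simp [P_eq]
  apply GL_ext <;> rw [coe_iElt h t (by simp [hP]), coe_eZero] <;> simp [hP]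

theorem coe_inv_eZero {L : Type*} [Field L] (b c : Lˣ) :
    ((eZero b c)⁻¹ : GL (Fin 2) L).1 = !![(b : L)⁻¹, 0; 0, (c : L)⁻¹] := by
  rw [← Units.val_inv_eq_inv_val, ← Units.val_inv_eq_inv_val]; rfl

theorem eps_inv_add_one (h : IsWild τ π d) :
    valuation E (1 + (eps τ π : E)⁻¹) = valuation E (π : E) ^ d := by
  have h0 : (eps τ π : E) ≠ 0 := Units.ne_zero _
  have h1 := h.val_tau_add_eq π rfl
  have e : τ π + π = (π : E) * (eps τ π * (1 + (eps τ π : E)⁻¹)) := by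
    rw [IsWild.tau_pi]; field_simp
  rw [e, map_mul, map_mul, h.val_eps, one_mul, pow_succ'] at h1
  exact mul_left_cancel₀ h.val_ne_zero h1

/-- Modulo `J`, the commutator of `i(π, 0)` and `i(1, ρ)` is `e₊(ρ (1 + ε⁻¹))`. -/
theorem commutator_sub_mem (h : IsWild τ π d) (hn : 1 ≤ n) (hm : m + 1 = 2 * n + d) {ρ : E}
    (hρ : valuation E ρ ≤ 1) :
    ((iElt τ π n π 0 * iElt τ π n 1 ρ * (iElt τ π n π 0)⁻¹ * (iElt τ π n 1 ρ)⁻¹ :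
      GL (Fin 2) E) : Matrix (Fin 2) (Fin 2) E) - (ePlus (ρ * (1 + (eps τ π : E)⁻¹))).1 ∈
      levelLattice E m := by
  set i₁ := iElt τ π n 1 ρ with hi₁
  have hmem : i₁ ∈ iwahori E := iElt_mem_iwahori h hn (by simp) hρ
  have hP := P_ne_zero h hn hρ
  have hvP := val_P h hn hρ
  set y := iElt τ π n π 0 * i₁ * (iElt τ π n π 0)⁻¹ with hy
  set r₀ := ρ * (1 + (eps τ π : E)⁻¹) with hr₀
  have hr₀m : r₀ ∈ pp E d := by
    rw [h.mem_pp, hr₀, map_mul, eps_inv_add_one h]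
    exact mul_le_of_le_one_left' hρ
  have key : (y : Matrix (Fin 2) (Fin 2) E) - (ePlus r₀ * i₁ : GL (Fin 2) E).1 ∈
      levelLattice E m := by
    have hτπ : τ π = (eps τ π : E) * π := IsWild.tau_pi τ π
    have hpi : (π : E) ≠ 0 := π.ne_zero
    have hε : (eps τ π : E) ≠ 0 := Units.ne_zero _
    have c00 : y 0 0 = i₁ 0 0 := by
      simp only [hy, coe_mul_apply, iElt_zero h, coe_eZero, coe_inv_eZero, Matrix.of_apply,
        Matrix.cons_val', Matrix.cons_val_zero, Matrix.cons_val_one, Matrix.cons_val_fin_one,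
        Units.coe_map, MonoidHom.coe_coe, hτπ]
      field_simp; ring
    have c01 : y 0 1 = (eps τ π : E)⁻¹ * i₁ 0 1 := by
      simp only [hy, coe_mul_apply, iElt_zero h, coe_eZero, coe_inv_eZero, Matrix.of_apply,
        Matrix.cons_val', Matrix.cons_val_zero, Matrix.cons_val_one, Matrix.cons_val_fin_one,
        Units.coe_map, MonoidHom.coe_coe, hτπ]
      field_simp; ring
    have c10 : y 1 0 = eps τ π * i₁ 1 0 := by
      simp only [hy, coe_mul_apply, iElt_zero h, coe_eZero, coe_inv_eZero, Matrix.of_apply,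
        Matrix.cons_val', Matrix.cons_val_zero, Matrix.cons_val_one, Matrix.cons_val_fin_one,
        Units.coe_map, MonoidHom.coe_coe, hτπ]
      field_simp; ring
    have c11 : y 1 1 = i₁ 1 1 := by
      simp only [hy, coe_mul_apply, iElt_zero h, coe_eZero, coe_inv_eZero, Matrix.of_apply,
        Matrix.cons_val', Matrix.cons_val_zero, Matrix.cons_val_one, Matrix.cons_val_fin_one,
        Units.coe_map, MonoidHom.coe_coe, hτπ]
      field_simp; ring
    have hPi : valuation E (P τ π n ρ)⁻¹ ≤ 1 := by rw [map_inv₀, hvP, inv_one]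
    have hτρ : valuation E (τ ρ) ≤ 1 := by rwa [h.val_tau]
    have hA := mul_mem_pp_of_le_one hPi (mul_mem_pp_of_le_one' hτρ (epsPi_mem (n := n) h))
    rw [mem_levelLattice]
    simp only [Matrix.sub_apply, c00, c01, c10, c11, coe_mul_apply, coe_ePlus, Matrix.of_apply,
      Matrix.cons_val', Matrix.cons_val_zero, Matrix.cons_val_one, Matrix.cons_val_fin_one]
    simp only [hi₁, coe_iElt h 1 hP, Matrix.of_apply,
      Matrix.cons_val', Matrix.cons_val_zero, Matrix.cons_val_one, Matrix.cons_val_fin_one,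
      Units.val_one, map_one, mul_one]
    -- The error in the left column lies in 𝔭^(2n+d) = 𝔭^(m+1): a factor in 𝔭^(2n) comes from the
    -- lower left entry of i(1, ρ) and one in 𝔭^d from r₀ or ε − 1. The right column agrees exactly,
    -- its upper entry because 2 = 0.
    refine ⟨?_, ?_, ?_, ?_⟩
    · have := neg_mem (mul_mem_pp hA hr₀m)
      rw [← hm] at this
      convert this using 1; ring
    · convert zero_mem (pp E m) using 1
      rw [hr₀]; linear_combination (-(P τ π n ρ)⁻¹ * ρ) * h.two_eq_zero
    · have := mul_mem_pp hA h.eps_sub_one_mem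
      rw [← hm] at this
      convert this using 1; ring
    · convert zero_mem (pp E (m + 1)) using 1; ring
  convert mul_iwahori_mem (inv_mem hmem) key using 1
  rw [sub_mul, ← Units.val_mul, ← Units.val_mul, mul_inv_cancel_right]

/-- Apart from the upper right entry, r enters i(t, r) only multiplied by `epsPi` in 𝔭^(2n), so
changing it by an element of 𝔭^d is invisible modulo 𝔭^(2n+d) = 𝔭^(m+1). The factor e₊(r' − r)
corrects the upper right entry. -/
theorem ePlus_mul_iElt_sub_mem (h : IsWild τ π d) (hn : 1 ≤ n) (hm : m + 1 = 2 * n + d)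
    {t t' : Eˣ} {r r' : E} (ht : valuation E (t : E) = 1)
    (hr : valuation E r ≤ 1) (hr' : valuation E r' ≤ 1) (htt : (t : E) - t' ∈ pp E (m + 1))
    (hrr : r - r' ∈ pp E d) :
    ((ePlus (r' - r) * iElt τ π n t r : GL (Fin 2) E) : Matrix (Fin 2) (Fin 2) E) -
      (iElt τ π n t' r').1 ∈ levelLattice E m := by
  have hP := P_ne_zero h hn hr
  have hP' := P_ne_zero h hn hr'
  have hvP := val_P h hn hr
  have hvP' := val_P h hn hr'
  have hPP := inv_sub_inv_mem_pp (P_sub_P_mem (n := n) h hr hr' hrr) hvP hvP'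
  rw [← hm] at hPP
  have hτt : τ t - τ t' ∈ pp E (m + 1) := by rw [← map_sub]; exact h.tau_mem_pp htt
  have hPi : valuation E (P τ π n r)⁻¹ ≤ 1 := by rw [map_inv₀, hvP, inv_one]
  have hPi' : valuation E (P τ π n r')⁻¹ ≤ 1 := by rw [map_inv₀, hvP', inv_one]
  have hτr : valuation E (τ r) ≤ 1 := by rwa [h.val_tau]
  have hvt : valuation E (τ t) = 1 := by rwa [h.val_tau]
  have hA := mul_mem_pp_of_le_one hPi (mul_mem_pp_of_le_one' hτr (epsPi_mem (n := n) h))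
  have h00 := mul_sub_mul_mem_pp hPP htt hPi' ht.le
  have h11 := mul_sub_mul_mem_pp hPP hτt hPi' hvt.le
  have hAr : epsPi τ π n * τ r - epsPi τ π n * τ r' ∈ pp E (m + 1) := by
    rw [hm, ← mul_sub, ← map_sub]
    exact mul_mem_pp (epsPi_mem h) (h.tau_mem_pp hrr)
  have hAr1 : valuation E (epsPi τ π n * τ r) ≤ 1 :=
    valuation_le_one_of_mem_pp (mul_mem_pp_of_le_one' hτr (epsPi_mem (n := n) h))
  rw [mem_levelLattice]
  simp only [Matrix.sub_apply, coe_mul_apply, coe_ePlus, coe_iElt h _ hP, coe_iElt h _ hP',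
    Matrix.of_apply,
    Matrix.cons_val', Matrix.cons_val_zero, Matrix.cons_val_one, Matrix.cons_val_fin_one]
  refine ⟨?_, ?_, ?_, ?_⟩
  · have := mul_mem_pp_of_le_one ht.le (mul_mem_pp hA (sub_mem_pp_symm hrr))
    rw [← hm] at this
    convert add_mem h00 this using 1; ring
  · convert mul_mem_pp_of_le_one hr' (pp_anti (Nat.le_succ m) h11) using 1; ring
  · have h10 := mul_sub_mul_mem_pp hAr h00 (k := m + 1) ?_ ?_
    · convert h10 using 1; ring
    · exact valuation_le_one_of_mem_pp (mul_mem_pp_of_le_one' (by rwa [h.val_tau])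
        (epsPi_mem (n := n) h))
    · rw [map_mul, ht, mul_one]; exact hPi
  · convert h11 using 1; ring

section Character

variable {K : Type*} [Field K] {θ : gammaTilde τ π n m →* Kˣ}

theorem character_eq_of_sub_mem (hθ : TrivialOnLevel θ) {x y : gammaTilde τ π n m}
    (hx : (x : GL (Fin 2) E) ∈ iwahori E)
    (hxy : (y : GL (Fin 2) E).1 - (x : GL (Fin 2) E).1 ∈ levelLattice E m) : θ y = θ x := by
  have h1 : θ (x⁻¹ * y) = 1 := hθ _ (inv_mul_mem_level hx hxy)
  rw [map_mul, map_inv] at h1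
  exact (inv_mul_eq_one.1 h1).symm

/-- `θ(i(t, r))` depends only on `t` modulo `1 + 𝔭 ^ (m+1)` and on `r` modulo `𝔭 ^ d`. -/
theorem character_iElt_congr (h : IsWild τ π d) (hn : 1 ≤ n) (hm : m + 1 = 2 * n + d)
    (hθ : TrivialOnLevel θ) {t t' : Eˣ} {r r' : E} (ht : valuation E (t : E) = 1)
    (ht' : valuation E (t' : E) = 1) (hr : valuation E r ≤ 1) (hr' : valuation E r' ≤ 1)
    (htt : (t : E) - t' ∈ pp E (m + 1)) (hrr : r - r' ∈ pp E d)
    (hmem : iElt τ π n t r ∈ gammaTilde τ π n m) (hmem' : iElt τ π n t' r' ∈ gammaTilde τ π n m) :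
    θ ⟨iElt τ π n t r, hmem⟩ = θ ⟨iElt τ π n t' r', hmem'⟩ := by
  have hε : 1 + (eps τ π : E)⁻¹ ≠ 0 := fun h0 => by
    have := eps_inv_add_one h
    rw [h0, map_zero] at this
    exact (pow_ne_zero _ h.val_ne_zero) this.symm
  -- The divisor has valuation |π|^d, so ρ is integral; it is chosen to make the commutator of i(π,
  -- 0) and i(1, ρ) equal to e₊(r' − r) modulo J.
  set ρ := (r' - r) / (1 + (eps τ π : E)⁻¹) with hρ
  have hρ1 : valuation E ρ ≤ 1 := by
    rw [hρ, map_div₀, eps_inv_add_one h]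
    exact div_le_one_of_le₀ (h.mem_pp.1 (sub_mem_pp_symm hrr)) zero_le
  have hr₀ : ρ * (1 + (eps τ π : E)⁻¹) = r' - r := div_mul_cancel₀ _ hε
  have hc := commutator_sub_mem h hn hm hρ1
  rw [hr₀] at hc
  let a : gammaTilde τ π n m := ⟨iElt τ π n π 0, iElt_mem_gammaTilde h hn π (by simp)⟩
  let b : gammaTilde τ π n m := ⟨iElt τ π n 1 ρ, iElt_mem_gammaTilde h hn 1 hρ1⟩
  -- A character with values in a commutative group kills commutators.
  have hab : θ (a * b * a⁻¹ * b⁻¹) = 1 := by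
    simp only [map_mul, map_inv]
    rw [mul_comm (θ a), mul_inv_cancel_right, mul_inv_cancel]
  have := character_eq_of_sub_mem (K := K) (θ := θ) hθ (x := ⟨_, hmem'⟩)
    (y := a * b * a⁻¹ * b⁻¹ * ⟨_, hmem⟩) (iElt_mem_iwahori h hn ht' hr') ?_
  · rwa [map_mul, hab, one_mul] at this
  · have h1 := mul_iwahori_mem (iElt_mem_iwahori h hn ht hr) hc
    have h2 := ePlus_mul_iElt_sub_mem h hn hm ht hr hr' htt hrr
    convert add_mem h1 h2 using 1
    rw [sub_mul, ← Units.val_mul, ← Units.val_mul, sub_add_sub_cancel]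
    rfl

end Character


/-! ### The points x(a, C) -/

variable {F E : Type*} [Field F] [Field E] [Algebra F E] [ValuativeRel E]
variable {τ : E ≃ₐ[F] E} {π : Eˣ} {d n m : ℕ}

section Points

variable (π d n) in
theorem coe_vDot : (vDot π d n : Matrix (Fin 2) (Fin 2) E) =
    !![0, ((π : E) ^ ((d + 1) / 2 + (n + 1) / 2))⁻¹; (π : E) ^ ((d + 1) / 2 + n / 2), 0] := by
  simp [vDot, coe_antiDiag]

theorem eMinus_add {L : Type*} [Field L] (a b : L) : eMinus (a + b) = eMinus a * eMinus b := by
  apply GL_ext <;> simp [coe_mul_apply, coe_eMinus]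

theorem ePlus_mem_level {L : Type*} [Field L] [ValuativeRel L] {a : L} (ha : a ∈ pp L m) :
    ePlus a ∈ level L m := by
  rw [mem_level, coe_ePlus]; simpa using ha

theorem ePlus_mem_iwahori {L : Type*} [Field L] [ValuativeRel L] {a : L}
    (ha : valuation L a ≤ 1) : ePlus a ∈ iwahori L := by
  rw [mem_iwahori, coe_ePlus]; simpa using ha

/-- The two exponents in v̇ add up to n + d + 1 because d + 1 is even. Thus shifting a by π^(n+d+1)
x amounts to inserting e₊(x) to the right of v̇; this explains the modulus 𝔭^(n+d+1) for orbits and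
𝔭^(n+d+m+1) for points. -/
theorem eMinus_mul_vDot (hd : Odd d) (x : E) :
    eMinus ((π : E) ^ (n + d + 1) * x) * vDot π d n = vDot π d n * ePlus x := by
  have e : n + d + 1 = ((d + 1) / 2 + n / 2) + ((d + 1) / 2 + (n + 1) / 2) := by
    obtain ⟨k, rfl⟩ := hd; omega
  have hpi : (π : E) ≠ 0 := π.ne_zero
  apply GL_ext <;> simp only [coe_mul_apply, coe_vDot, coe_eMinus, coe_ePlus, e, Matrix.of_apply,
    Matrix.cons_val', Matrix.cons_val_zero, Matrix.cons_val_one, Matrix.cons_val_fin_one] <;>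
    field_simp <;> ring

variable (τ π d n) in
/-- The factor of `x(a, C)` in the Iwahori subgroup. -/
def ptI (a : E) (C : Eˣ) : GL (Fin 2) E :=
  eMinus ((π : E) ^ n * (R τ π d a)⁻¹) *
    eZero C (eps τ π ^ ((d + 1) / 2) * Units.map (τ : E →* E) C * (unitOf (R τ π d a))⁻¹)

variable (τ π d n) in
theorem pt_eq (a : E) (C : Eˣ) : pt τ π d n a C = eMinus a * vDot π d n * ptI τ π d n a C := by
  rw [pt, ptI, mul_assoc _ (eMinus _) (eZero _ _)]

theorem pt_eq_of_add (hd : Odd d) {a b H : E} (hb : b = a + (π : E) ^ (n + d + 1) * H) (C : Eˣ) :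
    pt τ π d n b C = eMinus a * vDot π d n * (ePlus H * ptI τ π d n b C) := by
  rw [pt_eq]
  conv_lhs => rw [hb, eMinus_add, mul_assoc (eMinus a), eMinus_mul_vDot hd, ← hb]
  simp only [mul_assoc]

variable (h : IsWild τ π d)
include h

theorem val_R {a : E} (ha : valuation E a = valuation E (π : E)) :
    valuation E (R τ π d a) = 1 := by
  rw [R, map_mul, map_inv₀, map_pow, h.val_tau_add_eq a ha, inv_mul_cancel₀]
  exact pow_ne_zero _ h.val_ne_zero

theorem R_ne_zero {a : E} (ha : valuation E a = valuation E (π : E)) : R τ π d a ≠ 0 :=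
  fun h0 => by simpa [h0] using val_R h ha

theorem tau_pow (k : ℕ) : τ ((π : E) ^ k) = (eps τ π : E) ^ k * (π : E) ^ k := by
  rw [map_pow, IsWild.tau_pi, mul_pow]

theorem tau_R (a : E) : τ (R τ π d a) = ((eps τ π : E) ^ (d + 1))⁻¹ * R τ π d a := by
  rw [R, map_mul, map_inv₀, tau_pow h, map_add, h.tau_tau, mul_inv]
  ring

/-- Adding the conjugate gains d powers of π and the normalization of R divides by d + 1 of them, so
exactly one power is lost. -/
theorem R_sub_R_mem {k : ℕ} {a b : E} (hab : a - b ∈ pp E (k + 1)) :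
    R τ π d a - R τ π d b ∈ pp E k := by
  have h1 := h.tau_add_mem_pp hab
  rw [show k + 1 + d = (d + 1) + k by ring] at h1
  convert h.inv_pow_mul_mem_pp h1 using 1
  rw [R, R, map_sub]; ring

theorem coe_ptI {a : E} (ha : valuation E a = valuation E (π : E)) (C : Eˣ) :
    (ptI τ π d n a C).1 = !![(C : E), 0; (π : E) ^ n * (R τ π d a)⁻¹ * C,
      (eps τ π : E) ^ ((d + 1) / 2) * τ C * (R τ π d a)⁻¹] := by
  ext i j
  fin_cases i <;> fin_cases j <;>
    simp [ptI, coe_eMinus, coe_eZero, coe_unitOf (R_ne_zero h ha)]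

theorem ptI_mem_iwahori (hn : 1 ≤ n) {a : E} (ha : valuation E a = valuation E (π : E)) {C : Eˣ}
    (hC : valuation E (C : E) = 1) : ptI τ π d n a C ∈ iwahori E := by
  have hp : valuation E (π : E) ^ n < 1 := pow_lt_one₀ zero_le h.lt_one (by omega)
  rw [mem_iwahori, coe_ptI h ha]
  simp [val_R h ha, hC, h.val_eps, h.val_tau, hp]

theorem ptI_sub_ptI_mem {a b : E} (ha : valuation E a = valuation E (π : E))
    (hb : valuation E b = valuation E (π : E)) {C C' : Eˣ} (hC : valuation E (C : E) = 1)
    (hab : a - b ∈ pp E (m + 2))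
    (hCC : (C : E) - C' ∈ pp E (m + 1)) :
    (ptI τ π d n a C).1 - (ptI τ π d n b C').1 ∈ levelLattice E m := by
  have hR := inv_sub_inv_mem_pp (R_sub_R_mem h hab) (val_R h ha) (val_R h hb)
  have hτ : τ (C : E) - τ C' ∈ pp E (m + 1) := by rw [← map_sub]; exact h.tau_mem_pp hCC
  have hvR : valuation E (R τ π d b)⁻¹ ≤ 1 := by rw [map_inv₀, val_R h hb, inv_one]
  have h1 := mul_sub_mul_mem_pp hR hCC hvR hC.le
  have h2 := mul_sub_mul_mem_pp hR hτ hvR (by rw [h.val_tau, hC])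
  rw [mem_levelLattice, coe_ptI h ha, coe_ptI h hb]
  simp only [Matrix.sub_apply, Matrix.of_apply, Matrix.cons_val', Matrix.cons_val_zero,
    Matrix.cons_val_one, Matrix.cons_val_fin_one, sub_zero]
  refine ⟨hCC, zero_mem _, ?_, ?_⟩
  · have hp : valuation E ((π : E) ^ n) ≤ 1 := by
      rw [map_pow]; exact pow_le_one₀ zero_le h.lt_one.le
    convert mul_mem_pp_of_le_one hp h1 using 1; ring
  · have hp : valuation E ((eps τ π : E) ^ ((d + 1) / 2)) ≤ 1 := by
      rw [map_pow, h.val_eps, one_pow]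
    convert mul_mem_pp_of_le_one hp h2 using 1; ring

/-- The point `x(a, C)` depends only on the classes of `a` and `C`. -/
theorem pt_coset_congr (hd : Odd d) (hn : 1 ≤ n) {a b : E}
    (ha : valuation E a = valuation E (π : E))
    (hb : valuation E b = valuation E (π : E)) {C C' : Eˣ} (hC : valuation E (C : E) = 1)
    (hC' : valuation E (C' : E) = 1) (hab : b - a ∈ pp E (n + d + m + 1))
    (hCC : (C' : E) - C ∈ pp E (m + 1)) :
    ((pt τ π d n a C : GL (Fin 2) E) : GL (Fin 2) E ⧸ level E m) = pt τ π d n b C' := by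
  -- The change of a is carried across v̇ as e₊(H); with H in 𝔭^m this lies in J, and only the
  -- change of R and C inside the Iwahori factor is left to compare.
  obtain ⟨H, hH, rfl⟩ : ∃ H ∈ pp E m, b = a + (π : E) ^ (n + d + 1) * H := by
    refine ⟨((π : E) ^ (n + d + 1))⁻¹ * (b - a), h.inv_pow_mul_mem_pp ?_, ?_⟩
    · convert hab using 2; ring
    · have := π.ne_zero
      field_simp; ring
  rw [QuotientGroup.eq, pt_eq, pt_eq_of_add hd rfl]
  simp only [mul_inv_rev, mul_assoc, inv_mul_cancel_left]
  refine inv_mul_mem_level (ptI_mem_iwahori h hn ha hC) ?_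
  have h1 := mul_iwahori_mem (ptI_mem_iwahori h hn hb hC')
    (mem_level_iff_sub_mem.1 (ePlus_mem_level hH))
  have h2 := ptI_sub_ptI_mem (n := n) h hb ha hC' (m := m)
    (pp_anti (by obtain ⟨k, rfl⟩ := hd; omega) hab) hCC
  convert add_mem h1 h2 using 1
  rw [sub_mul, one_mul, sub_add_sub_cancel, Units.val_mul]

/-- The entries B and D of the Iwahori factor are chosen for this identity: since τ(a) = a + π^(d+1)
R, the factor R⁻¹ in B and D absorbs the change of a, and the powers of ε in D and ẇ compensate τ(π)
= επ. Having an equality, rather than a congruence modulo J, makes the transition elements exact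
solutions of the twisted equation. -/
theorem pt_twisted (hd : Odd d) {a : E} (ha : valuation E a = valuation E (π : E)) (C : Eˣ) :
    tauGL τ (pt τ π d n a C) = pt τ π d n a C * wDot τ π n := by
  have hR := R_ne_zero h ha
  have hτa : τ a = (π : E) ^ (d + 1) * R τ π d a + a := by
    have := π.ne_zero
    rw [R]; field_simp; linear_combination (-a) * h.two_eq_zero
  have hτR := tau_R h a
  have hε : (eps τ π : E) ≠ 0 := Units.ne_zero _
  have hpi : (π : E) ≠ 0 := π.ne_zero
  have hτε := h.tau_eps
  obtain ⟨k, hk⟩ : ∃ k, d + 1 = 2 * k := by obtain ⟨k, rfl⟩ := hd; exact ⟨k + 1, by ring⟩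
  obtain ⟨p, s, hs, hp, hs'⟩ : ∃ p s, n = p + s ∧ n / 2 = p ∧ (n + 1) / 2 = s :=
    ⟨n / 2, (n + 1) / 2, by omega, rfl, rfl⟩
  have hk' : (d + 1) / 2 = k := by omega
  rw [pt_eq]
  rw [hk] at hτa hτR
  apply GL_ext <;>
  simp only [tauGL_apply, coe_mul_apply, coe_vDot, coe_eMinus, coe_wDot, coe_ptI h ha,
    Matrix.of_apply, Matrix.cons_val', Matrix.cons_val_zero, Matrix.cons_val_one,
    Matrix.cons_val_fin_one, map_mul, map_inv₀, tau_pow h, hτa, hτR, map_one, map_zero,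
    zero_mul, mul_zero, zero_add, add_zero, map_pow τ (eps τ π : E), hτε, one_mul,
    h.tau_tau, hp, hs', hk', inv_pow] <;>
  rw [hs]
  · field_simp
    ring
  · field_simp
    ring
  · field_simp
    linear_combination ((eps τ π : E) ^ (2 * k + p + s) * (π : E) ^ (2 * k + p + s) *
      R τ π d a) * h.two_eq_zero
  · field_simp
    ring

end Points


/-! ### Classification of the points over uniformizers -/

variable {F E : Type*} [Field F] [Field E] [Algebra F E] [ValuativeRel E]
variable {τ : E ≃ₐ[F] E} {π : Eˣ} {d n m : ℕ}

theorem inv_mul_tauGL_mem_of_coset_eq (h : IsWild τ π d) {x y : GL (Fin 2) E}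
    (hxy : (x : GL (Fin 2) E ⧸ level E m) = y)
    (hx : x⁻¹ * tauGL τ x ∈ dblCoset τ π n m) : y⁻¹ * tauGL τ y ∈ dblCoset τ π n m := by
  obtain ⟨j, hj, j', hj', e⟩ := mem_dblCoset.1 hx
  have hk := QuotientGroup.eq.1 hxy
  refine mem_dblCoset.2 ⟨(x⁻¹ * y)⁻¹ * j, mul_mem (inv_mem hk) hj, j' * tauGL τ (x⁻¹ * y),
    mul_mem hj' (tauGL_mem_level h hk), ?_⟩
  have : (x⁻¹ * y)⁻¹ * j * wDot τ π n * (j' * tauGL τ (x⁻¹ * y)) =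
    (x⁻¹ * y)⁻¹ * (j * wDot τ π n * j') * tauGL τ (x⁻¹ * y) := by simp only [mul_assoc]
  rw [this, ← e, map_mul, map_inv]
  group

theorem inv_mul_tauGL_mem_of_twisted {x : GL (Fin 2) E} (hx : tauGL τ x = x * wDot τ π n) :
    x⁻¹ * tauGL τ x ∈ dblCoset τ π n m :=
  mem_dblCoset.2 ⟨1, one_mem _, 1, one_mem _, by rw [hx]; group⟩

/-- The lower triangular elements `κ` of the Iwahori subgroup with `κ⁻¹ ẇ τ(κ) ∈ J ẇ J` and first
row `(1, 0)` lie in `J`. -/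
theorem mem_level_of_lower (h : IsWild τ π d) (hn : 1 ≤ n) {κ : GL (Fin 2) E}
    (hκ : κ ∈ iwahori E) (h0 : κ 0 0 = 1) (h1 : κ 0 1 = 0)
    (hw : κ⁻¹ * wDot τ π n * tauGL τ κ ∈ dblCoset τ π n m) : κ ∈ level E m := by
  obtain ⟨j, hj, j', hj', e⟩ := mem_dblCoset.1 hw
  have hg := tauGL_mem_level h (inv_mem hj')
  -- The relation κ⁻¹ ẇ τ(κ) = j ẇ j' is put into the form ẇ τ(g) = k ẇ with g = κ τ(j'⁻¹) and k = κ
  -- j. As κ has first row (1, 0), the first row of g is that of τ(j'⁻¹), which is known modulo the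
  -- level.
  have key : wDot τ π n * tauGL τ (κ * tauGL τ j'⁻¹) = (κ * j) * wDot τ π n := by
    rw [map_mul, tauGL_tauGL h, ← mul_assoc, mul_inv_eq_iff_eq_mul, mul_assoc, mul_assoc,
      ← mul_assoc j, ← e]
    group
  obtain ⟨k1, -, k3, -⟩ := (wDot_mul_tauGL_eq_iff h).1 key
  generalize tauGL τ j'⁻¹ = g at hg k1 k3
  rw [coe_mul_apply, coe_mul_apply, h0, h1, one_mul, zero_mul, add_zero] at k1 k3
  obtain ⟨a, b, c, f⟩ := mem_level.1 hj
  obtain ⟨a', b', c', f'⟩ := mem_level.1 hg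
  obtain ⟨-, -, hu, hw1⟩ := mem_iwahori.1 hκ
  have hj00 : valuation E (j 0 0) = 1 := valuation_eq_one_of_sub_mem a (map_one _)
  have hτ := mul_mem_pp (epsPi_mem (n := n) h) (h.tau_mem_pp b')
  have hu' : κ 1 0 * j 0 0 ∈ pp E (m + 1) := by
    have h2 := sub_mem (pp_anti (show m + 1 ≤ 2 * n + m by omega) hτ)
      (mul_mem_pp_of_le_one hw1.le c)
    rw [← k3] at h2
    convert h2 using 1; ring
  rw [h.mem_pp, map_mul, hj00, mul_one, ← h.mem_pp] at hu'
  refine mem_level.2 ⟨by simp [h0], by simp [h1], hu', ?_⟩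
  have h3 := sub_mem (sub_mem (h.tau_mem_pp a') (mul_mem_pp_of_le_one hw1.le f))
    (mul_mem_pp_of_le_one' (valuation_le_one_of_mem_pp b) hu')
  convert h3 using 1
  rw [map_sub, map_one, ← k1]; ring

/-- Every point of `X` in the cell of `v̇` over a uniformizer is some `x(b, C)`. -/
theorem exists_pt_eq (h : IsWild τ π d) (hd : Odd d) (hn : 1 ≤ n) {a : E}
    (ha : valuation E a = valuation E (π : E)) {i : GL (Fin 2) E} (hi : i ∈ iwahori E)
    (hx : (eMinus a * vDot π d n * i)⁻¹ * tauGL τ (eMinus a * vDot π d n * i) ∈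
      dblCoset τ π n m) :
    ∃ (b : E) (C : Eˣ), valuation E b = valuation E (π : E) ∧ valuation E (C : E) = 1 ∧
      ((eMinus a * vDot π d n * i : GL (Fin 2) E) : GL (Fin 2) E ⧸ level E m) =
        (pt τ π d n b C : GL (Fin 2) E) := by
  obtain ⟨i0, i1, i2, i3⟩ := mem_iwahori.1 hi
  have hi3 : i 1 1 ≠ 0 := fun h0 => by simp [h0] at i3
  -- Factoring e₊(A) off on the left leaves a lower triangular Iwahori element; passing e₊(A)
  -- through v̇ replaces a by b, which is still a uniformizer.
  set A := i 0 1 / i 1 1 with hA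
  have hA1 : valuation E A ≤ 1 := by rw [hA, map_div₀, i3, div_one]; exact i1
  set b := a + (π : E) ^ (n + d + 1) * A with hb
  have hbv : valuation E b = valuation E (π : E) := by
    rw [hb, Valuation.map_add_eq_of_lt_left, ha]
    rw [ha, map_mul, map_pow]
    refine (mul_le_of_le_one_right' hA1).trans_lt ?_
    have := h.zpow_lt_zpow_iff (i := (n + d + 1 : ℕ)) (j := 1)
    simp only [zpow_natCast, zpow_one] at this
    exact this.2 (by push_cast; omega)
  set l := (ePlus A)⁻¹ * i with hl
  have hli : l ∈ iwahori E := mul_mem (inv_mem (ePlus_mem_iwahori hA1)) hi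
  have hil : i = ePlus A * l := by rw [hl, mul_inv_cancel_left]
  have hl1 : l 0 1 = 0 := by
    have e1 : i 0 1 = l 0 1 + A * l 1 1 := by
      conv_lhs => rw [hil]
      simp [coe_mul_apply, coe_ePlus]
    have e2 : i 1 1 = l 1 1 := by
      conv_lhs => rw [hil]
      simp [coe_mul_apply, coe_ePlus]
    rw [← e2, hA, div_mul_cancel₀ _ hi3] at e1
    simpa using e1.symm
  have hl0 := (mem_iwahori.1 hli).1
  have hl00 : l 0 0 ≠ 0 := fun h0 => by simp [h0] at hl0
  set C : Eˣ := Units.mk0 _ hl00 with hC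
  have hCv : valuation E (C : E) = 1 := hl0
  refine ⟨b, C, hbv, hCv, ?_⟩
  -- Since C is the upper left entry of l, the quotient κ has first row (1, 0), and the defining
  -- condition of X then puts it in J.
  set κ := (ptI τ π d n b C)⁻¹ * l with hκ
  have hκl : l = ptI τ π d n b C * κ := by rw [hκ, mul_inv_cancel_left]
  have hxκ : eMinus a * vDot π d n * i = pt τ π d n b C * κ := by
    rw [pt_eq, hκ, hl, mul_assoc _ (ptI _ _ _ _ _ _), mul_inv_cancel_left, hb, eMinus_add,
      mul_assoc (eMinus a) (eMinus _), eMinus_mul_vDot hd]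
    group
  have hκi : κ ∈ iwahori E := mul_mem (inv_mem (ptI_mem_iwahori h hn hbv hCv)) hli
  have e0 : l 0 0 = C * κ 0 0 := by
    conv_lhs => rw [hκl]
    simp [coe_mul_apply, coe_ptI h hbv]
  have e1 : l 0 1 = C * κ 0 1 := by
    conv_lhs => rw [hκl]
    simp [coe_mul_apply, coe_ptI h hbv]
  have hκ0 : κ 0 0 = 1 := by
    have : (C : E) = l 0 0 := rfl
    rw [this] at e0
    exact (mul_eq_left₀ hl00).1 e0.symm
  have hκ1 : κ 0 1 = 0 := by
    rw [hl1] at e1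
    exact (mul_eq_zero.1 e1.symm).resolve_left C.ne_zero
  have hκJ : κ ∈ level E m := by
    refine mem_level_of_lower h hn hκi hκ0 hκ1 ?_
    rw [hxκ, map_mul, pt_twisted h hd hbv] at hx
    convert hx using 1
    group
  rw [hxκ]
  exact (QuotientGroup.eq.2 (by simpa using hκJ)).symm

/-- Here g must be e₊((b − a)/π^(n+d+1)), and a unipotent upper triangular matrix in Z(E) I_E has
integral entries. -/
theorem eMinus_mul_vDot_mem (hd : Odd d) {a b : E} (h : IsWild τ π d) {g : GL (Fin 2) E}
    (hg : g ∈ Subgroup.center (GL (Fin 2) E) ⊔ iwahori E)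
    (e : eMinus a * vDot π d n * g = eMinus b * vDot π d n) : b - a ∈ pp E (n + d + 1) := by
  set H := ((π : E) ^ (n + d + 1))⁻¹ * (b - a) with hH
  have hb : b = a + (π : E) ^ (n + d + 1) * H := by
    have := π.ne_zero
    rw [hH]; field_simp; ring
  rw [hb, eMinus_add, mul_assoc (eMinus a) (eMinus _), eMinus_mul_vDot hd, mul_assoc,
    mul_right_inj, mul_right_inj] at e
  rw [e] at hg
  have hH1 := valuation_le_one_of_unipotent hg (by simp [coe_ePlus])
  have hH1 : valuation E H ≤ 1 := by simpa [coe_ePlus] using hH1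
  rw [hb, add_sub_cancel_left, mul_comm]
  exact mul_mem_pp_of_le_one hH1 (h.pow_mem_pp _)

/-- This separates the Γ̃-orbits. Nothing about Γ̃ enters except that it is contained in Z(E) I_E,
since the Iwahori factors of both points can be absorbed into g. -/
theorem sub_mem_of_pt_coset_eq (h : IsWild τ π d) (hd : Odd d) (hn : 1 ≤ n) {a b : E}
    (ha : valuation E a = valuation E (π : E)) (hb : valuation E b = valuation E (π : E))
    {C C' : Eˣ} (hC : valuation E (C : E) = 1) (hC' : valuation E (C' : E) = 1)
    {g : GL (Fin 2) E} (hg : g ∈ Subgroup.center (GL (Fin 2) E) ⊔ iwahori E)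
    (e : ((pt τ π d n a C * g : GL (Fin 2) E) : GL (Fin 2) E ⧸ level E m) = pt τ π d n b C') :
    b - a ∈ pp E (n + d + 1) := by
  have hj := QuotientGroup.eq.1 e
  have hI : ∀ {x : GL (Fin 2) E}, x ∈ iwahori E →
      x ∈ Subgroup.center (GL (Fin 2) E) ⊔ iwahori E := fun hx => Subgroup.mem_sup_right hx
  refine eMinus_mul_vDot_mem hd h (g := ptI τ π d n a C * g *
    ((pt τ π d n a C * g)⁻¹ * pt τ π d n b C') * (ptI τ π d n b C')⁻¹) ?_ ?_
  · exact mul_mem (mul_mem (mul_mem (hI (ptI_mem_iwahori h hn ha hC)) hg)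
      (hI (level_le_iwahori hj))) (inv_mem (hI (ptI_mem_iwahori h hn hb hC')))
  · rw [pt_eq, pt_eq]; group

theorem pt_mem_XP (h : IsWild τ π d) (hd : Odd d) (hn : 1 ≤ n) {a : E}
    (ha : valuation E a = valuation E (π : E)) {C : Eˣ} (hC : valuation E (C : E) = 1) :
    ((pt τ π d n a C : GL (Fin 2) E) : GL (Fin 2) E ⧸ level E m) ∈ XP τ π d n m := by
  obtain ⟨h1, h2⟩ := h.uniformizer_iff.2 ha
  exact ⟨⟨_, rfl, inv_mul_tauGL_mem_of_twisted (pt_twisted h hd ha C)⟩, a, h1, h2, _,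
    ptI_mem_iwahori h hn ha hC, by rw [← pt_eq]⟩

theorem exists_pt_of_mem_XP (h : IsWild τ π d) (hd : Odd d) (hn : 1 ≤ n)
    {y : GL (Fin 2) E ⧸ level E m} (hy : y ∈ XP τ π d n m) :
    ∃ (a : E) (C : Eˣ), valuation E a = valuation E (π : E) ∧ valuation E (C : E) = 1 ∧
      y = (pt τ π d n a C : GL (Fin 2) E) := by
  obtain ⟨⟨x, rfl, hx⟩, a, h1, h2, i, hi, e⟩ := hy
  rw [← e]
  exact exists_pt_eq h hd hn (h.uniformizer_iff.1 ⟨h1, h2⟩) hi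
    (inv_mul_tauGL_mem_of_coset_eq h e.symm hx)


/-! ### Transition elements between points of one orbit -/

variable {F E : Type*} [Field F] [Field E] [Algebra F E] [ValuativeRel E]
variable {τ : E ≃ₐ[F] E} {π : Eˣ} {d n m : ℕ}

theorem pt_transition_twisted (h : IsWild τ π d) (hd : Odd d) {a b : E}
    (ha : valuation E a = valuation E (π : E)) (hb : valuation E b = valuation E (π : E))
    (C C' : Eˣ) : wDot τ π n * tauGL τ ((pt τ π d n a C)⁻¹ * pt τ π d n b C') =
      (pt τ π d n a C)⁻¹ * pt τ π d n b C' * wDot τ π n := by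
  rw [map_mul, map_inv, pt_twisted h hd ha, pt_twisted h hd hb]
  group

/-- The congruence relating the upper left entry of the transition matrix to `t`. -/
theorem one_add_mul_P_congr (h : IsWild τ π d) (hn : 1 ≤ n) (hm : m + 1 = 2 * n + d) {x y : E}
    (hx : x ∈ pp E n) (hxy : x - y ∈ pp E (2 * n + d)) :
    (1 + x) * (1 + x * τ x / ((1 + x) * (1 + τ x))) - (1 + y)⁻¹ ∈ pp E (m + 1) := by
  rw [hm]
  have hy : y ∈ pp E n := by
    have := sub_mem hx (pp_anti (show n ≤ 2 * n + d by omega) hxy)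
    simpa using this
  have hv : ∀ {z : E}, z ∈ pp E n → valuation E (1 + z) = 1 := fun {z} hz =>
    valuation_eq_one_of_sub_mem (k := 0) (by simpa using pp_anti hn hz) (map_one _)
  have hne : ∀ {z : E}, z ∈ pp E n → 1 + z ≠ 0 := fun {z} hz h0 => by simpa [h0] using hv hz
  have hτx := h.tau_mem_pp hx
  have h1x := hne hx
  have h1τ := hne hτx
  have h1 := inv_sub_inv_mem_pp (x := 1 + x) (y := 1 + y) (by simpa using hxy) (hv hx) (hv hy)
  have h2 : valuation E ((1 + x)⁻¹ * (1 + τ x)⁻¹) ≤ 1 := by simp [hv hx, hv hτx]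
  -- In characteristic 2 the left factor product differs from (1 + x)⁻¹ by x(τ(x) + x)/((1 + x)(1 +
  -- τ(x))), which lies in 𝔭^(n + (n+d)).
  have h3 := mul_mem_pp_of_le_one h2 (mul_mem_pp hx (h.tau_add_mem_pp hx))
  rw [show n + (n + d) = 2 * n + d by ring] at h3
  convert add_mem h3 h1 using 1
  field_simp
  linear_combination (x + x * τ x + x ^ 2 * τ x) * h.two_eq_zero

theorem pow_sub_one_mem_pp {L : Type*} [Field L] [ValuativeRel L] {k : ℕ} {x : L}
    (hx : valuation L x ≤ 1) (h : x - 1 ∈ pp L k) (j : ℕ) : x ^ j - 1 ∈ pp L k := by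
  induction j with
  | zero => simp
  | succ j ih => simpa [pow_succ] using mul_sub_mul_mem_pp ih h (by simp) hx

theorem R_inv_sub_mem (h : IsWild τ π d) {a b : E}
    (ha : valuation E a = valuation E (π : E)) (hb : valuation E b = valuation E (π : E)) {k : ℕ}
    (hab : b - a ∈ pp E (k + 1)) : (R τ π d b)⁻¹ - (R τ π d a)⁻¹ ∈ pp E k :=
  inv_sub_inv_mem_pp (R_sub_R_mem h hab) (val_R h hb) (val_R h ha)

/-- The right translate carrying `x(a, 1)` to `x(b, C)` for `b ≡ a` modulo `𝔭 ^ (n+d+1)`. -/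
theorem exists_pt_eq_pt_mul_iElt (h : IsWild τ π d) (hd : Odd d) (hn : 1 ≤ n)
    (hm : m + 1 = 2 * n + d) {a b : E}
    (ha : valuation E a = valuation E (π : E)) (hb : valuation E b = valuation E (π : E))
    (hab : b - a ∈ pp E (n + d + 1)) {C : Eˣ} (hC : valuation E (C : E) = 1) {H u : E}
    (hH : H = ((π : E) ^ (n + d + 1))⁻¹ * (b - a))
    (hu : u = (1 + (π : E) ^ n * H * (R τ π d a)⁻¹)⁻¹) :
    ∃ (t : Eˣ) (r : E), valuation E (t : E) = 1 ∧ valuation E r ≤ 1 ∧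
      pt τ π d n b C = pt τ π d n a 1 * iElt τ π n t r ∧
      r - (R τ π d a)⁻¹ * H * u ∈ pp E d ∧ (t : E) - C * u ∈ pp E (m + 1) := by
  have hbH : b = a + (π : E) ^ (n + d + 1) * H := by
    have := π.ne_zero
    rw [hH]; field_simp; ring
  have hH1 : valuation E H ≤ 1 := by
    have := h.inv_pow_mul_mem_pp (j := n + d + 1) (k := 0) hab
    rw [← hH] at this
    exact valuation_le_one_of_mem_pp this
  have hRa := val_R h ha
  have hRb := val_R h hb
  have hRa0 := R_ne_zero h ha
  have hRb0 := R_ne_zero h hb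
  have hRR := R_inv_sub_mem h ha hb hab
  have hε0 : (eps τ π : E) ≠ 0 := Units.ne_zero _
  have hεd : (eps τ π : E) ^ ((d + 1) / 2) - 1 ∈ pp E d :=
    pow_sub_one_mem_pp h.val_eps.le h.eps_sub_one_mem _
  set x := (π : E) ^ n * H * (R τ π d b)⁻¹ with hx
  set y := (π : E) ^ n * H * (R τ π d a)⁻¹ with hy
  have hxm : x ∈ pp E n := by
    rw [hx, mul_assoc]
    exact mul_mem_pp_of_le_one' (by simpa [hRb] using hH1) (h.pow_mem_pp n)
  have hxy : x - y ∈ pp E (2 * n + d) := by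
    have := mul_mem_pp (mul_mem_pp_of_le_one' hH1 (h.pow_mem_pp n)) hRR
    rw [← add_assoc, ← two_mul] at this
    convert this using 1
    rw [hx, hy]; ring
  have hym : y ∈ pp E n := by
    have := sub_mem hxm (pp_anti (show n ≤ 2 * n + d by omega) hxy)
    simpa using this
  have hτx := h.tau_mem_pp hxm
  have hv : ∀ {z : E}, z ∈ pp E n → valuation E (1 + z) = 1 := fun {z} hz =>
    valuation_eq_one_of_sub_mem (k := 0) (by simpa using pp_anti hn hz) (map_one _)
  have hne : ∀ {z : E}, z ∈ pp E n → 1 + z ≠ 0 := fun {z} hz h0 => by simpa [h0] using hv hz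
  have hvx := hv hxm
  have hvy := hv hym
  have hvτx := hv hτx
  have h1x := hne hxm
  have h1τ := hne hτx
  have hC0 : τ (C : E) ≠ 0 := by simp
  set g := (pt τ π d n a 1)⁻¹ * pt τ π d n b C with hg
  -- The matrix on the left has first row (1, 0), so the first row of g is simply the first row of
  -- the right-hand side.
  have hgk : ptI τ π d n a 1 * g = ePlus H * ptI τ π d n b C := by
    rw [hg, pt_eq_of_add hd hbH, pt_eq]; group
  have g0 : g 0 0 = C * (1 + x) := by
    have := congrArg (fun M : GL (Fin 2) E => M 0 0) hgk
    simp only [coe_mul_apply, coe_ptI h ha, coe_ptI h hb, coe_ePlus, Matrix.of_apply,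
      Matrix.cons_val', Matrix.cons_val_zero, Matrix.cons_val_one, Matrix.cons_val_fin_one,
      Units.val_one] at this
    rw [hx]; linear_combination this
  have g1 : g 0 1 = H * ((eps τ π : E) ^ ((d + 1) / 2) * τ C * (R τ π d b)⁻¹) := by
    have := congrArg (fun M : GL (Fin 2) E => M 0 1) hgk
    simp only [coe_mul_apply, coe_ptI h ha, coe_ptI h hb, coe_ePlus, Matrix.of_apply,
      Matrix.cons_val', Matrix.cons_val_zero, Matrix.cons_val_one, Matrix.cons_val_fin_one,
      Units.val_one] at this
    linear_combination this
  -- The first row of i(t, r) is (P_r⁻¹ t, P_r⁻¹ r τ(t)) with P_r fixed by τ; this determines r, and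
  -- then t = g₀₀ P_r.
  set r := g 0 1 / τ (g 0 0) with hr
  have hr' : r = (eps τ π : E) ^ ((d + 1) / 2) * H * (R τ π d b)⁻¹ * (1 + τ x)⁻¹ := by
    rw [hr, g0, g1, map_mul, map_add, map_one]
    field_simp
  have hP : P τ π n r = 1 + x * τ x / ((1 + x) * (1 + τ x)) := by
    have hτR : τ (R τ π d b) ≠ 0 := by simpa using hRb0
    have hτr : τ r = ((eps τ π : E) ^ ((d + 1) / 2))⁻¹ * τ H * (τ (R τ π d b))⁻¹ * (1 + x)⁻¹ := by
      rw [hr']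
      simp only [map_mul, map_inv₀, map_add, map_one, map_pow, h.tau_eps, h.tau_tau, inv_pow]
    have hxx : x * τ x = epsPi τ π n * H * τ H * (R τ π d b)⁻¹ * (τ (R τ π d b))⁻¹ := by
      rw [hx, map_mul, map_mul, map_inv₀, tau_pow h, epsPi]; ring
    rw [P_eq, hτr, hxx, hr']
    field_simp
  have hg00 : valuation E (g 0 0) = 1 := by rw [g0, map_mul, hC, hvx, one_mul]
  have hg01 : valuation E (g 0 1) ≤ 1 := by
    rw [g1]
    simpa [h.val_eps, h.val_tau, hC, hRb] using hH1
  have hr1 : valuation E r ≤ 1 := by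
    rw [hr, map_div₀, h.val_tau, hg00, div_one]; exact hg01
  have hP0 := P_ne_zero h hn hr1
  have hgP : g 0 0 * P τ π n r ≠ 0 := mul_ne_zero (fun h0 => by simp [h0] at hg00) hP0
  refine ⟨Units.mk0 _ hgP, r, ?_, hr1, ?_, ?_, ?_⟩
  · rw [Units.val_mk0, map_mul, hg00, val_P h hn hr1, one_mul]
  · rw [← eq_iElt_of_twisted h hn (pt_transition_twisted h hd ha hb 1 C) hg00 hg01 _ hr rfl,
      mul_inv_cancel_left]
  -- Modulo 𝔭^d the exact value of r simplifies by three replacements: the power of ε by 1, R(b) by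
  -- R(a), and 1 + τ(x) by 1 + y.
  · have h1 := mul_sub_mul_mem_pp hεd (pp_anti (show d ≤ n + d by omega) hRR)
      (by simp) (by simp [hRb])
    have h2 : (1 + τ x) - (1 + y) ∈ pp E d := by
      have := add_mem (pp_anti (show d ≤ n + d by omega) (h.tau_add_mem_pp hxm))
        (pp_anti (show d ≤ 2 * n + d by omega) (neg_mem hxy))
      convert this using 1
      linear_combination (-y) * h.two_eq_zero
    have h3 := inv_sub_inv_mem_pp h2 hvτx hvy
    have h4 := mul_sub_mul_mem_pp h1 h3 (by simp [hRa]) (by simp [hvτx])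
    convert mul_mem_pp_of_le_one hH1 h4 using 1
    rw [hr', hu]; ring
  · have := mul_mem_pp_of_le_one hC.le (one_add_mul_P_congr h hn hm hxm hxy)
    convert this using 1
    rw [Units.val_mk0, g0, hP, hu]; ring


/-! ### The left action of ι(Eˣ) I_F on the cell of v̇ -/

variable {F E : Type*} [Field F] [Field E] [Algebra F E] [ValuativeRel E]
variable {τ : E ≃ₐ[F] E} {π : Eˣ} {d n m : ℕ}

/-- The properties of the extension `E = F(π)` that are used for the left action of `GL₂(F)`. -/
structure IsWildOver (τ : E ≃ₐ[F] E) (π : Eˣ) (d : ℕ) (ϖ Δ : F) : Prop extends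
    IsWild τ π d where
  val_uniformizer : valuation E (algebraMap F E ϖ) = valuation E (π : E) ^ 2
  minpoly : (π : E) ^ 2 + algebraMap F E Δ * π + algebraMap F E ϖ = 0
  tau_pi_eq : τ π = π + algebraMap F E Δ
  exists_eq_add : ∀ u : E, ∃ x y : F, u = algebraMap F E x + algebraMap F E y * π
  val_le_sq : ∀ x : F, valuation E (algebraMap F E x) < 1 →
    valuation E (algebraMap F E x) ≤ valuation E (π : E) ^ 2

theorem toGLE_apply (g : GL (Fin 2) F) (i j : Fin 2) :
    toGLE (E := E) g i j = algebraMap F E (g i j) := rfl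

theorem tauGL_toGLE (τ : E ≃ₐ[F] E) (g : GL (Fin 2) F) :
    tauGL τ (toGLE (E := E) g) = toGLE g := by
  ext i j
  rw [tauGL_apply, toGLE_apply, AlgEquiv.commutes]

variable (π d n) in
/-- The element `G` maps the part over the uniformizers of the cell of `v̇` to its translate
by `π ^ s`. -/
def MovesCell (G : GL (Fin 2) E) (s : ℤ) : Prop :=
  ∀ a : E, valuation E a = valuation E (π : E) → ∃ a' : E, valuation E a' = valuation E (π : E) ∧
    ∃ i ∈ iwahori E, G * (eMinus a * vDot π d n) =
      eMinus a' * vDot π d n * (Matrix.GeneralLinearGroup.scalar (Fin 2) (π ^ s) * i)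

theorem scalar_comm {L : Type*} [Field L] (z : Lˣ) (g : GL (Fin 2) L) :
    g * Matrix.GeneralLinearGroup.scalar (Fin 2) z =
      Matrix.GeneralLinearGroup.scalar (Fin 2) z * g := by
  apply GL_ext <;> simp [Matrix.GeneralLinearGroup.scalar, coe_mul_apply, mul_comm]

theorem MovesCell.mul {G G' : GL (Fin 2) E} {s s' : ℤ} (h : MovesCell π d n G s)
    (h' : MovesCell π d n G' s') : MovesCell π d n (G * G') (s + s') := by
  intro a ha
  obtain ⟨b, hb, i, hi, e⟩ := h' a ha
  obtain ⟨c, hc, j, hj, e'⟩ := h b hb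
  refine ⟨c, hc, j * i, mul_mem hj hi, ?_⟩
  rw [mul_assoc, e, ← mul_assoc, e', zpow_add, map_mul]
  simp only [mul_assoc]
  rw [← mul_assoc j, scalar_comm]
  simp only [mul_assoc]

/-- With p = G₀₀ + G₀₁ a, the matrix G moves a to (G₁₀ + G₁₁ a)/p, and the remaining factor is lower
triangular with diagonal (det G / p, p) and lower left entry G₀₁ π^(n+d+1). The valuation hypotheses
say that the new coordinate is a uniformizer and that this factor is π^s times an Iwahori element.
-/
theorem movesCell_of_val (h : IsWild τ π d) (hn : 1 ≤ n) {G : GL (Fin 2) E} {s : ℤ}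
    (h1 : ∀ a, valuation E a = valuation E (π : E) →
      valuation E (G 0 0 + G 0 1 * a) = valuation E (π : E) ^ s)
    (h2 : ∀ a, valuation E a = valuation E (π : E) →
      valuation E (G 1 0 + G 1 1 * a) = valuation E (π : E) ^ (s + 1))
    (h3 : valuation E (G 0 1) ≤ valuation E (π : E) ^ (s - 1))
    (h4 : valuation E G.1.det = valuation E (π : E) ^ (2 * s)) (hd : Odd d) :
    MovesCell π d n G s := by
  intro a ha
  specialize h1 a ha
  specialize h2 a ha
  have hs : valuation E (π : E) ^ s ≠ 0 := zpow_ne_zero _ h.val_ne_zero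
  set p := G 0 0 + G 0 1 * a with hp
  have hp0 : p ≠ 0 := fun h0 => by rw [h0, map_zero] at h1; exact hs h1.symm
  set a' := (G 1 0 + G 1 1 * a) / p with ha'
  have ha'v : valuation E a' = valuation E (π : E) := by
    rw [ha', map_div₀, h1, h2, zpow_add_one₀ h.val_ne_zero, mul_div_cancel_left₀ _ hs]
  set i₀ := (eMinus a' * vDot π d n)⁻¹ * (G * (eMinus a * vDot π d n)) with hi₀
  have e : eMinus a' * vDot π d n * i₀ = G * (eMinus a * vDot π d n) := by
    rw [hi₀, mul_inv_cancel_left]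
  set b := ((π : E) ^ ((d + 1) / 2 + (n + 1) / 2))⁻¹ with hb
  set c := (π : E) ^ ((d + 1) / 2 + n / 2) with hc
  have hb0 : b ≠ 0 := by simp [hb]
  have hc0 : c ≠ 0 := by simp [hc]
  have hcb : c = (π : E) ^ (n + d + 1) * b := by
    have e : n + d + 1 = ((d + 1) / 2 + n / 2) + ((d + 1) / 2 + (n + 1) / 2) := by
      obtain ⟨k, rfl⟩ := hd; omega
    have := π.ne_zero
    rw [hc, hb, e, pow_add _ ((d + 1) / 2 + n / 2)]
    field_simp
  have hv : (vDot π d n : Matrix (Fin 2) (Fin 2) E) = !![0, b; c, 0] := coe_vDot π d n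
  have e00 := congrArg (fun M : GL (Fin 2) E => M 0 0) e
  have e01 := congrArg (fun M : GL (Fin 2) E => M 0 1) e
  have e10 := congrArg (fun M : GL (Fin 2) E => M 1 0) e
  have e11 := congrArg (fun M : GL (Fin 2) E => M 1 1) e
  simp only [coe_mul_apply, hv, coe_eMinus, Matrix.of_apply, Matrix.cons_val',
    Matrix.cons_val_zero, Matrix.cons_val_one, Matrix.cons_val_fin_one, mul_zero, zero_mul,
    add_zero, zero_add, one_mul] at e00 e01 e10 e11
  have i10 : i₀ 1 0 = G 0 1 * (π : E) ^ (n + d + 1) := by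
    apply mul_left_cancel₀ hb0
    rw [e00, hcb]; ring
  have i11 : i₀ 1 1 = p := by
    apply mul_left_cancel₀ hb0
    rw [e01, hp]; ring
  have i01 : i₀ 0 1 = 0 := by
    apply mul_left_cancel₀ hc0
    rw [i11, ha'] at e11
    field_simp at e11
    linear_combination e11
  have i00 : p * i₀ 0 0 = G.1.det := by
    apply mul_left_cancel₀ hc0
    have ha'p : a' * p = G 1 0 + G 1 1 * a := div_mul_cancel₀ _ hp0
    rw [Matrix.det_fin_two]
    rw [i10] at e10
    linear_combination p * e10 - b * π ^ (n + d + 1) * G 0 1 * ha'p +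
      G 0 1 * (G 1 0 + G 1 1 * a) * hcb + c * G 1 1 * hp
  have hzv : valuation E ((π ^ s : Eˣ) : E) = valuation E (π : E) ^ s := by
    rw [Units.val_zpow_eq_zpow_val, map_zpow₀]
  refine ⟨a', ha'v, (Matrix.GeneralLinearGroup.scalar (Fin 2) (π ^ s))⁻¹ * i₀,
    scalar_inv_mul_mem_iwahori _ ?_ ?_ ?_ ?_, ?_⟩
  · have := congrArg (valuation E) i00
    rw [map_mul, h1, h4, two_mul, zpow_add₀ h.val_ne_zero] at this
    rw [hzv]
    exact mul_left_cancel₀ hs this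
  · rw [i01, map_zero]; exact zero_le
  · rw [hzv, i10, map_mul, map_pow, ← zpow_natCast]
    calc _ ≤ valuation E (π : E) ^ (s - 1) * valuation E (π : E) ^ ((n + d + 1 : ℕ) : ℤ) := by
          gcongr
      _ < _ := by
          rw [← zpow_add₀ h.val_ne_zero, h.zpow_lt_zpow_iff]
          push_cast; omega
  · rw [i11, h1, hzv]
  · rw [mul_inv_cancel_left, e]

section Torus

variable {ϖ Δ : F} (h : IsWildOver τ π d ϖ Δ)
include h

theorem val_discr : valuation E (algebraMap F E Δ) = valuation E (π : E) ^ (d + 1) := by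
  rw [← h.val_tau_add_eq π rfl, h.tau_pi_eq]
  congr 1
  linear_combination (-(π : E)) * h.two_eq_zero

/-- Total ramification: otherwise x/y in F would have the valuation of π, whereas elements of F of
valuation below 1 have valuation at most |π|². -/
theorem val_algebraMap_ne (x y : F) (hx : x ≠ 0) : valuation E (algebraMap F E x) ≠
    valuation E (algebraMap F E y) * valuation E (π : E) := by
  intro e
  have hx' : algebraMap F E x ≠ 0 := by simpa using hx
  have hy : y ≠ 0 := by
    rintro rfl
    simp [hx] at e
  have hy' : algebraMap F E y ≠ 0 := by simpa using hy
  have h1 : valuation E (algebraMap F E (x / y)) = valuation E (π : E) := by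
    rw [map_div₀, map_div₀, e, mul_div_cancel_left₀]
    simpa using hy
  have h2 := h.val_le_sq (x / y) (by rw [h1]; exact h.lt_one)
  rw [h1] at h2
  have h3 := h.zpow_le_zpow_iff (i := 1) (j := 2)
  simp only [zpow_one] at h3
  have := h3.1 (by exact_mod_cast h2)
  omega

theorem val_algebraMap_add_mul (x y : F) {c : E} (hc : valuation E c = valuation E (π : E)) :
    valuation E (algebraMap F E x + algebraMap F E y * c) =
      max (valuation E (algebraMap F E x))
        (valuation E (algebraMap F E y) * valuation E (π : E)) := by
  rcases eq_or_ne x 0 with rfl | hx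
  · simp [hc]
  · have := val_algebraMap_ne h x y hx
    rw [Valuation.map_add_of_distinct_val _ (by rwa [map_mul, hc]), map_mul, hc]

omit h in
theorem algHom_apply_eq {ι : E →ₐ[F] Matrix (Fin 2) (Fin 2) F}
    (hι : ι π = !![Δ, 1; ϖ, 0]) (x y : F) :
    ι (algebraMap F E x + algebraMap F E y * π) = !![x + y * Δ, y; y * ϖ, x] := by
  rw [map_add, map_mul, AlgHom.commutes, AlgHom.commutes, hι]
  ext i j
  fin_cases i <;> fin_cases j <;>
    simp [Matrix.algebraMap_matrix_apply, Matrix.mul_apply]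

/-- For u = x + yπ one has |u| = max(|x|, |yπ|), and this persists when π is replaced by any element
of the same valuation. The denominator of the fractional linear action is x + y(Δ + a) and the
numerator is (x + y ϖ/a) a, where Δ + a and ϖ/a both have the valuation of π. The determinant is the
norm u τ(u). -/
theorem movesCell_torus (hd : Odd d) (hn : 1 ≤ n) {ι : E →ₐ[F] Matrix (Fin 2) (Fin 2) F}
    (hι : ι π = !![Δ, 1; ϖ, 0]) (u : Eˣ) :
    ∃ s : ℤ, valuation E (toGLE (E := E)
        (Units.map (ι : E →* Matrix (Fin 2) (Fin 2) F) u)).1.det = valuation E (π : E) ^ (2 * s) ∧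
      MovesCell π d n (toGLE (E := E) (Units.map (ι : E →* Matrix (Fin 2) (Fin 2) F) u)) s := by
  obtain ⟨s, hs⟩ := h.exists_zpow u u.ne_zero
  obtain ⟨x, y, hu⟩ := h.exists_eq_add u
  set g := Units.map (ι : E →* Matrix (Fin 2) (Fin 2) F) u with hg
  have hgm : g.1 = !![x + y * Δ, y; y * ϖ, x] := by
    change ι (u : E) = _
    rw [hu, algHom_apply_eq hι]
  have hmax := val_algebraMap_add_mul h x y (c := π) rfl
  rw [← hu, hs] at hmax
  set G := toGLE (E := E) g with hG
  have G00 : G 0 0 = algebraMap F E x + algebraMap F E y * algebraMap F E Δ := by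
    rw [hG, toGLE_apply, hgm]; simp
  have G01 : G 0 1 = algebraMap F E y := by
    rw [hG, toGLE_apply, hgm]; simp
  have G10 : G 1 0 = algebraMap F E y * algebraMap F E ϖ := by
    rw [hG, toGLE_apply, hgm]; simp
  have G11 : G 1 1 = algebraMap F E x := by
    rw [hG, toGLE_apply, hgm]; simp
  have hdet : valuation E G.1.det = valuation E (π : E) ^ (2 * s) := by
    have e : G.1.det = (u : E) * τ u := by
      rw [Matrix.det_fin_two, G00, G01, G10, G11, hu, map_add, map_mul, AlgEquiv.commutes,
        AlgEquiv.commutes, h.tau_pi_eq]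
      linear_combination (-(algebraMap F E y) ^ 2) * h.minpoly -
        (algebraMap F E x * algebraMap F E y * π) * h.two_eq_zero
    rw [e, map_mul, h.val_tau, hs, two_mul, zpow_add₀ h.val_ne_zero]
  refine ⟨s, hdet, movesCell_of_val h.toIsWild hn (fun a ha => ?_) (fun a ha => ?_) ?_ hdet hd⟩
  · have hc : valuation E (algebraMap F E Δ + a) = valuation E (π : E) := by
      rw [Valuation.map_add_eq_of_lt_right, ha]
      rw [ha, val_discr h]
      have := h.zpow_lt_zpow_iff (i := (d + 1 : ℕ)) (j := 1)
      simp only [zpow_natCast, zpow_one] at this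
      exact this.2 (by obtain ⟨k, rfl⟩ := hd; push_cast; omega)
    rw [hmax, ← val_algebraMap_add_mul h x y hc, G00, G01]
    congr 1; ring
  · have ha0 : a ≠ 0 := fun h0 => by
      rw [h0, map_zero] at ha; exact h.val_ne_zero ha.symm
    have hc : valuation E (algebraMap F E ϖ / a) = valuation E (π : E) := by
      rw [map_div₀, ha, h.val_uniformizer, sq, mul_div_cancel_right₀ _ h.val_ne_zero]
    have e : G 1 0 + G 1 1 * a =
        (algebraMap F E x + algebraMap F E y * (algebraMap F E ϖ / a)) * a := by
      rw [G10, G11]; field_simp; ring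
    rw [e, map_mul, val_algebraMap_add_mul h x y hc, ← hmax, ha, zpow_add_one₀ h.val_ne_zero]
  · rw [G01, zpow_sub_one₀ h.val_ne_zero, le_mul_inv_iff₀ h.val_pos, hmax]
    exact le_max_right _ _

variable [ValuativeRel F] [ValuativeExtension F E]

omit h in
theorem val_algebraMap_le_iff {x y : F} : valuation E (algebraMap F E x) ≤
    valuation E (algebraMap F E y) ↔ valuation F x ≤ valuation F y := by
  rw [← ValuativeExtension.mapValueGroupWithZero_valuation,
    ← ValuativeExtension.mapValueGroupWithZero_valuation]
  exact (ValuativeExtension.mapValueGroupWithZero_strictMono).le_iff_le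

omit h in
theorem val_algebraMap_le_one_iff {x : F} :
    valuation E (algebraMap F E x) ≤ 1 ↔ valuation F x ≤ 1 := by
  simpa using val_algebraMap_le_iff (E := E) (x := x) (y := 1)

omit h in
theorem val_algebraMap_lt_one_iff {x : F} :
    valuation E (algebraMap F E x) < 1 ↔ valuation F x < 1 := by
  simpa using (val_algebraMap_le_iff (E := E) (x := 1) (y := x)).not

omit h in
theorem val_algebraMap_eq_one_iff {x : F} :
    valuation E (algebraMap F E x) = 1 ↔ valuation F x = 1 := by
  rw [eq_iff_le_not_lt, eq_iff_le_not_lt, val_algebraMap_le_one_iff, val_algebraMap_lt_one_iff]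

theorem movesCell_iwahori (hd : Odd d) (hn : 1 ≤ n) {g : GL (Fin 2) F} (hg : g ∈ iwahori F) :
    ∃ s : ℤ, valuation E (toGLE (E := E) g).1.det = valuation E (π : E) ^ (2 * s) ∧
      MovesCell π d n (toGLE (E := E) g) s := by
  obtain ⟨a0, b0, c0, e0⟩ := mem_iwahori.1 hg
  set G := toGLE (E := E) g with hG
  have g00 : valuation E (G 0 0) = 1 := val_algebraMap_eq_one_iff.2 a0
  have g01 : valuation E (G 0 1) ≤ 1 := val_algebraMap_le_one_iff.2 b0
  have g10 : valuation E (G 1 0) < 1 := val_algebraMap_lt_one_iff.2 c0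
  have g11 : valuation E (G 1 1) = 1 := val_algebraMap_eq_one_iff.2 e0
  have g10' : valuation E (G 1 0) < valuation E (π : E) := by
    refine (h.val_le_sq _ g10).trans_lt ?_
    rw [sq]; exact mul_lt_of_lt_one_left h.val_pos h.lt_one
  have hdet : valuation E G.1.det = valuation E (π : E) ^ (2 * (0 : ℤ)) := by
    rw [Matrix.det_fin_two, sub_eq_add_neg, Valuation.map_add_eq_of_lt_left] <;>
      rw [map_mul, g00, g11]
    · simp
    · rw [Valuation.map_neg, map_mul, one_mul]
      exact mul_lt_one_of_nonneg_of_lt_one_right g01 zero_le g10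
  refine ⟨0, hdet, movesCell_of_val h.toIsWild hn (fun a ha => ?_) (fun a ha => ?_) ?_ hdet hd⟩
  · rw [Valuation.map_add_eq_of_lt_left, g00, zpow_zero]
    rw [g00, map_mul, ha]
    exact mul_lt_one_of_nonneg_of_lt_one_right g01 zero_le h.lt_one
  · rw [Valuation.map_add_eq_of_lt_right, map_mul, ha, g11, one_mul, zero_add, zpow_one]
    rwa [map_mul, ha, g11, one_mul]
  · rw [zero_sub, zpow_neg_one]
    exact g01.trans ((one_le_inv₀ h.val_pos).2 h.lt_one.le)

theorem movesCell_of_mem (hd : Odd d) (hn : 1 ≤ n) {ι : E →ₐ[F] Matrix (Fin 2) (Fin 2) F}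
    (hι : ι π = !![Δ, 1; ϖ, 0]) {g : GL (Fin 2) F} (hg : g ∈ torusIwahori ι) :
    ∃ s : ℤ, valuation E (toGLE (E := E) g).1.det = valuation E (π : E) ^ (2 * s) ∧
      MovesCell π d n (toGLE (E := E) g) s := by
  rw [torusIwahori, Subgroup.sup_eq_closure] at hg
  have hmul : ∀ x y : GL (Fin 2) F, (∃ s : ℤ, valuation E (toGLE (E := E) x).1.det =
      valuation E (π : E) ^ (2 * s) ∧ MovesCell π d n (toGLE (E := E) x) s) →
      (∃ s : ℤ, valuation E (toGLE (E := E) y).1.det =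
      valuation E (π : E) ^ (2 * s) ∧ MovesCell π d n (toGLE (E := E) y) s) →
      ∃ s : ℤ, valuation E (toGLE (E := E) (x * y)).1.det =
      valuation E (π : E) ^ (2 * s) ∧ MovesCell π d n (toGLE (E := E) (x * y)) s := by
    rintro x y ⟨s, hs, hx⟩ ⟨t, ht, hy⟩
    refine ⟨s + t, ?_, by rw [map_mul]; exact hx.mul hy⟩
    rw [map_mul, Units.val_mul, Matrix.det_mul, map_mul, hs, ht, mul_add,
      zpow_add₀ h.val_ne_zero]
  have key : ∀ x : GL (Fin 2) F, x ∈ ((Units.map (ι : E →* Matrix (Fin 2) (Fin 2) F)).range :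
      Set (GL (Fin 2) F)) ∪ iwahori F → ∃ s : ℤ, valuation E (toGLE (E := E) x).1.det =
      valuation E (π : E) ^ (2 * s) ∧ MovesCell π d n (toGLE (E := E) x) s := by
    rintro x (⟨u, rfl⟩ | hx)
    · exact movesCell_torus h hd hn hι u
    · exact movesCell_iwahori h hd hn hx
  induction hg using Subgroup.closure_induction'' with
  | mem x hx => exact key x hx
  | inv_mem x hx =>
    refine key x⁻¹ ?_
    rcases hx with hx | hx
    · exact Or.inl (inv_mem hx)
    · exact Or.inr (inv_mem hx)
  | one => exact key 1 (Or.inr (one_mem _))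
  | mul x y _ _ hx hy => exact hmul x y hx hy

/-- The exponent s is determined by the determinant, since |ϖ| = |π|² turns ord_F into half the
valuation in E. -/
theorem movesCell_of_mem_of_val (hd : Odd d) (hn : 1 ≤ n)
    {ι : E →ₐ[F] Matrix (Fin 2) (Fin 2) F} (hι : ι π = !![Δ, 1; ϖ, 0]) {g : GL (Fin 2) F}
    (hg : g ∈ torusIwahori ι) {s : ℤ} (hs : valuation F g.1.det = valuation F ϖ ^ s) :
    MovesCell π d n (toGLE (E := E) g) s := by
  obtain ⟨t, ht, hm⟩ := movesCell_of_mem h hd hn hι hg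
  have e : (toGLE (E := E) g).1.det = algebraMap F E g.1.det := by
    rw [Matrix.det_fin_two, Matrix.det_fin_two, map_sub, map_mul, map_mul]; rfl
  have e2 := congrArg (ValuativeExtension.mapValueGroupWithZero F E) hs
  rw [map_zpow₀, ValuativeExtension.mapValueGroupWithZero_valuation,
    ValuativeExtension.mapValueGroupWithZero_valuation, ← e, ht, h.val_uniformizer,
    ← zpow_natCast, ← zpow_mul, h.zpow_inj] at e2
  obtain rfl : t = s := by push_cast at e2; omega
  exact hm

end Torus


/-! ### The transformations β_g -/

variable {F E : Type*} [Field F] [Field E] [Algebra F E] [ValuativeRel E]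
variable {τ : E ≃ₐ[F] E} {π : Eˣ} {d n m : ℕ}

theorem eZero_mul_eZero {L : Type*} [Field L] (a b c e : Lˣ) :
    eZero a b * eZero c e = eZero (a * c) (b * e) := by
  apply GL_ext <;> simp [coe_mul_apply, coe_eZero]

theorem coset_mul_right {L : Type*} [Field L] [ValuativeRel L] {x y g : GL (Fin 2) L}
    (hg : g ∈ Subgroup.center (GL (Fin 2) L) ⊔ iwahori L)
    (e : (x : GL (Fin 2) L ⧸ level L m) = y) :
    ((x * g : GL (Fin 2) L) : GL (Fin 2) L ⧸ level L m) = (y * g : GL (Fin 2) L) := by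
  rw [QuotientGroup.eq] at e ⊢
  convert (conj_mem_level_iff hg).2 e using 1
  group

theorem coset_mul_left {L : Type*} [Field L] [ValuativeRel L] {x y : GL (Fin 2) L}
    (g : GL (Fin 2) L) (e : (x : GL (Fin 2) L ⧸ level L m) = y) :
    ((g * x : GL (Fin 2) L) : GL (Fin 2) L ⧸ level L m) = (g * y : GL (Fin 2) L) := by
  rw [QuotientGroup.eq] at e ⊢
  convert e using 1
  group

theorem pt_mul_iElt_zero (h : IsWild τ π d) (a : E) (C c : Eˣ) :
    pt τ π d n a C * iElt τ π n c 0 = pt τ π d n a (C * c) := by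
  rw [pt, iElt_zero h, mul_assoc _ (eZero _ _), eZero_mul_eZero, pt, map_mul]
  congr 2
  simp only [mul_comm, mul_left_comm]

theorem iElt_zero_comm (h : IsWild τ π d) (t t' : Eˣ) :
    Commute (iElt τ π n t 0) (iElt τ π n t' 0) := by
  rw [Commute, SemiconjBy, iElt_zero h, iElt_zero h, eZero_mul_eZero, eZero_mul_eZero, mul_comm t,
    mul_comm (Units.map _ t)]

theorem iElt_zero_zpow_mem (h : IsWild τ π d) (hn : 1 ≤ n) (s : ℤ) :
    iElt τ π n π 0 ^ s ∈ Subgroup.center (GL (Fin 2) E) ⊔ iwahori E :=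
  zpow_mem (iElt_mem_center_sup h hn π (by simp)) s

theorem iElt_zero_zpow (h : IsWild τ π d) (s : ℤ) : ∃ i ∈ iwahori E,
    iElt τ π n π 0 ^ s = Matrix.GeneralLinearGroup.scalar (Fin 2) (π ^ s) * i := by
  have e : iElt τ π n π 0 =
      Matrix.GeneralLinearGroup.scalar (Fin 2) π * eZero 1 (eps τ π) := by
    rw [iElt_zero h]
    apply GL_ext <;>
      simp [coe_eZero, coe_mul_apply, Matrix.GeneralLinearGroup.scalar, IsWild.tau_pi, mul_comm]
  refine ⟨eZero 1 (eps τ π) ^ s, zpow_mem ?_ s, ?_⟩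
  · rw [mem_iwahori, coe_eZero]
    simp [h.val_eps]
  · rw [e, Commute.mul_zpow, map_zpow]
    exact (scalar_comm _ _).symm

theorem twisted_zpow {g : GL (Fin 2) E} (hg : wDot τ π n * tauGL τ g = g * wDot τ π n) (s : ℤ) :
    wDot τ π n * tauGL τ (g ^ s) = g ^ s * wDot τ π n := by
  have hw' : tauGL τ g = (wDot τ π n)⁻¹ * g * (wDot τ π n)⁻¹⁻¹ := by
    rw [inv_inv, mul_assoc, ← hg, inv_mul_cancel_left]
  rw [map_zpow, hw', conj_zpow, inv_inv, ← mul_assoc, mul_inv_cancel_left]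

/-- The transformation `β_g` preserves the set of the points `x(a, C)`. -/
theorem exists_smul_pt_eq (h : IsWild τ π d) (hd : Odd d) (hn : 1 ≤ n) {g : GL (Fin 2) F} {s : ℤ}
    (hg : MovesCell π d n (toGLE (E := E) g) s) {a : E}
    (ha : valuation E a = valuation E (π : E)) {C : Eˣ} (hC : valuation E (C : E) = 1) :
    ∃ (b : E) (C' : Eˣ), valuation E b = valuation E (π : E) ∧ valuation E (C' : E) = 1 ∧
      ((toGLE g * pt τ π d n a C * iElt τ π n π 0 ^ (-s) : GL (Fin 2) E) :
        GL (Fin 2) E ⧸ level E m) = (pt τ π d n b C' : GL (Fin 2) E) := by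
  obtain ⟨a', ha', i, hi, e⟩ := hg a ha
  obtain ⟨j, hj, ej⟩ := iElt_zero_zpow (n := n) h (-s)
  have ex : toGLE g * pt τ π d n a C * iElt τ π n π 0 ^ (-s) =
      eMinus a' * vDot π d n * (i * ptI τ π d n a C * j) := by
    rw [pt_eq, ← mul_assoc, e, ej, zpow_neg, map_inv]
    simp only [mul_assoc]
    congr 2
    rw [← map_inv]
    simp only [← mul_assoc]
    rw [scalar_comm, map_inv]
    simp only [← mul_assoc, inv_mul_cancel, one_mul]
  rw [ex]
  refine exists_pt_eq h hd hn ha' (mul_mem (mul_mem hi (ptI_mem_iwahori h hn ha hC)) hj) ?_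
  rw [← ex]
  apply inv_mul_tauGL_mem_of_twisted
  rw [map_mul, map_mul, tauGL_toGLE, pt_twisted h hd ha, mul_assoc, mul_assoc _ (wDot _ _ _),
    twisted_zpow (iElt_twisted h hn π (by simp))]
  simp only [mul_assoc]

theorem iElt_zpow_mem_gammaTilde (h : IsWild τ π d) (hn : 1 ≤ n) (s : ℤ) :
    iElt τ π n π 0 ^ s ∈ gammaTilde τ π n m :=
  zpow_mem (iElt_mem_gammaTilde h hn π (by simp)) s

/-- Left and right multiplication commute, so only points x(a, C) matter; β_g preserves these, and
i(π, 0)^s lies in Γ̃. -/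
theorem smul_mem_XTilde (h : IsWild τ π d) (hd : Odd d) (hn : 1 ≤ n) {g : GL (Fin 2) F} {s : ℤ}
    (hg : MovesCell π d n (toGLE (E := E) g) s) {y : GL (Fin 2) E ⧸ level E m}
    (hy : y ∈ XTilde τ π d n m) : toGLE (E := E) g • y ∈ XTilde τ π d n m := by
  obtain ⟨x, i, hx, hi, rfl⟩ := hy
  obtain ⟨a, C, ha, hC, e⟩ := exists_pt_of_mem_XP h hd hn hx
  obtain ⟨b, C', hb, hC', e'⟩ := exists_smul_pt_eq (m := m) h hd hn hg ha hC
  refine ⟨pt τ π d n b C', iElt τ π n π 0 ^ s * i, pt_mem_XP h hd hn hb hC',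
    mul_mem (iElt_zpow_mem_gammaTilde h hn s) hi, ?_⟩
  rw [MulAction.Quotient.smul_coe, smul_eq_mul]
  have e1 := coset_mul_right (mul_mem (iElt_zero_zpow_mem (n := n) h hn s) hi.1) e'
  rw [← e1]
  have e2 := coset_mul_left (toGLE g) (coset_mul_right hi.1 e)
  rw [e2]
  congr 1
  rw [zpow_neg]
  simp only [mul_assoc, inv_mul_cancel_left]

section Classes

theorem mem_maximalIdeal_and_iff (h : IsWild τ π d) {a : 𝒪[E]} :
    (a ∈ 𝓂[E] ∧ a ∉ 𝓂[E] ^ 2) ↔ valuation E (a : E) = valuation E (π : E) := by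
  rw [← h.uniformizer_iff, coe_mem_pp, coe_mem_pp, pow_one]

theorem val_toE (c : 𝒪[E]ˣ) : valuation E (toE c : E) = 1 :=
  (Valuation.integer.integers (valuation E)).isUnit_iff_valuation_eq_one.1 c.isUnit

theorem exists_toE_eq {c : Eˣ} (hc : valuation E (c : E) = 1) : ∃ c' : 𝒪[E]ˣ, toE c' = c := by
  have hu : IsUnit (⟨c, hc.le⟩ : 𝒪[E]) :=
    (Valuation.integer.integers (valuation E)).isUnit_iff_valuation_eq_one.2 hc
  exact ⟨hu.unit, Units.ext rfl⟩

theorem cls_eq_iff {k : ℕ} {a b : 𝒪[E]} : cls k a = cls k b ↔ (a : E) - b ∈ pp E k := by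
  rw [Ideal.Quotient.eq, ← coe_mem_pp]; rfl

theorem ucls_eq_iff {k : ℕ} {a b : 𝒪[E]ˣ} :
    ucls k a = ucls k b ↔ (toE a : E) - toE b ∈ pp E k := by
  rw [Units.ext_iff]
  exact cls_eq_iff

/-- The condition on k ensures that the class modulo 𝔭^k still detects being a uniformizer, so that
every lift has this property and not just the one in the definition of `star`. -/
theorem cls_mem_star_iff (h : IsWild τ π d) {k : ℕ} (hk : 2 ≤ k) {a : 𝒪[E]} :
    cls k a ∈ star E k ↔ valuation E (a : E) = valuation E (π : E) := by
  constructor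
  · rintro ⟨b, hb, hb2, e⟩
    have hb' := (mem_maximalIdeal_and_iff h).1 ⟨hb, hb2⟩
    have hab := cls_eq_iff.1 e
    have e : (a : E) = b - (b - a) := by ring
    rw [e, Valuation.map_sub_eq_of_lt_left, hb']
    rw [hb']
    refine (h.mem_pp.1 (pp_anti hk hab)).trans_lt ?_
    rw [sq]; exact mul_lt_of_lt_one_left h.val_pos h.lt_one
  · intro ha
    obtain ⟨h1, h2⟩ := (mem_maximalIdeal_and_iff h).2 ha
    exact ⟨a, h1, h2, rfl⟩

theorem exists_integer_eq {x : E} (hx : valuation E x ≤ 1) : ∃ a : 𝒪[E], (a : E) = x :=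
  ⟨⟨x, hx⟩, rfl⟩

/-- It is enough to find the image of x(a, 1). Right multiplication by i(C, 0) takes x(a, 1) to x(a,
C) and commutes with i(π, 0)^(-s), so it multiplies the second coordinate of the image by C.
Independence of the lifts is `pt_coset_congr`. -/
theorem exists_isBeta (h : IsWild τ π d) (hd : Odd d) (hn : 1 ≤ n) {g : GL (Fin 2) F} {s : ℤ}
    (hg : MovesCell π d n (toGLE (E := E) g) s) :
    ∃ bA bC, IsBeta τ π d n m g s bA bC := by
  have key : ∀ x ∈ star E (n + d + m + 1), ∃ p : Quo E (n + d + m + 1) × (Quo E (m + 1))ˣ,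
      p.1 ∈ star E (n + d + m + 1) ∧ ∀ (a b : 𝒪[E]) (C C' : 𝒪[E]ˣ), cls _ a = x →
        cls _ b = p.1 → ucls (m + 1) C' = p.2 * ucls (m + 1) C →
        ((toGLE g * pt τ π d n a (toE C) * iElt τ π n π 0 ^ (-s) : GL (Fin 2) E) :
          GL (Fin 2) E ⧸ level E m) = (pt τ π d n b (toE C') : GL (Fin 2) E) := by
    rintro x ⟨a₀, ha₀, ha₀', rfl⟩
    have hva₀ := (mem_maximalIdeal_and_iff h).1 ⟨ha₀, ha₀'⟩
    obtain ⟨b, C, hb, hC, e⟩ := exists_smul_pt_eq (m := m) h hd hn hg hva₀ (C := 1) (by simp)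
    obtain ⟨b₀, rfl⟩ := exists_integer_eq (x := b) (by rw [hb]; exact h.lt_one.le)
    obtain ⟨C₀, rfl⟩ := exists_toE_eq hC
    have hN : 2 ≤ n + d + m + 1 := by obtain ⟨k, rfl⟩ := hd; omega
    refine ⟨(cls _ b₀, ucls _ C₀), (cls_mem_star_iff h hN).2 hb, ?_⟩
    intro a b C C' hxa hxb hC'
    have hva := (cls_mem_star_iff h hN).1 (hxa ▸ (cls_mem_star_iff h hN).2 hva₀)
    have hvb := (cls_mem_star_iff h hN).1 (by rw [hxb]; exact (cls_mem_star_iff h hN).2 hb)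
    rw [← map_mul, ucls_eq_iff] at hC'
    have e1 := pt_coset_congr (n := n) (m := m) h hd hn hva hva₀ (val_toE C) (val_toE C)
      (cls_eq_iff.1 hxa.symm) (by simp)
    have e2 := coset_mul_right (iElt_zero_zpow_mem (n := n) h hn (-s)) (coset_mul_left (toGLE g) e1)
    rw [e2, ← one_mul (toE C), ← pt_mul_iElt_zero h]
    have e3 := coset_mul_right (iElt_mem_center_sup h hn (toE C) (r := 0) (by simp)) e
    rw [pt_mul_iElt_zero h, mul_assoc,
      ((iElt_zero_comm h π (toE C)).zpow_left (-s)).eq] at e3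
    simp only [mul_assoc] at e3 ⊢
    rw [e3]
    refine pt_coset_congr h hd hn hb hvb ?_ (val_toE C') (cls_eq_iff.1 hxb) ?_
    · rw [Units.val_mul, map_mul, val_toE, val_toE, one_mul]
    · rw [← map_mul]; exact hC'
  -- Values off `star` are arbitrary; `IsBeta` does not involve them.
  choose! p hp hp' using key
  refine ⟨fun x => (p x).1, fun x => (p x).2, fun a ha ha' => ?_⟩
  have hx : cls (n + d + m + 1) a ∈ star E (n + d + m + 1) := ⟨a, ha, ha', rfl⟩
  exact ⟨hp _ hx, fun b C C' hb hC => hp' _ hx a b C C' rfl hb hC⟩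

end Classes

end WildGL2

/-- The trace in terms of a spanning family with a dual family of functionals. -/
theorem LinearMap.trace_eq_sum_of_dual {K V ι : Type*} [Field K] [AddCommGroup V] [Module K V]
    [Fintype ι] [DecidableEq ι] (e : ι → V) (φ : ι → V →ₗ[K] K)
    (hspan : ⊤ ≤ Submodule.span K (Set.range e))
    (hφ : ∀ i j, φ i (e j) = if i = j then 1 else 0) (f : V →ₗ[K] V) :
    LinearMap.trace K V f = ∑ i, φ i (f (e i)) := by
  have hli : LinearIndependent K e := by
    rw [Fintype.linearIndependent_iff]
    intro c hc i
    have := congrArg (φ i) hc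
    simpa [map_sum, hφ] using this
  let b := Module.Basis.mk hli hspan
  have hb : ∀ i, b i = e i := fun i => Module.Basis.mk_apply hli hspan i
  have hcoord : ∀ i, b.coord i = φ i := by
    intro i
    refine b.ext fun j => ?_
    rw [Module.Basis.coord_apply, Module.Basis.repr_self, hb, hφ, Finsupp.single_apply]
    simp only [eq_comm]
  rw [LinearMap.trace_eq_matrix_trace K b f, Matrix.trace]
  refine Finset.sum_congr rfl fun i _ => ?_
  rw [Matrix.diag_apply, LinearMap.toMatrix_apply, hb, ← hcoord]
  rfl

namespace WildGL2

variable {F E : Type*} [Field F] [Field E] [Algebra F E] [ValuativeRel E]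
variable {τ : E ≃ₐ[F] E} {π : Eˣ} {d n m : ℕ}

/-! ### The quotient V and functionals supported on single orbits -/

section Isotypic

variable {K : Type*} [Field K] {θ : gammaTilde τ π n m →* Kˣ}

variable (d θ) in
/-- The image of `δ_x` in `V_θ`. -/
def delta (x : GL (Fin 2) E) (hx : (x : GL (Fin 2) E ⧸ level E m) ∈ XTilde τ π d n m) :
    V d θ :=
  Submodule.Quotient.mk (Finsupp.single ⟨_, hx⟩ 1)

theorem delta_congr {x y : GL (Fin 2) E} (e : (x : GL (Fin 2) E ⧸ level E m) = y)
    (hx : (x : GL (Fin 2) E ⧸ level E m) ∈ XTilde τ π d n m)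
    (hy : (y : GL (Fin 2) E ⧸ level E m) ∈ XTilde τ π d n m) :
    delta d θ x hx = delta d θ y hy := by
  simp only [delta, e]

theorem delta_mul {x : GL (Fin 2) E} (i : gammaTilde τ π n m)
    (hx : (x : GL (Fin 2) E ⧸ level E m) ∈ XTilde τ π d n m)
    (hxi : ((x * i : GL (Fin 2) E) : GL (Fin 2) E ⧸ level E m) ∈ XTilde τ π d n m) :
    delta d θ (x * i) hxi = (θ i : K) • delta d θ x hx := by
  rw [delta, delta, ← Submodule.Quotient.mk_smul, Submodule.Quotient.eq]
  exact Submodule.subset_span ⟨x, i, hx, hxi, rfl⟩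

theorem mul_mem_XTilde {x : GL (Fin 2) E} {i : GL (Fin 2) E} (hi : i ∈ gammaTilde τ π n m)
    (hx : (x : GL (Fin 2) E ⧸ level E m) ∈ XTilde τ π d n m) :
    ((x * i : GL (Fin 2) E) : GL (Fin 2) E ⧸ level E m) ∈ XTilde τ π d n m := by
  obtain ⟨y, j, hy, hj, e⟩ := hx
  exact ⟨y, j * i, hy, mul_mem hj hi, by rw [← mul_assoc]; exact coset_mul_right hi.1 e⟩

theorem mem_XTilde_of_mem_XP {x : GL (Fin 2) E}
    (hx : (x : GL (Fin 2) E ⧸ level E m) ∈ XP τ π d n m) :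
    (x : GL (Fin 2) E ⧸ level E m) ∈ XTilde τ π d n m :=
  ⟨x, 1, hx, one_mem _, by rw [mul_one]⟩

theorem span_delta_eq_top {s : Set (V d θ)}
    (hs : ∀ (x : GL (Fin 2) E) (hx : (x : GL (Fin 2) E ⧸ level E m) ∈ XTilde τ π d n m),
      delta d θ x hx ∈ Submodule.span K s) : Submodule.span K s = ⊤ := by
  rw [eq_top_iff]
  rintro v -
  obtain ⟨f, rfl⟩ := Submodule.Quotient.mk_surjective _ v
  induction f using Finsupp.induction_linear with
  | zero => exact zero_mem _
  | add f g hf hg => exact add_mem hf hg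
  | single y c =>
    obtain ⟨⟨x⟩, hx⟩ := y
    have hx' : (x : GL (Fin 2) E ⧸ level E m) ∈ XTilde τ π d n m := hx
    have e : (Submodule.Quotient.mk (Finsupp.single ⟨_, hx'⟩ c) : V d θ) = c • delta d θ x hx' := by
      rw [delta, ← Submodule.Quotient.mk_smul, Finsupp.smul_single, smul_eq_mul, mul_one]
    exact e ▸ Submodule.smul_mem _ c (hs x hx')

open Classical in
variable (θ) in
/-- The function supported on the orbit `p Γ̃` with value `θ(γ)` at `p γ`. -/
def orbitFun (p : GL (Fin 2) E) (z : GL (Fin 2) E ⧸ level E m) : K :=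
  if hz : ∃ γ : gammaTilde τ π n m,
    ((p * γ : GL (Fin 2) E) : GL (Fin 2) E ⧸ level E m) = z then (θ hz.choose : K) else 0

/-- The element γ chosen in `orbitFun` is determined up to J, where θ̃ is trivial. -/
theorem orbitFun_mul (hθ : TrivialOnLevel θ) (p : GL (Fin 2) E) (γ : gammaTilde τ π n m) :
    orbitFun θ p ((p * γ : GL (Fin 2) E) : GL (Fin 2) E ⧸ level E m) = θ γ := by
  have hz : ∃ γ' : gammaTilde τ π n m, ((p * γ' : GL (Fin 2) E) : GL (Fin 2) E ⧸ level E m) =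
    (p * γ : GL (Fin 2) E) := ⟨γ, rfl⟩
  rw [orbitFun, dif_pos hz]
  have e := QuotientGroup.eq.1 hz.choose_spec
  rw [mul_inv_rev, mul_assoc, inv_mul_cancel_left] at e
  have := hθ (hz.choose⁻¹ * γ) e
  rw [map_mul, map_inv, inv_mul_eq_one] at this
  rw [this]

theorem orbitFun_eq_zero {p : GL (Fin 2) E} {z : GL (Fin 2) E ⧸ level E m}
    (hz : ∀ γ : gammaTilde τ π n m, ((p * γ : GL (Fin 2) E) : GL (Fin 2) E ⧸ level E m) ≠ z) :
    orbitFun θ p z = 0 := by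
  rw [orbitFun, dif_neg]
  rintro ⟨γ, hγ⟩
  exact hz γ hγ

/-- This equivariance makes the function vanish on `relations`, hence descend to V. -/
theorem orbitFun_smul (hθ : TrivialOnLevel θ) (p x : GL (Fin 2) E) (i : gammaTilde τ π n m) :
    orbitFun θ p ((x * i : GL (Fin 2) E) : GL (Fin 2) E ⧸ level E m) =
      θ i * orbitFun θ p (x : GL (Fin 2) E ⧸ level E m) := by
  by_cases hz : ∃ γ : gammaTilde τ π n m, ((p * γ : GL (Fin 2) E) : GL (Fin 2) E ⧸ level E m) = x
  · obtain ⟨γ, hγ⟩ := hz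
    rw [← hγ, orbitFun_mul hθ, ← coset_mul_right i.2.1 hγ, mul_assoc, ← Subgroup.coe_mul,
      orbitFun_mul hθ, map_mul, Units.val_mul, mul_comm]
  · push Not at hz
    rw [orbitFun_eq_zero hz, mul_zero]
    refine orbitFun_eq_zero fun γ hγ => hz (γ * i⁻¹) ?_
    have := coset_mul_right (inv_mem i.2.1) hγ
    rwa [mul_inv_cancel_right, mul_assoc] at this

variable (d) in
/-- The functional on `V_θ` given by `orbitFun`. -/
def orbitDual (hθ : TrivialOnLevel θ) (p : GL (Fin 2) E) : V d θ →ₗ[K] K :=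
  (relations d θ).liftQ (Finsupp.linearCombination K
    fun z : XTilde τ π d n m => orbitFun θ p z.1) (by
    rw [relations, Submodule.span_le]
    rintro f ⟨x, i, hx, hxi, rfl⟩
    simp [orbitFun_smul hθ])

theorem orbitDual_delta (hθ : TrivialOnLevel θ) (p x : GL (Fin 2) E)
    (hx : (x : GL (Fin 2) E ⧸ level E m) ∈ XTilde τ π d n m) :
    orbitDual d hθ p (delta d θ x hx) = orbitFun θ p (x : GL (Fin 2) E ⧸ level E m) := by
  rw [orbitDual, delta, ← Submodule.mkQ_apply, ← LinearMap.comp_apply, Submodule.liftQ_mkQ]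
  simp

theorem Xi_delta [ValuativeRel F] {ι : E →ₐ[F] Matrix (Fin 2) (Fin 2) F}
    (hX : ∀ g ∈ torusIwahori ι, ∀ y ∈ XTilde τ π d n m,
      toGLE (E := E) g • y ∈ XTilde τ π d n m) (g : torusIwahori ι) {x : GL (Fin 2) E}
    (hx : (x : GL (Fin 2) E ⧸ level E m) ∈ XTilde τ π d n m)
    (hgx : ((toGLE g.1 * x : GL (Fin 2) E) : GL (Fin 2) E ⧸ level E m) ∈ XTilde τ π d n m) :
    Xi d ι hX θ g (delta d θ x hx) = delta d θ (toGLE g.1 * x) hgx := by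
  have e : Xi d ι hX θ g (delta d θ x hx) = Submodule.Quotient.mk
      (Finsupp.lmapDomain K K (fun y : XTilde τ π d n m =>
        (⟨toGLE (E := E) g.1 • y.1, hX g.1 g.2 y.1 y.2⟩ : XTilde τ π d n m))
        (Finsupp.single ⟨_, hx⟩ 1)) := rfl
  rw [e, Finsupp.lmapDomain_apply, Finsupp.mapDomain_single]
  rfl

end Isotypic


/-! ### Cardinality of the quotients of the ring of integers of E -/

section Counting

variable {F E : Type*} [Field F] [Field E] [Algebra F E] [ValuativeRel E]
variable {τ : E ≃ₐ[F] E} {π : Eˣ} {d : ℕ}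

theorem irreducible_uniformizer (h : IsWild τ π d) : Irreducible (⟨π, h.lt_one.le⟩ : 𝒪[E]) := by
  have hunit : ∀ x : 𝒪[E], IsUnit x ↔ valuation E (x : E) = 1 := fun x =>
    (Valuation.integer.integers (valuation E)).isUnit_iff_valuation_eq_one
  refine ⟨fun hu => h.lt_one.ne ((hunit _).1 hu), fun a b hab => ?_⟩
  by_contra hcon
  push Not at hcon
  rw [hunit, hunit] at hcon
  have ha := h.le_of_lt_one (lt_of_le_of_ne a.2 hcon.1)
  have hb := lt_of_le_of_ne b.2 hcon.2
  have e : (π : E) = a * b := congrArg Subtype.val hab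
  have : valuation E (π : E) < valuation E (π : E) := by
    conv_lhs => rw [e, map_mul]
    calc _ ≤ valuation E (π : E) * valuation E (b : E) := by gcongr
      _ < _ := mul_lt_of_lt_one_right h.val_pos hb
  exact lt_irrefl _ this

theorem isDiscreteValuationRing (h : IsWild τ π d) : IsDiscreteValuationRing 𝒪[E] := by
  refine IsDiscreteValuationRing.ofHasUnitMulPowIrreducibleFactorization
    ⟨⟨π, h.lt_one.le⟩, irreducible_uniformizer h, fun {x} hx => ?_⟩
  have hx0 : (x : E) ≠ 0 := fun h0 => hx (Subtype.ext h0)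
  obtain ⟨k, hk⟩ := h.exists_zpow x hx0
  have hx1 : valuation E (x : E) ≤ 1 := x.2
  rw [hk, ← zpow_zero (valuation E (π : E)), h.zpow_le_zpow_iff] at hx1
  lift k to ℕ using hx1
  rw [zpow_natCast] at hk
  have hpk : valuation E (π : E) ^ k ≠ 0 := pow_ne_zero _ h.val_ne_zero
  obtain ⟨c, hc⟩ := exists_toE_eq (c := Units.mk0 _ hx0 * (π ^ k)⁻¹) (by
    simp [hk])
  refine ⟨k, c, Subtype.ext ?_⟩
  have hc' : ((c : 𝒪[E]) : E) = x * ((π : E) ^ k)⁻¹ := by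
    have := congrArg Units.val hc
    exact this.trans (by simp)
  change (π : E) ^ k * ((c : 𝒪[E]) : E) = x
  rw [hc']
  field_simp

variable {ϖ Δ : F} (h : IsWildOver τ π d ϖ Δ) [ValuativeRel F] [ValuativeExtension F E]
include h

/-- The extension is totally ramified. -/
theorem card_residueField : Nat.card (𝒪[E] ⧸ 𝓂[E]) = Nat.card 𝓀[F] := by
  let f : 𝒪[F] →+* 𝒪[E] := (algebraMap F E).restrict 𝒪[F] 𝒪[E] fun x hx =>
    val_algebraMap_le_one_iff.2 hx
  let q : 𝒪[F] →+* 𝒪[E] ⧸ 𝓂[E] := (Ideal.Quotient.mk 𝓂[E]).comp f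
  have hker : RingHom.ker q = 𝓂[F] := by
    ext x
    rw [RingHom.mem_ker, RingHom.comp_apply, Ideal.Quotient.eq_zero_iff_mem, mem_maximalIdeal_iff,
      mem_maximalIdeal_iff]
    exact val_algebraMap_lt_one_iff
  have hsurj : Function.Surjective q := by
    intro z
    obtain ⟨⟨u, hu⟩, rfl⟩ := Ideal.Quotient.mk_surjective z
    obtain ⟨x, y, rfl⟩ := h.exists_eq_add u
    have hmax := val_algebraMap_add_mul h x y (c := π) rfl
    have hu' : valuation E (algebraMap F E x + algebraMap F E y * π) ≤ 1 := hu
    rw [hmax, max_le_iff] at hu'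
    refine ⟨⟨x, val_algebraMap_le_one_iff.1 hu'.1⟩, ?_⟩
    rw [RingHom.comp_apply, Ideal.Quotient.eq, mem_maximalIdeal_iff]
    change valuation E (algebraMap F E x - (algebraMap F E x + algebraMap F E y * π)) < 1
    rw [sub_add_cancel_left, Valuation.map_neg, map_mul]
    refine lt_of_le_of_ne hu'.2 fun e => ?_
    have := val_algebraMap_ne h 1 y one_ne_zero
    rw [map_one, map_one] at this
    exact this e.symm
  have e := (Ideal.quotEquivOfEq hker.symm).trans (RingHom.quotientKerEquivOfSurjective hsurj)
  exact (Nat.card_congr e.toEquiv).symm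

theorem card_quo (k : ℕ) : Nat.card (Quo E k) = Nat.card 𝓀[F] ^ k := by
  have := isDiscreteValuationRing h.toIsWild
  have hne : 𝓂[E] ≠ ⊥ := IsDiscreteValuationRing.not_a_field 𝒪[E]
  have := cardQuot_pow_of_prime (P := 𝓂[E]) hne (i := k)
  rw [Submodule.cardQuot_apply, Submodule.cardQuot_apply] at this
  rw [← card_residueField h]
  exact this

end Counting


variable {F E : Type*} [Field F] [Field E] [Algebra F E] [ValuativeRel E]
variable {τ : E ≃ₐ[F] E} {π : Eˣ} {d n m : ℕ}

/-! ### Reduction between the quotients -/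

section Reduction

variable (E) in
/-- The reduction `𝒪_E / 𝔭_E ^ (j+k) → 𝒪_E / 𝔭_E ^ j`. -/
def quoRed {j k : ℕ} (hjk : j ≤ k) : Quo E k →+* Quo E j :=
  Ideal.Quotient.factor (Ideal.pow_le_pow_right hjk)

theorem quoRed_cls {j k : ℕ} (hjk : j ≤ k) (a : 𝒪[E]) : quoRed E hjk (cls k a) = cls j a := rfl

theorem quoRed_surjective {j k : ℕ} (hjk : j ≤ k) : Function.Surjective (quoRed E hjk) :=
  Ideal.Quotient.factor_surjective _

theorem quoRed_mem_star_iff (h : IsWild τ π d) {j k : ℕ} (hj : 2 ≤ j) (hjk : j ≤ k) {x : Quo E k} :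
    quoRed E hjk x ∈ star E j ↔ x ∈ star E k := by
  obtain ⟨a, rfl⟩ := Ideal.Quotient.mk_surjective x
  exact (cls_mem_star_iff h hj).trans (cls_mem_star_iff h (hj.trans hjk)).symm

/-- The fibres of a surjective additive homomorphism all have the same size, here q^(k−j) = q^i.
With i = m this is the source of the factor q^(-m) in the trace formula. -/
theorem sum_comp_quoRed {q : ℕ} (hq : q ≠ 0) (hcard : ∀ k, Nat.card (Quo E k) = q ^ k) {i j k : ℕ}
    (hjk : j ≤ k) (hk : k = j + i) [Fintype (Quo E j)] [Fintype (Quo E k)] {K : Type*} [Field K]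
    (f : Quo E j → K) : ∑ y : Quo E k, f (quoRed E hjk y) = (q : K) ^ i * ∑ x, f x := by
  classical
  have hfib : ∀ x : Quo E j,
      (Finset.univ.filter fun y : Quo E k => quoRed E hjk y = x).card = q ^ i := by
    have heq : ∀ x : Quo E j, (Finset.univ.filter fun y : Quo E k => quoRed E hjk y = x).card =
        (Finset.univ.filter fun y : Quo E k => quoRed E hjk y = 0).card := fun x =>
      AddMonoidHom.card_fiber_eq_of_mem_range (quoRed E hjk).toAddMonoidHom
        (quoRed_surjective hjk x) (quoRed_surjective hjk 0)
    intro x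
    rw [heq]
    have h1 := Finset.card_eq_sum_card_fiberwise (f := quoRed E hjk) (s := Finset.univ)
      (t := Finset.univ) (fun _ _ => Finset.mem_coe.2 (Finset.mem_univ _))
    simp only [heq, Finset.sum_const, smul_eq_mul, Finset.card_univ] at h1
    have hpow : q ^ k = q ^ j * q ^ i := by rw [hk, pow_add]
    rw [← Nat.card_eq_fintype_card, ← Nat.card_eq_fintype_card, hcard, hcard, hpow] at h1
    exact (Nat.eq_of_mul_eq_mul_left (pow_pos (Nat.pos_of_ne_zero hq) _) h1).symm
  rw [← Finset.sum_fiberwise Finset.univ (quoRed E hjk), Finset.mul_sum]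
  refine Finset.sum_congr rfl fun x _ => ?_
  rw [Finset.sum_congr rfl (g := fun _ => f x)
    fun y hy => by rw [(Finset.mem_filter.1 hy).2], Finset.sum_const, hfib, nsmul_eq_mul]
  push_cast
  rfl

theorem exists_ucls_eq {k : ℕ} (hk : 1 ≤ k) (z : (Quo E k)ˣ) : ∃ c : 𝒪[E]ˣ, ucls k c = z := by
  obtain ⟨c, hc⟩ := Ideal.Quotient.mk_surjective (z : Quo E k)
  obtain ⟨c', hc'⟩ := Ideal.Quotient.mk_surjective ((z⁻¹ : (Quo E k)ˣ) : Quo E k)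
  have hu : IsUnit c := by
    by_contra hcon
    have hcm : c ∈ 𝓂[E] := (IsLocalRing.mem_maximalIdeal c).2 hcon
    have h1 : c * c' - 1 ∈ 𝓂[E] ^ k := by
      rw [← Ideal.Quotient.eq, map_mul, hc, hc', map_one, Units.mul_inv]
    have h2 := Ideal.pow_le_self (by omega) h1
    have h3 := sub_mem (Ideal.mul_mem_right c' _ hcm) h2
    rw [sub_sub_cancel] at h3
    exact (Ideal.ne_top_iff_one _).1 (IsLocalRing.maximalIdeal.isMaximal 𝒪[E]).ne_top h3
  exact ⟨hu.unit, Units.ext hc⟩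

end Reduction

/-! ### A basis of V indexed by uniformizers modulo 𝔭^(n+d+1) -/

section BasePoints

theorem valuation_coe_le_one (r : 𝒪[E]) : valuation E (r : E) ≤ 1 := r.2

theorem toE_one : toE (1 : 𝒪[E]ˣ) = 1 := map_one _

theorem ucls_one (k : ℕ) : ucls k (1 : 𝒪[E]ˣ) = 1 := map_one _

/-- A lift to `𝒪_E` of an element of `(𝔭_E / 𝔭_E ^ k)^*`. -/
def starRep {k : ℕ} (x : star E k) : 𝒪[E] := x.2.choose

theorem cls_starRep {k : ℕ} (x : star E k) : cls k (starRep x) = x := x.2.choose_spec.2.2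

theorem val_starRep (h : IsWild τ π d) {k : ℕ} (x : star E k) :
    valuation E (starRep x : E) = valuation E (π : E) :=
  (mem_maximalIdeal_and_iff h).1 ⟨x.2.choose_spec.1, x.2.choose_spec.2.1⟩

variable (τ π d n) in
/-- The chosen point of `X̃` over a class of uniformizers modulo `𝔭 ^ (n+d+1)`. -/
def basePt (x : star E (n + d + 1)) : GL (Fin 2) E := pt τ π d n (starRep x) 1

variable {K : Type*} [Field K] {θ : gammaTilde τ π n m →* Kˣ}

theorem pt_mem_XTilde (h : IsWild τ π d) (hd : Odd d) (hn : 1 ≤ n) {a : E}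
    (ha : valuation E a = valuation E (π : E)) {C : Eˣ} (hC : valuation E (C : E) = 1) :
    ((pt τ π d n a C : GL (Fin 2) E) : GL (Fin 2) E ⧸ level E m) ∈ XTilde τ π d n m :=
  mem_XTilde_of_mem_XP (pt_mem_XP h hd hn ha hC)

theorem basePt_mem (h : IsWild τ π d) (hd : Odd d) (hn : 1 ≤ n) (x : star E (n + d + 1)) :
    ((basePt τ π d n x : GL (Fin 2) E) : GL (Fin 2) E ⧸ level E m) ∈ XTilde τ π d n m :=
  pt_mem_XTilde h hd hn (val_starRep h x) (by simp)

theorem exists_pt_eq_basePt_mul (h : IsWild τ π d) (hd : Odd d) (hn : 1 ≤ n)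
    (hm : m + 1 = 2 * n + d) {a : 𝒪[E]} {x : star E (n + d + 1)}
    (hax : cls (n + d + 1) a = x) {C : Eˣ} (hC : valuation E (C : E) = 1) :
    ∃ γ : gammaTilde τ π n m, pt τ π d n a C = basePt τ π d n x * γ := by
  have hN : 2 ≤ n + d + 1 := by obtain ⟨k, rfl⟩ := hd; omega
  have ha := (cls_mem_star_iff h hN).1 (hax ▸ x.2)
  have hab : (a : E) - starRep x ∈ pp E (n + d + 1) := cls_eq_iff.1 (by rw [hax, cls_starRep])
  obtain ⟨t, r, -, hr, e, -, -⟩ := exists_pt_eq_pt_mul_iElt h hd hn hm (val_starRep h x) ha hab hC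
    rfl rfl
  exact ⟨⟨_, iElt_mem_gammaTilde h hn t hr⟩, e⟩

/-- Points with different classes modulo 𝔭^(n+d+1) lie in different Γ̃-orbits. -/
theorem orbitFun_basePt_eq_zero (h : IsWild τ π d) (hd : Odd d) (hn : 1 ≤ n)
    {x : star E (n + d + 1)} {b : 𝒪[E]} (hb : valuation E (b : E) = valuation E (π : E))
    (hbx : cls (n + d + 1) b ≠ x) {C : Eˣ} (hC : valuation E (C : E) = 1) :
    orbitFun θ (basePt τ π d n x) (pt τ π d n b C : GL (Fin 2) E) = 0 := by
  refine orbitFun_eq_zero fun γ hγ => hbx ?_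
  rw [← cls_starRep x]
  exact cls_eq_iff.2
    (sub_mem_of_pt_coset_eq h hd hn (val_starRep h x) hb (by simp) hC γ.2.1 hγ)

theorem orbitFun_basePt_basePt (h : IsWild τ π d) (hd : Odd d) (hn : 1 ≤ n)
    (hθ : TrivialOnLevel θ) [DecidableEq (star E (n + d + 1))] (x y : star E (n + d + 1)) :
    orbitFun θ (basePt τ π d n x) (basePt τ π d n y : GL (Fin 2) E) = if x = y then 1 else 0 := by
  split_ifs with hxy
  · subst hxy
    have := orbitFun_mul hθ (basePt τ π d n x) 1
    simpa using this
  · refine orbitFun_basePt_eq_zero h hd hn (val_starRep h y) (fun e => hxy ?_) (by simp)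
    rw [cls_starRep] at e
    exact Subtype.ext e.symm

/-- Every point of X̃ is a Γ̃-translate of some x(a, C), which is itself a Γ̃-translate of the base
point of its class; in V a translation only contributes a scalar. -/
theorem span_basePt (h : IsWild τ π d) (hd : Odd d) (hn : 1 ≤ n) (hm : m + 1 = 2 * n + d) :
    Submodule.span K (Set.range fun x : star E (n + d + 1) =>
      delta d θ (basePt τ π d n x) (basePt_mem h hd hn x)) = ⊤ := by
  refine span_delta_eq_top fun x hx => ?_
  obtain ⟨y, i, hy, hi, e⟩ := id hx
  obtain ⟨a, C, ha, hC, e'⟩ := exists_pt_of_mem_XP h hd hn hy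
  obtain ⟨a, rfl⟩ := exists_integer_eq (x := a) (by rw [ha]; exact h.lt_one.le)
  have hN : 2 ≤ n + d + 1 := by obtain ⟨k, rfl⟩ := hd; omega
  obtain ⟨γ, hγ⟩ := exists_pt_eq_basePt_mul (m := m) h hd hn hm (a := a)
    (x := ⟨_, (cls_mem_star_iff h hN).2 ha⟩) rfl hC
  have e1 : (x : GL (Fin 2) E ⧸ level E m) =
      (basePt τ π d n ⟨_, (cls_mem_star_iff h hN).2 ha⟩ * (γ * ⟨i, hi⟩ : gammaTilde τ π n m) :
        GL (Fin 2) E) := by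
    rw [← e, coset_mul_right hi.1 e', hγ, Subgroup.coe_mul, mul_assoc]
  rw [delta_congr e1 hx (e1 ▸ hx), delta_mul _ (basePt_mem h hd hn _)]
  exact Submodule.smul_mem _ _ (Submodule.subset_span ⟨_, rfl⟩)

theorem finite_V (h : IsWild τ π d) (hd : Odd d) (hn : 1 ≤ n) (hm : m + 1 = 2 * n + d)
    [Finite (star E (n + d + 1))] : Module.Finite K (V d θ) :=
  ⟨(Submodule.fg_def).2 ⟨_, Set.finite_range _, span_basePt h hd hn hm⟩⟩

end BasePoints

/-! ### Diagonal coefficients and the trace -/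

section Trace

variable {K : Type*} [Field K] {θ : gammaTilde τ π n m →* Kˣ}
variable [ValuativeRel F] {ι : E →ₐ[F] Matrix (Fin 2) (Fin 2) F}

/-- The diagonal coefficient of `Ξ_θ(g)` at a base point. -/
def diagCoeff (hX : ∀ g ∈ torusIwahori ι, ∀ y ∈ XTilde τ π d n m,
      toGLE (E := E) g • y ∈ XTilde τ π d n m) (h : IsWild τ π d) (hd : Odd d) (hn : 1 ≤ n)
    (hθ : TrivialOnLevel θ) (g : torusIwahori ι) (x : star E (n + d + 1)) : K :=
  orbitDual d hθ (basePt τ π d n x)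
    (Xi d ι hX θ g (delta d θ (basePt τ π d n x) (basePt_mem h hd hn x)))

variable (hX : ∀ g ∈ torusIwahori ι, ∀ y ∈ XTilde τ π d n m,
      toGLE (E := E) g • y ∈ XTilde τ π d n m) (h : IsWild τ π d) (hd : Odd d) (hn : 1 ≤ n)
    (hm : m + 1 = 2 * n + d) (hθ : TrivialOnLevel θ) (g : torusIwahori ι)

include hm

theorem trace_Xi [Fintype (star E (n + d + 1))] :
    LinearMap.trace K (V d θ) (Xi d ι hX θ g) = ∑ x, diagCoeff hX h hd hn hθ g x := by
  classical
  refine LinearMap.trace_eq_sum_of_dual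
    (fun x : star E (n + d + 1) => delta d θ (basePt τ π d n x) (basePt_mem h hd hn x))
    (fun x => orbitDual d hθ (basePt τ π d n x)) (span_basePt h hd hn hm).ge (fun x y => ?_) _
  rw [orbitDual_delta, orbitFun_basePt_basePt h hd hn hθ]

/-- The diagonal coefficient, computed at another point `x(a, 1)` of the same orbit. -/
theorem exists_mul_diagCoeff_eq {a : 𝒪[E]} {x : star E (n + d + 1)}
    (hax : cls (n + d + 1) a = x) : ∃ γ : gammaTilde τ π n m,
    orbitFun θ (basePt τ π d n x) (pt τ π d n a 1 : GL (Fin 2) E) = θ γ ∧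
      (θ γ : K) * diagCoeff hX h hd hn hθ g x = orbitFun θ (basePt τ π d n x)
        ((toGLE g.1 * pt τ π d n a 1 : GL (Fin 2) E) : GL (Fin 2) E ⧸ level E m) := by
  obtain ⟨γ, hγ⟩ := exists_pt_eq_basePt_mul (m := m) h hd hn hm hax (C := 1) (by simp)
  refine ⟨γ, by rw [hγ, orbitFun_mul hθ], ?_⟩
  have hmem := mul_mem_XTilde γ.2 (basePt_mem (m := m) h hd hn x)
  have hgmem : ((toGLE g.1 * (basePt τ π d n x * (γ : GL (Fin 2) E)) : GL (Fin 2) E) :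
      GL (Fin 2) E ⧸ level E m) ∈ XTilde τ π d n m := hX g.1 g.2 _ hmem
  have e := Xi_delta (θ := θ) hX g hmem hgmem
  rw [delta_mul γ (basePt_mem h hd hn x), map_smul] at e
  have e2 := congrArg (orbitDual d hθ (basePt τ π d n x)) e
  rw [map_smul, orbitDual_delta, ← hγ] at e2
  exact e2

/-- Replacing the base point by x(a, 1) in the same orbit multiplies both the vector and its image
by the same scalar, so the coefficient can be read off at any convenient lift a. -/
theorem diagCoeff_eq_character {a : 𝒪[E]} {x : star E (n + d + 1)}
    (hax : cls (n + d + 1) a = x) (γ : gammaTilde τ π n m)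
    (e : ((toGLE g.1 * pt τ π d n a 1 : GL (Fin 2) E) : GL (Fin 2) E ⧸ level E m) =
      (pt τ π d n a 1 * γ : GL (Fin 2) E)) : diagCoeff hX h hd hn hθ g x = θ γ := by
  obtain ⟨γ₀, h0, h1⟩ := exists_mul_diagCoeff_eq hX h hd hn hm hθ g hax
  rw [e, orbitFun_smul hθ, h0, mul_comm] at h1
  exact mul_right_cancel₀ (Units.ne_zero _) h1

theorem diagCoeff_eq_zero {a b : 𝒪[E]} {x : star E (n + d + 1)}
    (hax : cls (n + d + 1) a = x) (hb : valuation E (b : E) = valuation E (π : E))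
    (hbx : cls (n + d + 1) b ≠ x) {C : Eˣ} (hC : valuation E (C : E) = 1)
    (γ : gammaTilde τ π n m)
    (e : ((toGLE g.1 * pt τ π d n a 1 : GL (Fin 2) E) : GL (Fin 2) E ⧸ level E m) =
      (pt τ π d n b C * γ : GL (Fin 2) E)) : diagCoeff hX h hd hn hθ g x = 0 := by
  obtain ⟨γ₀, h0, h1⟩ := exists_mul_diagCoeff_eq hX h hd hn hm hθ g hax
  rw [e, orbitFun_smul hθ, orbitFun_basePt_eq_zero h hd hn hb hbx hC, mul_zero] at h1
  exact (mul_eq_zero.1 h1).resolve_left (Units.ne_zero _)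

omit hm in
include h hn in
theorem IsBeta.smul_pt_eq {s : ℤ} {bA : Quo E (n + d + m + 1) → Quo E (n + d + m + 1)}
    {bC : Quo E (n + d + m + 1) → (Quo E (m + 1))ˣ} {g : GL (Fin 2) F}
    (hβ : IsBeta τ π d n m g s bA bC) {a b : 𝒪[E]} {c : 𝒪[E]ˣ}
    (ha : valuation E (a : E) = valuation E (π : E)) (hb : cls _ b = bA (cls _ a))
    (hc : ucls _ c = bC (cls _ a)) :
    ((toGLE g * pt τ π d n a 1 : GL (Fin 2) E) : GL (Fin 2) E ⧸ level E m) =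
      (pt τ π d n b (toE c) * iElt τ π n π 0 ^ s : GL (Fin 2) E) := by
  obtain ⟨h1, h2⟩ := (mem_maximalIdeal_and_iff h).2 ha
  have e := (hβ a h1 h2).2 b 1 c hb (by rw [hc, ucls_one, mul_one])
  rw [toE_one] at e
  have e2 := coset_mul_right (iElt_zero_zpow_mem (n := n) h hn s) e
  rw [zpow_neg, inv_mul_cancel_right] at e2
  exact e2

/-- For a in A_g the image x(b, c) i(π, 0)^s of x(a, 1) equals x(a, 1) i(t', r') i(π, 0)^s, by the
transition formula between a and b. Its pair (t', r') and the prescribed (t, r) satisfy the same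
congruences, which is all that θ̃ detects. -/
theorem diagCoeff_of_mem_fixSet {s : ℤ} {bA : Quo E (n + d + m + 1) → Quo E (n + d + m + 1)}
    {bC : Quo E (n + d + m + 1) → (Quo E (m + 1))ˣ}
    (hβ : IsBeta τ π d n m g.1 s bA bC) {y : Quo E (n + d + m + 1)} (hy : y ∈ fixSet bA)
    {x : star E (n + d + 1)} (hyx : quoRed E (show n + d + 1 ≤ n + d + m + 1 by omega) y = x)
    {t : 𝒪[E]ˣ} {r : 𝒪[E]}
    (htr : Represents τ π bA bC y t r) :
    diagCoeff hX h hd hn hθ g x =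
      (θ ⟨iElt τ π n π 0, iElt_mem_gammaTilde h hn π (by simp)⟩ ^ s : Kˣ) *
        θ ⟨iElt τ π n (toE t) r, iElt_mem_gammaTilde h hn _ (valuation_coe_le_one r)⟩ := by
  obtain ⟨a, b, c, H, u, rfl, hb, hc, hH, hu, hr, ht⟩ := htr
  obtain ⟨hya, a', b', ha', hb', hab'⟩ := hy
  have hN : 2 ≤ n + d + m + 1 := by obtain ⟨k, rfl⟩ := hd; omega
  have ha := (cls_mem_star_iff h hN).1 hya
  have hvb : valuation E (b : E) = valuation E (π : E) := by
    obtain ⟨h1, h2⟩ := (mem_maximalIdeal_and_iff h).2 ha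
    exact (cls_mem_star_iff h hN).1 (by rw [hb]; exact (hβ a h1 h2).1)
  have hab : (b : E) - a ∈ pp E (n + d + 1) := by
    have h1 := pp_anti (show n + d + 1 ≤ n + d + m + 1 by omega) (cls_eq_iff.1 ha')
    have h2 := pp_anti (show n + d + 1 ≤ n + d + m + 1 by omega)
      (cls_eq_iff.1 (hb.trans hb'.symm))
    have h3 : (b' : E) - a' ∈ pp E (n + d + 1) := coe_mem_pp.2 hab'
    convert add_mem (add_mem h2 h3) h1 using 1; ring
  obtain ⟨t', r', ht', hr', e, hr'', ht''⟩ := exists_pt_eq_pt_mul_iElt h hd hn hm ha hvb hab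
    (val_toE c) hH hu
  have hβe := hβ.smul_pt_eq h hn ha hb hc
  rw [e, mul_assoc] at hβe
  have hmem' : iElt τ π n t' r' ∈ gammaTilde τ π n m := iElt_mem_gammaTilde h hn t' hr'
  have hmem0 : iElt τ π n π 0 ∈ gammaTilde τ π n m := iElt_mem_gammaTilde h hn π (by simp)
  have hcoe : ((⟨_, hmem'⟩ * ⟨_, hmem0⟩ ^ s : gammaTilde τ π n m) : GL (Fin 2) E) =
      iElt τ π n t' r' * iElt τ π n π 0 ^ s := by
    rw [Subgroup.coe_mul, Subgroup.coe_zpow]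
  rw [← hcoe] at hβe
  have hax : cls (n + d + 1) a = x := (quoRed_cls _ a).symm.trans hyx
  have key := diagCoeff_eq_character hX h hd hn hm hθ g hax _ hβe
  rw [key, map_mul, map_zpow, mul_comm, Units.val_mul]
  congr 2
  refine character_iElt_congr h hn hm hθ ht' (val_toE t) hr' (valuation_coe_le_one r) ?_ ?_ _ _
  · convert sub_mem ht'' ht using 1; ring
  · convert sub_mem hr'' hr using 1; ring

theorem diagCoeff_of_notMem_fixSet {s : ℤ}
    {bA : Quo E (n + d + m + 1) → Quo E (n + d + m + 1)}
    {bC : Quo E (n + d + m + 1) → (Quo E (m + 1))ˣ}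
    (hβ : IsBeta τ π d n m g.1 s bA bC) {y : Quo E (n + d + m + 1)}
    (hys : y ∈ star E (n + d + m + 1)) (hy : y ∉ fixSet bA)
    {x : star E (n + d + 1)} (hyx : quoRed E (show n + d + 1 ≤ n + d + m + 1 by omega) y = x) :
    diagCoeff hX h hd hn hθ g x = 0 := by
  obtain ⟨a, h1, h2, rfl⟩ := id hys
  obtain ⟨b, hb⟩ : ∃ b, cls _ b = bA (cls _ a) := Ideal.Quotient.mk_surjective _
  obtain ⟨c, hc⟩ := exists_ucls_eq (by omega) (bC (cls _ a))
  have hN : 2 ≤ n + d + m + 1 := by obtain ⟨k, rfl⟩ := hd; omega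
  have ha := (cls_mem_star_iff h hN).1 hys
  have hvb : valuation E (b : E) = valuation E (π : E) :=
    (cls_mem_star_iff h hN).1 (by rw [hb]; exact (hβ a h1 h2).1)
  refine diagCoeff_eq_zero hX h hd hn hm hθ g (a := a) (b := b) hyx hvb (fun e => hy ?_)
    (val_toE c) ⟨_, iElt_zpow_mem_gammaTilde h hn s⟩ (hβ.smul_pt_eq h hn ha hb hc)
  refine ⟨hys, a, b, rfl, hb, ?_⟩
  rw [← coe_mem_pp]
  exact cls_eq_iff.1 (e.trans hyx.symm)

-- The coefficients depend on classes modulo 𝔭^(n+d+1), whereas A_g consists of classes modulo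
-- 𝔭^(n+d+m+1). Pulling the coefficient function back along the reduction multiplies its sum by q^m,
-- and the pulled-back function is supported on A_g.
include hd hθ in
theorem trace_formula {q : ℕ} (hq : q ≠ 0) (hqK : (q : K) ≠ 0)
    (hcard : ∀ k, Nat.card (Quo E k) = q ^ k) {s : ℤ}
    {bA : Quo E (n + d + m + 1) → Quo E (n + d + m + 1)}
    {bC : Quo E (n + d + m + 1) → (Quo E (m + 1))ˣ}
    (hβ : IsBeta τ π d n m g.1 s bA bC) (t : Quo E (n + d + m + 1) → 𝒪[E]ˣ)
    (r : Quo E (n + d + m + 1) → 𝒪[E])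
    (htr : ∀ a ∈ fixSet bA, Represents τ π bA bC a (t a) (r a)) :
    LinearMap.trace K (V d θ) (Xi d ι hX θ g) = ((q : K) ^ m)⁻¹ *
      ((θ ⟨iElt τ π n π 0, iElt_mem_gammaTilde h hn π (by simp)⟩ ^ s : Kˣ) : K) *
      ∑ᶠ a ∈ fixSet bA, (θ ⟨iElt τ π n (toE (t a)) (r a),
        iElt_mem_gammaTilde h hn _ (valuation_coe_le_one (r a))⟩ : K) := by
  classical
  have hfin : ∀ k, Finite (Quo E k) := fun k =>
    Nat.finite_of_card_ne_zero (by rw [hcard]; exact pow_ne_zero _ hq)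
  have := fun k => Fintype.ofFinite (Quo E k)
  have hN : 2 ≤ n + d + 1 := by obtain ⟨k, rfl⟩ := hd; omega
  have hle : n + d + 1 ≤ n + d + m + 1 := by omega
  -- Extension by zero off the classes of uniformizers, so that sums can run over the full quotient
  -- rings, whose reduction fibres all have q^m elements.
  let f : Quo E (n + d + 1) → K := fun x =>
    if hx : x ∈ star E (n + d + 1) then diagCoeff hX h hd hn hθ g ⟨x, hx⟩ else 0
  have hf0 : ∀ y ∉ fixSet bA, f (quoRed E hle y) = 0 := by
    intro y hy
    by_cases hys : quoRed E hle y ∈ star E (n + d + 1)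
    · simp only [f, dif_pos hys]
      exact diagCoeff_of_notMem_fixSet hX h hd hn hm hθ g hβ
        ((quoRed_mem_star_iff h hN hle).1 hys) hy rfl
    · simp only [f, dif_neg hys]
  have hf1 : ∀ y ∈ fixSet bA, f (quoRed E hle y) =
      (θ ⟨iElt τ π n π 0, iElt_mem_gammaTilde h hn π (by simp)⟩ ^ s : Kˣ) *
        θ ⟨iElt τ π n (toE (t y)) (r y),
          iElt_mem_gammaTilde h hn _ (valuation_coe_le_one (r y))⟩ := by
    intro y hy
    have hys : quoRed E hle y ∈ star E (n + d + 1) := (quoRed_mem_star_iff h hN hle).2 hy.1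
    simp only [f, dif_pos hys]
    exact diagCoeff_of_mem_fixSet hX h hd hn hm hθ g hβ hy rfl (htr y hy)
  have hsum : ∑ y : Quo E (n + d + m + 1), f (quoRed E hle y) =
      ((θ ⟨iElt τ π n π 0, iElt_mem_gammaTilde h hn π (by simp)⟩ ^ s : Kˣ) : K) *
      ∑ᶠ a ∈ fixSet bA, (θ ⟨iElt τ π n (toE (t a)) (r a),
        iElt_mem_gammaTilde h hn _ (valuation_coe_le_one (r a))⟩ : K) := by
    rw [mul_finsum_mem, ← finsum_mem_congr rfl hf1,
      finsum_mem_eq_toFinset_sum]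
    symm
    refine Finset.sum_subset (Finset.subset_univ _) fun y _ hy => hf0 y ?_
    simpa using hy
  have htrace : ∑ x, f x = LinearMap.trace K (V d θ) (Xi d ι hX θ g) := by
    rw [trace_Xi hX h hd hn hm hθ g,
      ← Finset.sum_subset (Finset.subset_univ (Finset.univ.filter (· ∈ star E (n + d + 1))))
        (fun x _ hx => dif_neg (by simpa using hx)),
      Finset.sum_subtype _ (p := (· ∈ star E (n + d + 1))) (by simp)]
    exact Finset.sum_congr rfl fun x _ => dif_pos x.2
  rw [sum_comp_quoRed hq hcard hle (i := m) (by omega), htrace] at hsum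
  rw [mul_assoc, ← hsum, inv_mul_cancel_left₀ (pow_ne_zero _ hqK)]

end Trace


/-! ### Deriving the valuation properties from π² + Δπ + ϖ = 0 -/

section Extension

variable {F E : Type*} [Field F] [Field E] [Algebra F E] [ValuativeRel E]

variable {ϖ Δ : F} {π : Eˣ} {d : ℕ}

/-- The Eisenstein argument: if |π| ≥ 1, then π² = −(Δπ + ϖ) would have valuation below |π|, a
contradiction. Once |π| < 1, the term ϖ dominates Δπ. -/
theorem val_sq_eq_of_minpoly (h1 : valuation E (algebraMap F E ϖ) < 1)
    {e : ℕ} (he : 1 ≤ e)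
    (hΔ : valuation E (algebraMap F E Δ) = valuation E (algebraMap F E ϖ) ^ e)
    (hϖ0 : ϖ ≠ 0)
    (hπ : (π : E) ^ 2 + algebraMap F E Δ * π + algebraMap F E ϖ = 0) :
    valuation E (π : E) < 1 ∧ valuation E (π : E) ^ 2 = valuation E (algebraMap F E ϖ) := by
  have hp0 : 0 < valuation E (π : E) := by simp [zero_lt_iff]
  have hγ0 : 0 < valuation E (algebraMap F E ϖ) := by simp [zero_lt_iff, hϖ0]
  have hΔ1 : valuation E (algebraMap F E Δ) ≤ valuation E (algebraMap F E ϖ) := by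
    rw [hΔ]
    calc _ ≤ valuation E (algebraMap F E ϖ) ^ 1 := pow_le_pow_of_le_one hγ0.le h1.le he
      _ = _ := pow_one _
  have heq : valuation E (π : E) ^ 2 =
      valuation E (algebraMap F E Δ * π + algebraMap F E ϖ) := by
    rw [← map_pow, ← Valuation.map_neg _ ((π : E) ^ 2)]
    congr 1
    linear_combination -hπ
  have hlt : valuation E (π : E) < 1 := by
    by_contra! hge
    have hle : valuation E (π : E) ≤ valuation E (π : E) ^ 2 := by
      rw [pow_two]; exact le_mul_of_one_le_right' hge
    have hb : valuation E (algebraMap F E Δ * π + algebraMap F E ϖ) < valuation E (π : E) := by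
      refine Valuation.map_add_lt _ ?_ (h1.trans_le hge)
      rw [map_mul]
      exact mul_lt_of_lt_one_left hp0 (hΔ1.trans_lt h1)
    exact absurd (heq ▸ hle) hb.not_ge
  refine ⟨hlt, ?_⟩
  rw [heq, Valuation.map_add_eq_of_lt_right]
  rw [map_mul]
  by_cases hz : valuation E (algebraMap F E Δ) = 0
  · rw [hz, zero_mul]; exact hγ0
  · exact (mul_lt_of_lt_one_right (zero_lt_iff.2 hz) hlt).trans_le hΔ1

section

variable (h0 : ∀ x : F, x ≠ 0 → ∃ k : ℤ,
  valuation E (algebraMap F E x) = valuation E (π : E) ^ (2 * k))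
  (hlt : valuation E (π : E) < 1)
include h0 hlt

theorem val_mul_ne_of_even (x y : F) (hx : x ≠ 0) :
    valuation E (algebraMap F E x) ≠ valuation E (algebraMap F E y * π) := by
  intro e
  have hp0 : 0 < valuation E (π : E) := by simp [zero_lt_iff]
  have hy : y ≠ 0 := by
    rintro rfl
    simp [hx] at e
  obtain ⟨k, hk⟩ := h0 x hx
  obtain ⟨l, hl⟩ := h0 y hy
  rw [map_mul, hk, hl, ← zpow_add_one₀ hp0.ne', zpow_right_inj₀ hp0 hlt.ne] at e
  omega

theorem val_add_mul_of_even (x y : F) :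
    valuation E (algebraMap F E x + algebraMap F E y * π) =
      max (valuation E (algebraMap F E x)) (valuation E (algebraMap F E y * π)) := by
  by_cases hx : x = 0
  · simp [hx]
  · exact Valuation.map_add_of_distinct_val _ (val_mul_ne_of_even h0 hlt x y hx)

/-- The values of x and yπ have different parity, so 1 and π are linearly independent over F and
hence span E. -/
theorem exists_eq_add_mul_of_even (hFE : Module.finrank F E = 2) (u : E) :
    ∃ x y : F, u = algebraMap F E x + algebraMap F E y * π := by
  have hli : LinearIndependent F ![(1 : E), (π : E)] := by
    rw [LinearIndependent.pair_iff]
    intro x y hxy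
    rw [Algebra.smul_def, Algebra.smul_def, mul_one] at hxy
    have hv := val_add_mul_of_even h0 hlt x y
    rw [hxy, map_zero, eq_comm, ← bot_eq_zero, max_eq_bot, bot_eq_zero] at hv
    simpa using hv
  have hspan := hli.span_eq_top_of_card_eq_finrank (by simp [hFE])
  have hu : u ∈ Submodule.span F (Set.range ![(1 : E), (π : E)]) := hspan ▸ Submodule.mem_top
  rw [Matrix.range_cons, Matrix.range_cons, Matrix.range_empty, Set.union_empty,
    Set.singleton_union, Submodule.mem_span_pair] at hu
  obtain ⟨x, y, e⟩ := hu
  exact ⟨x, y, by rw [← e, Algebra.smul_def, Algebra.smul_def, mul_one]⟩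

end

/-- All properties come from u = x + yπ with |u| = max(|x|, |yπ|) together with τ(u) + u = yΔ and
|Δ| = |π|^(d+1). -/
theorem isWildOver_of_val (h2 : (2 : E) = 0) (hFE : Module.finrank F E = 2) (hd : Odd d)
    (hϖ0 : ϖ ≠ 0) (h1 : valuation E (algebraMap F E ϖ) < 1)
    (hF : ∀ x : F, x ≠ 0 → ∃ k : ℤ,
      valuation E (algebraMap F E x) = valuation E (algebraMap F E ϖ) ^ k)
    (hΔ : valuation E (algebraMap F E Δ) = valuation E (algebraMap F E ϖ) ^ ((d + 1) / 2))
    (hπ : (π : E) ^ 2 + algebraMap F E Δ * π + algebraMap F E ϖ = 0)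
    {τ : E ≃ₐ[F] E} (hτ : τ ≠ 1) : IsWildOver τ π d ϖ Δ := by
  obtain ⟨hlt, hsq⟩ := val_sq_eq_of_minpoly h1 (by obtain ⟨k, rfl⟩ := hd; omega) hΔ hϖ0 hπ
  have hp0 : 0 < valuation E (π : E) := by simp [zero_lt_iff]
  have hev : ∀ x : F, x ≠ 0 → ∃ k : ℤ,
      valuation E (algebraMap F E x) = valuation E (π : E) ^ (2 * k) := by
    intro x hx
    obtain ⟨k, hk⟩ := hF x hx
    exact ⟨k, by rw [hk, ← hsq, ← zpow_natCast, ← zpow_mul]; rfl⟩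
  have hΔv : valuation E (algebraMap F E Δ) = valuation E (π : E) ^ (d + 1) := by
    rw [hΔ, ← hsq, ← pow_mul]
    congr 1
    obtain ⟨k, rfl⟩ := hd
    omega
  have hadd := exists_eq_add_mul_of_even hev hlt hFE
  have hmax := val_add_mul_of_even hev hlt
  have hτπ : τ π = π + algebraMap F E Δ := by
    have hmp := congrArg τ hπ
    rw [map_add, map_add, map_mul, map_pow, τ.commutes, τ.commutes, map_zero] at hmp
    -- The other root is π + Δ in characteristic 2; τ cannot fix π, because it would then fix E = F
    -- + Fπ.
    have hfac : (τ π - π) * (τ π + π + algebraMap F E Δ) = 0 := by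
      linear_combination hmp - hπ
    rcases mul_eq_zero.1 hfac with e | e
    · refine absurd (AlgEquiv.ext fun u => ?_) hτ
      obtain ⟨x, y, rfl⟩ := hadd u
      rw [map_add, map_mul, τ.commutes, τ.commutes, sub_eq_zero.1 e]
      rfl
    · linear_combination e - (π + algebraMap F E Δ) * h2
  have hτu : ∀ x y : F, τ (algebraMap F E x + algebraMap F E y * π) =
      algebraMap F E x + algebraMap F E y * π + algebraMap F E y * algebraMap F E Δ := by
    intro x y
    rw [map_add, map_mul, τ.commutes, τ.commutes, hτπ]
    ring
  have hsum : ∀ x y : F, τ (algebraMap F E x + algebraMap F E y * π) +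
      (algebraMap F E x + algebraMap F E y * π) = algebraMap F E y * algebraMap F E Δ := by
    intro x y
    rw [hτu]
    linear_combination (algebraMap F E x + algebraMap F E y * π) * h2
  have hle : ∀ u, valuation E (τ u + u) ≤ valuation E (π : E) ^ d * valuation E u := by
    intro u
    obtain ⟨x, y, rfl⟩ := hadd u
    rw [hsum, hmax, map_mul, map_mul, hΔv, pow_succ']
    calc _ = valuation E (π : E) ^ d * (valuation E (algebraMap F E y) * valuation E (π : E)) := by
          ac_rfl
      _ ≤ _ := by gcongr; exact le_max_right _ _
  exact
    { two_eq_zero := h2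
      lt_one := hlt
      exists_zpow := by
        intro u hu
        obtain ⟨x, y, rfl⟩ := hadd u
        rw [hmax]
        rcases max_choice (valuation E (algebraMap F E x)) (valuation E (algebraMap F E y * π))
          with e | e
        · obtain ⟨k, hk⟩ := hev x (by
            rintro rfl
            rw [map_zero, map_zero, max_eq_left_iff, le_zero_iff] at e
            exact hu (by simpa using e))
          exact ⟨2 * k, by rw [e, hk]⟩
        · obtain ⟨k, hk⟩ := hev y (by
            rintro rfl
            rw [map_zero, zero_mul, map_zero, max_eq_right_iff, le_zero_iff] at e
            exact hu (by simpa using e))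
          exact ⟨2 * k + 1, by rw [e, map_mul, hk, zpow_add_one₀ hp0.ne']⟩
      val_tau := by
        intro u
        by_cases hu : u = 0
        · simp [hu]
        have hlt' : valuation E (τ u + u) < valuation E (-u) := by
          rw [Valuation.map_neg]
          refine (hle u).trans_lt (mul_lt_of_lt_one_left (by simp [zero_lt_iff, hu]) ?_)
          exact pow_lt_one₀ hp0.le hlt (by rintro rfl; simp at hd)
        have e : τ u = (τ u + u) + -u := by ring
        rw [e, Valuation.map_add_eq_of_lt_right _ hlt', Valuation.map_neg]
      tau_tau := by
        intro u
        obtain ⟨x, y, rfl⟩ := hadd u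
        rw [hτu, map_add, hτu, map_mul, τ.commutes, τ.commutes]
        linear_combination (algebraMap F E y * algebraMap F E Δ) * h2
      val_tau_add_le := hle
      val_tau_add_eq := by
        intro u hu
        obtain ⟨x, y, rfl⟩ := hadd u
        rw [hsum, map_mul, hΔv]
        rw [hmax] at hu
        rcases max_choice (valuation E (algebraMap F E x)) (valuation E (algebraMap F E y * π))
          with e | e
        -- An element with the valuation of π cannot have x as its dominant term, by parity; in the
        -- other case |y| = 1.
        · rw [e] at hu
          have hx : x ≠ 0 := by
            rintro rfl
            rw [map_zero, map_zero] at hu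
            exact hp0.ne hu
          refine absurd ?_ (val_mul_ne_of_even hev hlt x 1 hx)
          simpa using hu
        · rw [e, map_mul, mul_eq_right₀ hp0.ne'] at hu
          rw [hu, one_mul]
      val_uniformizer := hsq.symm
      minpoly := hπ
      tau_pi_eq := hτπ
      exists_eq_add := hadd
      val_le_sq := by
        intro x hx
        by_cases hx0 : x = 0
        · simp [hx0]
        obtain ⟨k, hk⟩ := hF x hx0
        have hγ0 : 0 < valuation E (algebraMap F E ϖ) := by simp [zero_lt_iff, hϖ0]
        rw [hk, ← zpow_zero (valuation E (algebraMap F E ϖ)),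
          zpow_lt_zpow_iff_right_of_lt_one₀ hγ0 h1] at hx
        rw [hk, hsq]
        calc _ ≤ valuation E (algebraMap F E ϖ) ^ (1 : ℤ) :=
              (zpow_le_zpow_iff_right_of_lt_one₀ hγ0 h1).2 (by omega)
          _ = _ := zpow_one _ }

theorem exists_val_eq_zpow [ValuativeRel F] [IsDiscreteValuationRing 𝒪[F]] {ϖ : 𝒪[F]}
    (hϖ : Irreducible ϖ) {x : F} (hx : x ≠ 0) :
    ∃ k : ℤ, valuation F x = valuation F (ϖ : F) ^ k := by
  have hint : ∀ y : 𝒪[F], y ≠ 0 → ∃ k : ℕ, valuation F (y : F) = valuation F (ϖ : F) ^ k := by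
    intro y hy
    obtain ⟨k, u, e⟩ := IsDiscreteValuationRing.eq_unit_mul_pow_irreducible hy hϖ
    have hu : valuation F ((u : 𝒪[F]) : F) = 1 :=
      (Valuation.integer.integers (valuation F)).isUnit_iff_valuation_eq_one.1 u.isUnit
    refine ⟨k, ?_⟩
    have e' : (y : F) = (u : 𝒪[F]) * (ϖ : F) ^ k := congrArg Subtype.val e
    rw [e', map_mul, hu, one_mul, map_pow]
  rcases le_total (valuation F x) 1 with hle | hle
  · obtain ⟨k, hk⟩ := hint ⟨x, hle⟩ fun e => hx (congrArg Subtype.val e)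
    exact ⟨k, by rw [zpow_natCast]; exact hk⟩
  · have hle' : valuation F x⁻¹ ≤ 1 := by
      rw [map_inv₀]; exact inv_le_one_of_one_le₀ hle
    obtain ⟨k, hk⟩ := hint ⟨x⁻¹, hle'⟩ fun e => inv_ne_zero hx (congrArg Subtype.val e)
    have hk' : valuation F x⁻¹ = valuation F (ϖ : F) ^ k := hk
    exact ⟨-k, by rw [zpow_neg, zpow_natCast, ← hk', map_inv₀, inv_inv]⟩

theorem isWildOver [ValuativeRel F] [IsDiscreteValuationRing 𝒪[F]] [CharP F 2]
    [ValuativeExtension F E] (hFE : Module.finrank F E = 2) (hd : Odd d)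
    {ϖ : 𝒪[F]} (hϖ : Irreducible ϖ) {Δ : F}
    (hΔ : valuation F Δ = valuation F (ϖ : F) ^ ((d + 1) / 2))
    (hπ : (π : E) ^ 2 + algebraMap F E Δ * π + algebraMap F E ϖ = 0)
    {τ : E ≃ₐ[F] E} (hτ : τ ≠ 1) : IsWildOver τ π d (ϖ : F) Δ := by
  have hval : ∀ x : F, valuation E (algebraMap F E x) =
      ValuativeExtension.mapValueGroupWithZero F E (valuation F x) := fun x =>
    (ValuativeExtension.mapValueGroupWithZero_valuation x).symm
  have hϖ1 : valuation F (ϖ : F) < 1 :=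
    lt_of_le_of_ne ϖ.2 fun e => hϖ.not_isUnit
      ((Valuation.integer.integers (valuation F)).isUnit_iff_valuation_eq_one.2 e)
  refine isWildOver_of_val ?_ hFE hd (fun e => hϖ.ne_zero (Subtype.ext e)) ?_ (fun x hx => ?_) ?_
    hπ hτ
  · rw [← map_ofNat (algebraMap F E) 2, ← Nat.cast_ofNat, CharP.cast_eq_zero, map_zero]
  · rw [hval, ← map_one (ValuativeExtension.mapValueGroupWithZero F E)]
    exact ValuativeExtension.mapValueGroupWithZero_strictMono hϖ1
  · obtain ⟨k, hk⟩ := exists_val_eq_zpow hϖ hx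
    exact ⟨k, by rw [hval, hval, hk, map_zpow₀]⟩
  · rw [hval, hval, hΔ, map_pow]

end Extension

end WildGL2

end

/-! ### The trace formula -/

theorem mainTheorem10
    {F E : Type*} [Field F] [ValuativeRel F] [TopologicalSpace F] [IsNonarchimedeanLocalField F]
    [CharP F 2] [Field E] [Algebra F E] [ValuativeRel E] [ValuativeExtension F E]
    (hFE : Module.finrank F E = 2)
    (d n m : ℕ) (hd : Odd d) (hdn : d < 2 * n) (hm : m + 1 = 2 * n + d)
    (ϖ : 𝒪[F]) (hϖ : Irreducible ϖ) (Δ : F)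
    (hΔ : valuation F Δ = valuation F (ϖ : F) ^ ((d + 1) / 2))
    (π : Eˣ) (hπ : (π : E) ^ 2 + algebraMap F E Δ * π + algebraMap F E ϖ = 0)
    (τ : E ≃ₐ[F] E) (hτ : τ ≠ 1)
    (ι : E →ₐ[F] Matrix (Fin 2) (Fin 2) F) (hι : ι π = !![Δ, 1; (ϖ : F), 0])
    (ℓ : ℕ) [Fact ℓ.Prime]
    (θ : WildGL2.gammaTilde τ π n m →* (AlgebraicClosure ℚ_[ℓ])ˣ)
    (hθ : WildGL2.TrivialOnLevel θ) :
    ∃ (hΓ : ∀ (t : Eˣ) (r : 𝒪[E]), WildGL2.iElt τ π n t r ∈ WildGL2.gammaTilde τ π n m)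
      (hX : ∀ g ∈ WildGL2.torusIwahori ι, ∀ y ∈ WildGL2.XTilde τ π d n m,
        WildGL2.toGLE (E := E) g • y ∈ WildGL2.XTilde τ π d n m),
      Module.Finite (AlgebraicClosure ℚ_[ℓ]) (WildGL2.V d θ) ∧
      ∀ (g : WildGL2.torusIwahori ι) (s : ℤ),
        valuation F ((g : GL (Fin 2) F) : Matrix (Fin 2) (Fin 2) F).det =
          valuation F (ϖ : F) ^ s →
        (∃ bA bC, WildGL2.IsBeta τ π d n m (g : GL (Fin 2) F) s bA bC) ∧
        ∀ bA bC, WildGL2.IsBeta τ π d n m (g : GL (Fin 2) F) s bA bC →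
          (WildGL2.fixSet bA).Finite ∧
          ∀ (t : WildGL2.Quo E (n + d + m + 1) → 𝒪[E]ˣ)
            (r : WildGL2.Quo E (n + d + m + 1) → 𝒪[E]),
            (∀ a ∈ WildGL2.fixSet bA, WildGL2.Represents τ π bA bC a (t a) (r a)) →
            LinearMap.trace (AlgebraicClosure ℚ_[ℓ]) (WildGL2.V d θ) (WildGL2.Xi d ι hX θ g) =
              ((Nat.card 𝓀[F] : AlgebraicClosure ℚ_[ℓ]) ^ m)⁻¹ *
                ((θ ⟨WildGL2.iElt τ π n π 0, by simpa using hΓ π 0⟩ ^ s :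
                  (AlgebraicClosure ℚ_[ℓ])ˣ) : AlgebraicClosure ℚ_[ℓ]) *
                ∑ᶠ a ∈ WildGL2.fixSet bA,
                  (θ ⟨WildGL2.iElt τ π n (WildGL2.toE (t a)) (r a), hΓ _ _⟩ :
                    AlgebraicClosure ℚ_[ℓ]) := by
  have h := WildGL2.isWildOver hFE hd hϖ hΔ hπ hτ
  have hn : 1 ≤ n := by omega
  have hcard := WildGL2.card_quo h
  have hq : Nat.card 𝓀[F] ≠ 0 := Nat.card_pos.ne'
  have hfin : ∀ k, Finite (WildGL2.Quo E k) := fun k =>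
    Nat.finite_of_card_ne_zero (by rw [hcard]; exact pow_ne_zero _ hq)
  refine ⟨fun t r => WildGL2.iElt_mem_gammaTilde h.toIsWild hn t (WildGL2.valuation_coe_le_one r),
    fun g hg y hy => ?_, WildGL2.finite_V h.toIsWild hd hn hm, fun g s hs => ⟨?_, ?_⟩⟩
  · obtain ⟨s, -, hs⟩ := WildGL2.movesCell_of_mem h hd hn hι hg
    exact WildGL2.smul_mem_XTilde h.toIsWild hd hn hs hy
  · exact WildGL2.exists_isBeta h.toIsWild hd hn
      (WildGL2.movesCell_of_mem_of_val h hd hn hι g.2 hs)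
  · intro bA bC hβ
    exact ⟨Set.toFinite _, fun t r htr => WildGL2.trace_formula _ h.toIsWild hd hn hm hθ g hq
      (Nat.cast_ne_zero.2 hq) hcard hβ t r htr⟩
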